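/- A plane graph is a finite simple graph drawn in $\mathbb{R}^2$: its vertices are distinct points, its edges are polygonal arcs joining their two end-vertices, and the interior of an edge contains no vertex and no point of any other edge. Its faces are the connected components of the complement of the drawing. A pentagulation is a plane graph in which the boundary of every face is a cycle of length 5. For a cycle $C$ of a plane graph, $\mathrm{Int}(C)$ is the bounded region of $\mathbb{R}^2\setminus C$ and $\mathrm{Int}[C]=\mathrm{Int}(C)\cup C$; $C$ dominates its interior if every vertex in $\mathrm{Int}(C)$ is adjacent to a vertex of $C$. Theorem. Let $G$ be a pentagulation and let $C$ be a 4-cycle in $G$ that dominates its interior. Then there are two vertices $u\neq v$ of $C$ that are not adjacent in $C$, and an integer $k\ge 1$, such that the subgraph of $G$ formed by all vertices and edges of $G$ that lie in the closed region $\mathrm{Int}[C]$ consists of exactly (1) the cycle $C$, (2) $k$ $u$–$v$ paths $A_1,\dots,A_k$ of length 3, and (3) $k-1$ $u$–$v$ paths $B_1,\dots,B_{k-1}$ of length 2. All the paths in (2) and (3) are internally disjoint and contain no vertex of $C-\{u,v\}$, and the paths of length 3 and 2 alternate: if $B_0$ and $B_k$ denote the two $u$–$v$ paths of $C$, suitably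 labelled, then in the sequence $B_0,A_1,B_1,A_2,B_2,\dots,A_k,B_k$ the union of any two consecutive paths is the boundary of a face of $G$ contained in $\mathrm{Int}(C)$. -/

import Mathlib

/-- The Euclidean plane. -/
abbrev Plane : Type := EuclideanSpace ℝ (Fin 2)

/-- `A` is a polygonal arc from `x` to `y`: the union of finitely many nondegenerate segments
`[p 0, p 1], [p 1, p 2], …, [p (n - 1), p n]` with `p 0 = x` and `p n = y`, where consecutive
segments meet only in their common endpoint and all other pairs of segments are disjoint. -/
def IsPolygonalArc (A : Set Plane) (x y : Plane) : Prop :=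
  ∃ (n : ℕ) (p : ℕ → Plane),
    0 < n ∧ p 0 = x ∧ p n = y ∧
    (∀ i, i < n → p i ≠ p (i + 1)) ∧
    (∀ i, i + 1 < n →
      segment ℝ (p i) (p (i + 1)) ∩ segment ℝ (p (i + 1)) (p (i + 2)) = {p (i + 1)}) ∧
    (∀ i j, i + 1 < j → j < n →
      Disjoint (segment ℝ (p i) (p (i + 1))) (segment ℝ (p j) (p (j + 1)))) ∧
    A = {z | ∃ i, i < n ∧ z ∈ segment ℝ (p i) (p (i + 1))}

theorem IsPolygonalArc.left_mem {A : Set Plane} {x y : Plane} (h : IsPolygonalArc A x y) :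
    x ∈ A := by
  obtain ⟨n, p, hn, rfl, -, -, -, -, rfl⟩ := h
  exact ⟨0, hn, left_mem_segment ℝ _ _⟩

theorem IsPolygonalArc.right_mem {A : Set Plane} {x y : Plane} (h : IsPolygonalArc A x y) :
    y ∈ A := by
  obtain ⟨n, p, hn, -, rfl, -, -, -, rfl⟩ := h
  refine ⟨n - 1, by omega, ?_⟩
  have h1 : n - 1 + 1 = n := by omega
  rw [h1]
  exact right_mem_segment ℝ _ _

/-- A plane graph with vertex set `V`: a simple graph drawn in the plane, with distinct points as
vertices and polygonal arcs as edges, such that the interior of an edge contains no vertex and no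
point of another edge. The value of `arc` matters only at the edges of the graph. -/
structure PlaneGraph (V : Type*) where
  graph : SimpleGraph V
  pos : V → Plane
  arc : Sym2 V → Set Plane
  pos_injective : Function.Injective pos
  arc_isArc : ∀ u v : V, graph.Adj u v → IsPolygonalArc (arc s(u, v)) (pos u) (pos v)
  vertex_of_mem_arc : ∀ e ∈ graph.edgeSet, ∀ w : V, pos w ∈ arc e → w ∈ e
  endpoint_of_mem_arcs : ∀ e ∈ graph.edgeSet, ∀ e' ∈ graph.edgeSet, e ≠ e' →
    ∀ x ∈ arc e, x ∈ arc e' → ∃ w ∈ e, x = pos w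

namespace PlaneGraph

variable {V : Type*} (G : PlaneGraph V)

/-- The point set of a plane graph. -/
def pointSet : Set Plane :=
  Set.range G.pos ∪ {x | ∃ e ∈ G.graph.edgeSet, x ∈ G.arc e}

/-- The faces: the connected components of the complement of the point set. -/
def IsFace (F : Set Plane) : Prop :=
  ∃ x ∈ G.pointSetᶜ, F = connectedComponentIn G.pointSetᶜ x

/-- The point set of a walk (of positive length): the union of the arcs of its edges. -/
def walkSet {a b : V} (p : G.graph.Walk a b) : Set Plane :=
  {x | ∃ e ∈ p.edges, x ∈ G.arc e}

/-- Every face is bounded by a cycle of length 5. -/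
def IsPentagulation : Prop :=
  ∀ F : Set Plane, G.IsFace F →
    ∃ (a : V) (c : G.graph.Walk a a), c.IsCycle ∧ c.length = 5 ∧ frontier F = G.walkSet c

/-- `Int(C)`: the points off `C` whose component in the complement of `C` is bounded. -/
def openInside {a : V} (C : G.graph.Walk a a) : Set Plane :=
  {x | x ∉ G.walkSet C ∧ Bornology.IsBounded (connectedComponentIn (G.walkSet C)ᶜ x)}

/-- `Int[C] = Int(C) ∪ C`. -/
def closedInside {a : V} (C : G.graph.Walk a a) : Set Plane :=
  G.openInside C ∪ G.walkSet C

/-- Every vertex in `Int(C)` is adjacent to a vertex of `C`. -/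
def DominatesInterior {a : V} (C : G.graph.Walk a a) : Prop :=
  ∀ w : V, G.pos w ∈ G.openInside C → ∃ c ∈ C.support, G.graph.Adj c w

/-- `G[Int[C]]`: the subgraph of the vertices and edges of `G` that lie in the closed region
`Int[C]`. -/
def insideSubgraph {a : V} (C : G.graph.Walk a a) : G.graph.Subgraph where
  verts := {w | G.pos w ∈ G.closedInside C}
  Adj x y := G.graph.Adj x y ∧ G.arc s(x, y) ⊆ G.closedInside C
  adj_sub h := h.1
  edge_vert h := h.2 (G.arc_isArc _ _ h.1).left_mem
  symm := ⟨fun x y h => ⟨h.1.symm, by rw [Sym2.eq_swap]; exact h.2⟩⟩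

/-- The two walks with the same ends have no vertex in common except for these ends. -/
def InternallyDisjoint {u v : V} (p q : G.graph.Walk u v) : Prop :=
  ∀ w ∈ p.support, w ∈ q.support → w = u ∨ w = v

/-- The union of `p` and `q` is the boundary of a face of `G` that lies in `Int(C)`. -/
def BoundFaceInside {a u v : V} (C : G.graph.Walk a a) (p q : G.graph.Walk u v) : Prop :=
  ∃ F : Set Plane, G.IsFace F ∧ F ⊆ G.openInside C ∧ frontier F = G.walkSet p ∪ G.walkSet q

end PlaneGraph

/-! Topology and combinatorics are separated by `FaceSystem`: boundaries of faces are 5-cycles,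
every edge has exactly two faces, every closed walk has an inside, and the faces are connected
across edges. Everything about domination is proved from these facts alone.

Combinatorics. Take a cycle of length ℓ that dominates its interior, with f faces and m edges
inside. Counting edges of faces gives 5f = ℓ + 2m (`five_mul_ncard`). Suppose first that the cycle
has no chord inside and that no inside vertex has two neighbours on it. Call an inner edge a spoke
if it has an end on the cycle, and a link otherwise. A pentagon carries at most two spokes and a
spoke lies on two pentagons, so there are at most f spokes (`ncard_spokes_le`). If ℓ ≤ 4, a link can
be closed up through the cycle to a closed walk that uses no other link, since both its ends are
dominated. This walk separates the two faces of the link, so in the dual graph every link is a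
bridge; hence the links form a forest on f faces and number at most f - 1 (`ncard_links_lt`). Thus
5f ≤ ℓ + 2(2f - 1), that is, f ≤ ℓ - 2. For ℓ = 3 this is absurd. For ℓ = 4 it leaves two faces
separated by one path of length 3, which is the case k = 1.

In general one uses induction on f, for triangles and 4-cycles together
(`not_dominates_three_and_strip`). Domination passes to every cycle in the closed interior. A chord,
or an inside vertex with two consecutive neighbours on the cycle, therefore yields a smaller
dominating triangle, which is impossible. An inside vertex w adjacent to two opposite vertices u, v
splits the 4-cycle into two smaller ones, both filled by strips. Their poles are u and v: if w were
a pole, some vertex inside would have w as its only neighbour on the smaller cycle and would not be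
dominated by the original one. The two strips are then glued along the path u, w, v (`Strip.glue`).

Topology. Off a polygonal arc from p to q, the ratio (q - w)/(p - w) has a continuous square root in
w that tends to 1 at infinity and changes sign across the arc (`exists_root`). Around a closed walk
the product of these roots has square 1. It is a locally constant sign that equals 1 far away and
changes across an edge according to the parity of its use. The faces of sign -1 are the inside, and
for a cycle they fill exactly the bounded components of its complement (`isBounded_component_iff`).
-/

/-- The edges of the closed polygon with consecutive vertices `c 0, c 1, …`. -/
def cyclicEdges {V : Type*} {ℓ : ℕ} [NeZero ℓ] (c : Fin ℓ → V) : Set (Sym2 V) :=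
  {e | ∃ i, e = s(c i, c (i + 1))}

/-- The combinatorial data carried by the faces of a pentagulation: their boundaries are
5-cycles, every edge bounds exactly two faces, every closed walk separates the faces into an
inside and an outside, and no proper nonempty set of faces has an empty boundary. -/
structure FaceSystem {V : Type*} (G : SimpleGraph V) (Φ : Type*) where
  bd : Φ → Set (Sym2 V)
  out : Φ
  bd_subset : ∀ F, bd F ⊆ G.edgeSet
  pent : ∀ F, ∃ v : Fin 5 → V, Function.Injective v ∧ bd F = cyclicEdges v
  two : ∀ e ∈ G.edgeSet, ∃ F F', F ≠ F' ∧ ∀ X, e ∈ bd X ↔ X = F ∨ X = F'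
  fill : ∀ (ℓ : ℕ) [NeZero ℓ] (c : Fin ℓ → V), (∀ i, G.Adj (c i) (c (i + 1))) →
    ∃ S : Set Φ, out ∉ S ∧
      (∀ e F F', F ≠ F' → e ∈ bd F → e ∈ bd F' →
        ((F ∈ S ↔ F' ∈ S) ↔ Even {i | s(c i, c (i + 1)) = e}.ncard)) ∧
      ∀ w ∉ Set.range c, ∀ F F', (∃ e ∈ bd F, w ∈ e) → (∃ e ∈ bd F', w ∈ e) → F ∈ S → F' ∈ S
  conn : ∀ S : Set Φ, (∀ e F F', e ∈ bd F → e ∈ bd F' → F ∈ S → F' ∈ S) → S = ∅ ∨ S = Set.univ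

/-! ### Cyclic sequences and their edges. -/

section Cyclic

variable {V : Type*} {ℓ : ℕ} [NeZero ℓ]

theorem Fin.add_one_ne_self_of_two_le (hℓ : 2 ≤ ℓ) (i : Fin ℓ) : i + 1 ≠ i := by
  obtain ⟨m, rfl⟩ : ∃ m, ℓ = m + 2 := ⟨ℓ - 2, by omega⟩
  intro h
  simp at h

theorem Fin.add_one_add_one_ne_self (hℓ : 3 ≤ ℓ) (i : Fin ℓ) : i + 1 + 1 ≠ i := by
  obtain ⟨m, rfl⟩ : ∃ m, ℓ = m + 3 := ⟨ℓ - 3, by omega⟩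
  intro h
  rw [add_assoc] at h
  have h1 : (1 : Fin (m + 3)) + 1 = 0 := by simpa using h
  have := congrArg Fin.val h1
  rw [Fin.val_add] at this
  simp only [Fin.val_one', Fin.val_zero] at this
  rw [Nat.mod_eq_of_lt (show 1 < m + 3 by omega), Nat.mod_eq_of_lt (by omega)] at this
  omega

theorem mem_cyclicEdges_self (c : Fin ℓ → V) (i : Fin ℓ) : s(c i, c (i + 1)) ∈ cyclicEdges c :=
  ⟨i, rfl⟩

theorem mem_range_of_mem_cyclicEdges {c : Fin ℓ → V} {e : Sym2 V} (he : e ∈ cyclicEdges c)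
    {w : V} (hw : w ∈ e) : w ∈ Set.range c := by
  obtain ⟨i, rfl⟩ := he
  rcases Sym2.mem_iff.1 hw with rfl | rfl
  exacts [⟨_, rfl⟩, ⟨_, rfl⟩]

theorem cyclicEdge_injective (hℓ : 3 ≤ ℓ) {c : Fin ℓ → V} (hc : Function.Injective c) :
    Function.Injective fun i => s(c i, c (i + 1)) := by
  intro i j h
  rcases Sym2.eq_iff.1 h with ⟨h1, -⟩ | ⟨h1, h2⟩
  · exact hc h1
  · have h1 := hc h1
    have h2 := hc h2
    subst h1
    exact absurd h2 (Fin.add_one_add_one_ne_self hℓ j)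

theorem ncard_cyclicEdges (hℓ : 3 ≤ ℓ) {c : Fin ℓ → V} (hc : Function.Injective c) :
    (cyclicEdges c).ncard = ℓ := by
  have : cyclicEdges c = Set.range fun i => s(c i, c (i + 1)) := by
    ext e; simp [cyclicEdges, eq_comm]
  rw [this, ← Set.image_univ, Set.ncard_image_of_injective _ (cyclicEdge_injective hℓ hc)]
  simp

theorem cyclicEdges_at {c : Fin ℓ → V} (hc : Function.Injective c) {e : Sym2 V}
    (he : e ∈ cyclicEdges c) {i : Fin ℓ} (hi : c (i + 1) ∈ e) :
    e = s(c i, c (i + 1)) ∨ e = s(c (i + 1), c (i + 1 + 1)) := by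
  obtain ⟨j, rfl⟩ := he
  rcases Sym2.mem_iff.1 hi with h | h
  · right; rw [hc h]
  · left; rw [add_right_cancel (hc h)]

theorem cyclicEdges_comp_add (c : Fin ℓ → V) (k : Fin ℓ) :
    cyclicEdges (fun i => c (i + k)) = cyclicEdges c := by
  ext e
  constructor
  · rintro ⟨i, rfl⟩
    exact ⟨i + k, by simp only [add_right_comm]⟩
  · rintro ⟨i, rfl⟩
    exact ⟨i - k, by simp only [sub_add_cancel, add_right_comm _ 1 k]⟩

theorem cyclicEdges_comp_sub (c : Fin ℓ → V) (k : Fin ℓ) :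
    cyclicEdges (fun i => c (k - i)) = cyclicEdges c := by
  ext e
  constructor
  · rintro ⟨i, rfl⟩
    refine ⟨k - i - 1, ?_⟩
    rw [Sym2.eq_swap, show k - i - 1 + 1 = k - i by abel, sub_sub]
  · rintro ⟨i, rfl⟩
    refine ⟨k - i - 1, ?_⟩
    rw [Sym2.eq_swap]
    congr 2 <;> abel_nf

theorem Fin.forall_of_forall_imp_add_one {P : Fin ℓ → Prop} (h : ∀ i, P i → P (i + 1))
    {i : Fin ℓ} (hi : P i) (j : Fin ℓ) : P j := by
  obtain ⟨m, rfl⟩ : ∃ m, ℓ = m + 1 := ⟨ℓ - 1, by have := NeZero.ne ℓ; omega⟩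
  have key : ∀ k : Fin (m + 1), P (i + k) := by
    intro k
    induction k using Fin.induction with
    | zero => simpa using hi
    | succ k ih => rw [← Fin.coeSucc_eq_succ, ← add_assoc]; exact h _ ih
  simpa using key (j - i)

end Cyclic

/-! ### Boundaries of sets of faces, modulo 2. -/

namespace FaceSystem

variable {V Φ : Type*} {G : SimpleGraph V} (fs : FaceSystem G Φ)

/-- The face `F` has the vertex `w` on its boundary. -/
def At (F : Φ) (w : V) : Prop := ∃ e ∈ fs.bd F, w ∈ e

/-- The edges that separate a face of `X` from a face outside `X`. -/
def boundary (X : Set Φ) : Set (Sym2 V) := {e | ∃ F ∈ X, ∃ F' ∉ X, e ∈ fs.bd F ∧ e ∈ fs.bd F'}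

variable {fs}

theorem boundary_subset (X : Set Φ) : fs.boundary X ⊆ G.edgeSet := by
  rintro e ⟨F, -, -, -, h, -⟩
  exact fs.bd_subset F h

theorem mem_boundary_iff {e : Sym2 V} {F F' : Φ} (h : ∀ X, e ∈ fs.bd X ↔ X = F ∨ X = F')
    (X : Set Φ) : e ∈ fs.boundary X ↔ ¬ (F ∈ X ↔ F' ∈ X) := by
  constructor
  · rintro ⟨A, hA, B, hB, h1, h2⟩
    rcases (h A).1 h1 with rfl | rfl <;> rcases (h B).1 h2 with rfl | rfl <;> tauto
  · intro h'
    by_cases hF : F ∈ X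
    · exact ⟨F, hF, F', by tauto, (h F).2 (.inl rfl), (h F').2 (.inr rfl)⟩
    · exact ⟨F', by tauto, F, hF, (h F').2 (.inr rfl), (h F).2 (.inl rfl)⟩

/-- An edge lies in the boundary exactly when one of its two faces belongs to the set, so the
boundary is additive modulo 2. Together with `conn` this lets a set of faces without `out` be
recovered from its boundary (`eq_of_boundary`). -/
theorem boundary_symmDiff (X Y : Set Φ) :
    fs.boundary (symmDiff X Y) = symmDiff (fs.boundary X) (fs.boundary Y) := by
  ext e
  by_cases he : e ∈ G.edgeSet
  · obtain ⟨F, F', -, h⟩ := fs.two e he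
    simp only [Set.mem_symmDiff, mem_boundary_iff h]
    tauto
  · have : ∀ X, e ∉ fs.boundary X := fun X h => he (boundary_subset X h)
    simp [Set.mem_symmDiff, this]

theorem eq_empty_or_univ_of_boundary {X : Set Φ} (h : fs.boundary X = ∅) :
    X = ∅ ∨ X = Set.univ := by
  refine fs.conn X fun e F F' h1 h2 hF => ?_
  by_contra hF'
  exact (h ▸ (⟨F, hF, F', hF', h1, h2⟩ : e ∈ fs.boundary X) : e ∈ (∅ : Set (Sym2 V)))

theorem eq_empty_of_boundary {X : Set Φ} (h : fs.boundary X = ∅) (ho : fs.out ∉ X) : X = ∅ :=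
  (eq_empty_or_univ_of_boundary h).resolve_right fun h' => ho (h' ▸ Set.mem_univ _)

theorem eq_of_boundary {X Y : Set Φ} (h : fs.boundary X = fs.boundary Y) (hX : fs.out ∉ X)
    (hY : fs.out ∉ Y) : X = Y := by
  rw [← symmDiff_eq_bot]
  apply eq_empty_of_boundary (fs := fs)
  · rw [boundary_symmDiff, h, symmDiff_self]; rfl
  · simp [Set.mem_symmDiff, hX, hY]

/-- Every vertex has an even number of edges in the boundary of a set of faces. -/
theorem even_boundary [Finite V] [Finite Φ] (X : Set Φ) (w : V) :
    Even {e | e ∈ fs.boundary X ∧ w ∈ e}.ncard := by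
  classical
  cases nonempty_fintype V
  cases nonempty_fintype Φ
  -- Count the pairs of a face in `X` and an edge of it at `w`. Each pentagon contributes 0 or 2,
  -- while modulo 2 an edge contributes 1 exactly if it lies in the boundary.
  have hdc := Finset.sum_card_bipartiteAbove_eq_sum_card_bipartiteBelow
    (s := Finset.univ.filter fun F => F ∈ X) (t := Finset.univ.filter fun e : Sym2 V => w ∈ e)
    (fun F e => e ∈ fs.bd F)
  have h1 : Even (∑ F ∈ Finset.univ.filter (fun F => F ∈ X),
      ((Finset.univ.filter fun e : Sym2 V => w ∈ e).bipartiteAbove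
        (fun F e => e ∈ fs.bd F) F).card) := by
    refine Finset.even_sum _ fun F _ => ?_
    obtain ⟨v, hv, hbd⟩ := fs.pent F
    by_cases hw : w ∈ Set.range v
    · obtain ⟨i, rfl⟩ := hw
      obtain ⟨i, rfl⟩ : ∃ j, i = j + 1 := ⟨i - 1, by simp⟩
      have : (Finset.univ.filter fun e : Sym2 V => v (i + 1) ∈ e).bipartiteAbove
        (fun F e => e ∈ fs.bd F) F = {s(v i, v (i + 1)), s(v (i + 1), v (i + 1 + 1))} := by
        ext e
        simp only [Finset.mem_bipartiteAbove, Finset.mem_filter, Finset.mem_univ, true_and,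
          Finset.mem_insert, Finset.mem_singleton, hbd]
        constructor
        · rintro ⟨h1, h2⟩
          exact cyclicEdges_at hv h2 h1
        · rintro (rfl | rfl)
          · exact ⟨by simp, mem_cyclicEdges_self _ _⟩
          · exact ⟨by simp, mem_cyclicEdges_self _ _⟩
      rw [this, Finset.card_pair]
      · decide
      · intro h
        exact Fin.add_one_ne_self_of_two_le (by norm_num) i
          (cyclicEdge_injective (by norm_num) hv h).symm
    · have : (Finset.univ.filter fun e : Sym2 V => w ∈ e).bipartiteAbove
        (fun F e => e ∈ fs.bd F) F = ∅ := by
        ext e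
        simp only [Finset.mem_bipartiteAbove, Finset.mem_filter, Finset.mem_univ, true_and,
          Finset.notMem_empty, iff_false, hbd]
        rintro ⟨h1, h2⟩
        exact hw (mem_range_of_mem_cyclicEdges h2 h1)
      simp [this]
  rw [hdc] at h1
  have h2 : ∀ e : Sym2 V, (((Finset.univ.filter fun F => F ∈ X).bipartiteBelow
      (fun F e => e ∈ fs.bd F) e).card : ZMod 2) = if e ∈ fs.boundary X then 1 else 0 := by
    intro e
    by_cases he : e ∈ G.edgeSet
    · obtain ⟨F, F', hne, h⟩ := fs.two e he
      have : (Finset.univ.filter fun F => F ∈ X).bipartiteBelow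
          (fun F e => e ∈ fs.bd F) e = ({F, F'} : Finset Φ).filter (· ∈ X) := by
        ext Y
        simp [Finset.mem_bipartiteBelow, h, and_comm]
      rw [this, mem_boundary_iff h]
      by_cases h1 : F ∈ X <;> by_cases h2 : F' ∈ X <;>
        simp [Finset.filter_insert, Finset.filter_singleton, h1, h2, hne]
      decide
    · have : (Finset.univ.filter fun F => F ∈ X).bipartiteBelow
          (fun F e => e ∈ fs.bd F) e = ∅ := by
        ext Y
        simpa [Finset.mem_bipartiteBelow] using fun _ h => he (fs.bd_subset Y h)
      rw [this, if_neg fun h => he (boundary_subset X h)]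
      simp
  rw [← ZMod.natCast_eq_zero_iff_even] at h1 ⊢
  push_cast at h1
  simp only [h2] at h1
  rw [Finset.sum_boole, Finset.filter_filter] at h1
  rw [← h1]
  congr 1
  rw [Set.ncard_eq_toFinset_card']
  congr 1
  ext e
  simp [and_comm]

/-- By `even_boundary`, a boundary that reaches a vertex of the cycle along one edge must leave it
along the next one, so a nonempty boundary runs around the whole cycle. -/
theorem boundary_eq_of_subset_cyclicEdges [Finite V] [Finite Φ] {ℓ : ℕ} [NeZero ℓ]
    {c : Fin ℓ → V} (hc : Function.Injective c) {X : Set Φ}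
    (hX : fs.boundary X ⊆ cyclicEdges c) :
    fs.boundary X = ∅ ∨ fs.boundary X = cyclicEdges c := by
  rcases Set.eq_empty_or_nonempty (fs.boundary X) with h | ⟨e, he⟩
  · exact .inl h
  right
  refine hX.antisymm ?_
  obtain ⟨i, rfl⟩ := hX he
  have key : ∀ j, s(c j, c (j + 1)) ∈ fs.boundary X →
      s(c (j + 1), c (j + 1 + 1)) ∈ fs.boundary X := by
    intro j hj
    by_contra hj'
    have : {e | e ∈ fs.boundary X ∧ c (j + 1) ∈ e} = {s(c j, c (j + 1))} := by
      ext e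
      constructor
      · rintro ⟨h1, h2⟩
        rcases cyclicEdges_at hc (hX h1) h2 with rfl | rfl
        · rfl
        · exact absurd h1 hj'
      · rintro rfl
        exact ⟨hj, by simp⟩
    have h2 := even_boundary (fs := fs) X (c (j + 1))
    rw [this] at h2
    simp at h2
  rintro _ ⟨j, rfl⟩
  exact Fin.forall_of_forall_imp_add_one (P := fun j => s(c j, c (j + 1)) ∈ fs.boundary X) key he j

end FaceSystem

/-! ### Discs bounded by cycles, and inheritance of domination. -/

namespace FaceSystem

variable {V Φ : Type*} {G : SimpleGraph V} {fs : FaceSystem G Φ}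
variable {ℓ m : ℕ} [NeZero ℓ] [NeZero m]

/-- `S` is the set of the faces inside the cycle `c`. -/
structure IsDisk (fs : FaceSystem G Φ) (c : Fin ℓ → V) (S : Set Φ) : Prop where
  injective : Function.Injective c
  adj : ∀ i, G.Adj (c i) (c (i + 1))
  out_notMem : fs.out ∉ S
  boundary_eq : fs.boundary S = cyclicEdges c
  at_mem : ∀ w ∉ Set.range c, ∀ F F', fs.At F w → fs.At F' w → F ∈ S → F' ∈ S

/-- The vertex `w` lies strictly inside the cycle `c`. -/
def Inside (fs : FaceSystem G Φ) (c : Fin ℓ → V) (S : Set Φ) (w : V) : Prop :=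
  w ∉ Set.range c ∧ ∃ F ∈ S, fs.At F w

/-- Every vertex inside the cycle `c` has a neighbour on it. -/
def Dominates (fs : FaceSystem G Φ) (c : Fin ℓ → V) (S : Set Φ) : Prop :=
  ∀ w, fs.Inside c S w → ∃ i, G.Adj (c i) w

theorem exists_mem_bd {e : Sym2 V} (he : e ∈ G.edgeSet) : ∃ F, e ∈ fs.bd F := by
  obtain ⟨F, _, -, h⟩ := fs.two e he
  exact ⟨F, (h F).2 (.inl rfl)⟩

theorem mem_of_notMem_boundary {S : Set Φ} {e : Sym2 V} (he : e ∉ fs.boundary S) {F F' : Φ}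
    (hF : e ∈ fs.bd F) (hF' : e ∈ fs.bd F') (h : F ∈ S) : F' ∈ S := by
  by_contra h'
  exact he ⟨F, h, F', h', hF, hF'⟩

/-- A cycle uses each of its edges exactly once, so the parity condition of `fill` says that
precisely these edges separate `S` from its complement. -/
theorem isDisk_of_even (hℓ : 3 ≤ ℓ) {c : Fin ℓ → V} (hc : Function.Injective c)
    (hadj : ∀ i, G.Adj (c i) (c (i + 1))) {S : Set Φ} (h1 : fs.out ∉ S)
    (h2 : ∀ e F F', F ≠ F' → e ∈ fs.bd F → e ∈ fs.bd F' →
      ((F ∈ S ↔ F' ∈ S) ↔ Even {i | s(c i, c (i + 1)) = e}.ncard))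
    (h3 : ∀ w ∉ Set.range c, ∀ F F', fs.At F w → fs.At F' w → F ∈ S → F' ∈ S) :
    fs.IsDisk c S := by
  refine ⟨hc, hadj, h1, ?_, h3⟩
  have hcyc : ∀ e, e ∈ cyclicEdges c ↔ ¬ Even {i | s(c i, c (i + 1)) = e}.ncard := by
    intro e
    constructor
    · rintro ⟨i, rfl⟩
      have : {j | s(c j, c (j + 1)) = s(c i, c (i + 1))} = {i} := by
        ext j
        exact ⟨fun h => cyclicEdge_injective hℓ hc h, fun h => by rw [h]; rfl⟩
      rw [this]; simp
    · intro h
      by_contra h'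
      apply h
      have : {i | s(c i, c (i + 1)) = e} = ∅ := by
        ext j
        simp only [Set.mem_ofPred_eq, Set.mem_empty_iff_false, iff_false]
        exact fun hj => h' ⟨j, hj.symm⟩
      rw [this]; simp
  ext e
  rw [hcyc]
  by_cases he : e ∈ G.edgeSet
  · obtain ⟨F, F', hne, h⟩ := fs.two e he
    rw [mem_boundary_iff h, h2 e F F' hne ((h F).2 (.inl rfl)) ((h F').2 (.inr rfl))]
  · rw [← hcyc]
    refine ⟨fun h => absurd (boundary_subset S h) he, ?_⟩
    rintro ⟨i, rfl⟩
    exact absurd (hadj i) he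

theorem exists_isDisk (hℓ : 3 ≤ ℓ) {c : Fin ℓ → V} (hc : Function.Injective c)
    (hadj : ∀ i, G.Adj (c i) (c (i + 1))) : ∃ S, fs.IsDisk c S := by
  obtain ⟨S, h1, h2, h3⟩ := fs.fill ℓ c hadj
  exact ⟨S, isDisk_of_even hℓ hc hadj h1 h2 h3⟩

namespace IsDisk

variable {c : Fin ℓ → V} {d : Fin m → V} {S T : Set Φ}

theorem comp_add (h : fs.IsDisk c S) (k : Fin ℓ) : fs.IsDisk (fun i => c (i + k)) S where
  injective := h.injective.comp (add_left_injective k)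
  adj i := by simpa only [add_right_comm] using h.adj (i + k)
  out_notMem := h.out_notMem
  boundary_eq := by rw [cyclicEdges_comp_add, h.boundary_eq]
  at_mem w hw := h.at_mem w fun ⟨i, hi⟩ => hw ⟨i - k, by simpa using hi⟩

theorem cyclicEdges_subset (h : fs.IsDisk c S) : cyclicEdges c ⊆ G.edgeSet := by
  rw [← h.boundary_eq]; exact boundary_subset S

theorem exists_mem_notMem (h : fs.IsDisk c S) (i : Fin ℓ) :
    ∃ F ∈ S, ∃ F' ∉ S, fs.At F (c i) ∧ fs.At F' (c i) := by
  have : s(c i, c (i + 1)) ∈ fs.boundary S := by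
    rw [h.boundary_eq]; exact mem_cyclicEdges_self c i
  obtain ⟨F, hF, F', hF', h1, h2⟩ := this
  exact ⟨F, hF, F', hF', ⟨_, h1, by simp⟩, ⟨_, h2, by simp⟩⟩

theorem nonempty (h : fs.IsDisk c S) : S.Nonempty := by
  obtain ⟨F, hF, -⟩ := h.exists_mem_notMem 0
  exact ⟨F, hF⟩

theorem mem_of_inside (h : fs.IsDisk c S) {w : V} (hw : fs.Inside c S w) {F : Φ}
    (hF : fs.At F w) : F ∈ S := by
  obtain ⟨hw, F', hF', h'⟩ := hw
  exact h.at_mem w hw F' F h' hF hF'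

/-- A cycle all of whose edges lie on or inside another cycle has its faces inside that cycle. -/
theorem subset_of_edges [Finite V] [Finite Φ] (h : fs.IsDisk c S) (h' : fs.IsDisk d T)
    (hin : ∀ e ∈ cyclicEdges d, e ∉ cyclicEdges c → ∃ F ∈ S, e ∈ fs.bd F) : T ⊆ S := by
  -- A boundary edge of `T \ S` off `c` has both faces outside `S`, hence belongs to the boundary of
  -- `T`, that is, to `d`. But edges of `d` off `c` have a face in `S`.
  have hsub : fs.boundary (T \ S) ⊆ cyclicEdges c := by
    rintro e ⟨F, ⟨hF, hFS⟩, F', hF', h1, h2⟩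
    by_contra hec
    have hF'S : F' ∉ S := fun hx =>
      hFS (mem_of_notMem_boundary (by rwa [h.boundary_eq]) h2 h1 hx)
    have hF'T : F' ∉ T := fun hx => hF' ⟨hx, hF'S⟩
    have hed : e ∈ cyclicEdges d := by
      rw [← h'.boundary_eq]; exact ⟨F, hF, F', hF'T, h1, h2⟩
    obtain ⟨A, hA, hA'⟩ := hin e hed hec
    exact hFS (mem_of_notMem_boundary (by rwa [h.boundary_eq]) hA' h1 hA)
  have hout : fs.out ∉ T \ S := fun hx => h'.out_notMem hx.1
  rcases boundary_eq_of_subset_cyclicEdges h.injective hsub with h0 | h0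
  · exact Set.sdiff_eq_empty.1 (eq_empty_of_boundary h0 hout)
  · have : T \ S = S := eq_of_boundary (h0.trans h.boundary_eq.symm) hout h.out_notMem
    obtain ⟨F, hF⟩ := h.nonempty
    exact absurd hF (this.symm.subset hF).2

/-- Every vertex of `c` has a face outside `S`, whereas all faces at a vertex inside `d` lie in `T`.
-/
theorem inside_of_subset (h : fs.IsDisk c S) (h' : fs.IsDisk d T) (hTS : T ⊆ S) {w : V}
    (hw : fs.Inside d T w) : fs.Inside c S w := by
  refine ⟨?_, ?_⟩
  · rintro ⟨i, rfl⟩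
    obtain ⟨-, -, F, hF, -, h1⟩ := h.exists_mem_notMem i
    exact hF (hTS (h'.mem_of_inside hw h1))
  · obtain ⟨-, F, hF, h1⟩ := hw
    exact ⟨F, hTS hF, h1⟩

theorem notMem_range_of_inside (h : fs.IsDisk c S) (h' : fs.IsDisk d T) (hTS : T ⊆ S)
    {w : V} (hw : fs.Inside d T w) (i : Fin ℓ) : c i ≠ w := fun e =>
  (h.inside_of_subset h' hTS hw).1 ⟨i, e⟩

/-- A neighbour of an inside vertex of `d` is inside `d` or on `d`. -/
theorem inside_of_adj (h : fs.IsDisk d T) {w x : V} (hw : fs.Inside d T w) (hx : G.Adj x w)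
    (hxd : x ∉ Set.range d) : fs.Inside d T x := by
  obtain ⟨F, hF⟩ := exists_mem_bd (fs := fs) (e := s(x, w)) hx
  exact ⟨hxd, F, h.mem_of_inside hw ⟨_, hF, by simp⟩, _, hF, by simp⟩

/-- A neighbour on `c` of a vertex inside `d` is on `d` or inside `d`; in the second case it would
be inside `c`, which no vertex of `c` is. -/
theorem dominates_of_subset (h : fs.IsDisk c S) (h' : fs.IsDisk d T) (hTS : T ⊆ S)
    (hdom : fs.Dominates c S) : fs.Dominates d T := by
  intro w hw
  obtain ⟨i, hi⟩ := hdom w (h.inside_of_subset h' hTS hw)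
  by_contra hcon
  push Not at hcon
  have : c i ∉ Set.range d := by
    rintro ⟨j, hj⟩
    exact hcon j (hj ▸ hi)
  exact h.notMem_range_of_inside h' hTS (h'.inside_of_adj hw hi this) i rfl

theorem ncard_lt [Finite Φ] (h : fs.IsDisk c S) (h' : fs.IsDisk d T) (hTS : T ⊆ S) {e : Sym2 V}
    (he : e ∈ cyclicEdges d) (he' : e ∉ cyclicEdges c) : T.ncard < S.ncard := by
  refine Set.ncard_lt_ncard ⟨hTS, fun hST => he' ?_⟩
  rw [← h.boundary_eq, hST.antisymm hTS, h'.boundary_eq]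
  exact he

/-- The descent step for the induction on the number of faces; the edge off `c` makes the inclusion
of the discs strict. -/
theorem exists_smaller [Finite V] [Finite Φ] (h : fs.IsDisk c S) (hdom : fs.Dominates c S)
    (hm : 3 ≤ m) (hd : Function.Injective d) (hadj : ∀ i, G.Adj (d i) (d (i + 1)))
    (hin : ∀ i, s(d i, d (i + 1)) ∉ cyclicEdges c → ∃ F ∈ S, s(d i, d (i + 1)) ∈ fs.bd F)
    {e : Sym2 V} (he : e ∈ cyclicEdges d) (he' : e ∉ cyclicEdges c) :
    ∃ T, fs.IsDisk d T ∧ T ⊆ S ∧ T.ncard < S.ncard ∧ fs.Dominates d T := by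
  obtain ⟨T, hT⟩ := exists_isDisk (fs := fs) hm hd hadj
  have hTS : T ⊆ S := h.subset_of_edges hT (by rintro _ ⟨i, rfl⟩; exact hin i)
  exact ⟨T, hT, hTS, h.ncard_lt hT hTS he he', h.dominates_of_subset hT hTS hdom⟩

theorem exists_bd_of_inside (h : fs.IsDisk c S) {w x : V} (hw : fs.Inside c S w)
    (hx : G.Adj x w) : ∃ F ∈ S, s(x, w) ∈ fs.bd F := by
  obtain ⟨F, hF⟩ := exists_mem_bd (fs := fs) (e := s(x, w)) hx
  exact ⟨F, h.mem_of_inside hw ⟨_, hF, by simp⟩, hF⟩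

/-- Excludes two consecutive neighbours of an inside vertex, once smaller triangles are known not to
dominate their interior. -/
theorem triangle_of_inside [Finite V] [Finite Φ] (h : fs.IsDisk c S) (hdom : fs.Dominates c S)
    {w : V} (hw : fs.Inside c S w) {i : Fin ℓ} (h1 : G.Adj (c i) w) (h2 : G.Adj (c (i + 1)) w) :
    ∃ (d : Fin 3 → V) (T : Set Φ), fs.IsDisk d T ∧ T.ncard < S.ncard ∧ fs.Dominates d T := by
  have hne := h.adj i
  obtain ⟨T, hT, -, hlt, hd⟩ := h.exists_smaller hdom (d := ![c i, c (i + 1), w]) le_rfl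
    (by
      intro a b hab
      fin_cases a <;> fin_cases b <;> simp_all [h1.ne, h2.ne, h1.ne', h2.ne', hne.ne, hne.ne'])
    (by
      intro a
      fin_cases a
      exacts [hne, h2, h1.symm])
    (by
      intro a
      fin_cases a
      · exact fun h => absurd (mem_cyclicEdges_self c i) h
      · exact fun _ => h.exists_bd_of_inside hw h2
      · intro _
        obtain ⟨F, hF, hF'⟩ := h.exists_bd_of_inside hw h1
        exact ⟨F, hF, by rwa [Sym2.eq_swap] at hF'⟩)
    (mem_cyclicEdges_self _ 1)
    (fun he => hw.1 (mem_range_of_mem_cyclicEdges he (by simp)))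
  exact ⟨_, T, hT, hlt, hd⟩

/-- Only chords between vertices at distance two are needed: a 4-cycle has no others. -/
theorem triangle_of_chord [Finite V] [Finite Φ] (h : fs.IsDisk c S) (hdom : fs.Dominates c S)
    {i : Fin ℓ} {F : Φ} (hF : F ∈ S) (he : s(c i, c (i + 1 + 1)) ∈ fs.bd F)
    (hc : s(c i, c (i + 1 + 1)) ∉ cyclicEdges c) :
    ∃ (d : Fin 3 → V) (T : Set Φ), fs.IsDisk d T ∧ T.ncard < S.ncard ∧ fs.Dominates d T := by
  have h1 := h.adj i
  have h2 := h.adj (i + 1)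
  have h3 : G.Adj (c i) (c (i + 1 + 1)) := fs.bd_subset F he
  obtain ⟨T, hT, -, hlt, hd⟩ := h.exists_smaller hdom
    (d := ![c i, c (i + 1), c (i + 1 + 1)]) le_rfl
    (by
      intro a b hab
      fin_cases a <;> fin_cases b <;>
        simp_all [h1.ne, h2.ne, h1.ne', h2.ne', h3.ne, h3.ne'])
    (by
      intro a
      fin_cases a
      exacts [h1, h2, h3.symm])
    (by
      intro a
      fin_cases a
      · exact fun h => absurd (mem_cyclicEdges_self c i) h
      · exact fun h => absurd (mem_cyclicEdges_self c (i + 1)) h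
      · exact fun _ => ⟨F, hF, by rwa [Sym2.eq_swap] at he⟩)
    (mem_cyclicEdges_self _ 2)
    (by rwa [Sym2.eq_swap] at hc)
  exact ⟨_, T, hT, hlt, hd⟩

end IsDisk

end FaceSystem

/-! ### Counting faces and spokes inside an irreducible cycle. -/

namespace FaceSystem

variable {V Φ : Type*} {G : SimpleGraph V} {fs : FaceSystem G Φ}
variable {ℓ : ℕ} [NeZero ℓ]

/-- The edges inside the cycle that bounds `S`. -/
def innerEdges (fs : FaceSystem G Φ) (S : Set Φ) : Set (Sym2 V) :=
  {e | e ∈ G.edgeSet ∧ ∀ F, e ∈ fs.bd F → F ∈ S}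

/-- The inner edges with an end on the cycle `c`. -/
def spokes (fs : FaceSystem G Φ) (c : Fin ℓ → V) (S : Set Φ) : Set (Sym2 V) :=
  {e | e ∈ fs.innerEdges S ∧ ∃ w ∈ e, w ∈ Set.range c}

/-- The inner edges without an end on the cycle `c`. -/
def links (fs : FaceSystem G Φ) (c : Fin ℓ → V) (S : Set Φ) : Set (Sym2 V) :=
  {e | e ∈ fs.innerEdges S ∧ ∀ w ∈ e, w ∉ Set.range c}

/-- The cycle `c` has no chord inside, and every inside vertex has at most one neighbour on `c`. -/
structure Irreducible (fs : FaceSystem G Φ) (c : Fin ℓ → V) (S : Set Φ) : Prop where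
  no_chord : ∀ i j, ∀ F ∈ S, s(c i, c j) ∈ fs.bd F → s(c i, c j) ∈ cyclicEdges c
  unique : ∀ w, fs.Inside c S w → ∀ i j, G.Adj (c i) w → G.Adj (c j) w → i = j

theorem ncard_spokes_add_links [Finite V] (c : Fin ℓ → V) (S : Set Φ) :
    (fs.spokes c S).ncard + (fs.links c S).ncard = (fs.innerEdges S).ncard := by
  rw [← Set.ncard_union_eq]
  · congr 1
    ext e
    simp only [spokes, links, Set.mem_union, Set.mem_ofPred_eq, ← and_or_left]
    refine and_iff_left_of_imp fun _ => ?_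
    by_cases h : ∃ w ∈ e, w ∈ Set.range c
    · exact .inl h
    · exact .inr fun w hw hw' => h ⟨w, hw, hw'⟩
  · rw [Set.disjoint_left]
    rintro e ⟨-, w, hw, hw'⟩ ⟨-, h⟩
    exact h w hw hw'

namespace IsDisk

variable {c : Fin ℓ → V} {S : Set Φ}

theorem mem_innerEdges (h : fs.IsDisk c S) {e : Sym2 V} {F : Φ} (hF : F ∈ S)
    (he : e ∈ fs.bd F) (hc : e ∉ cyclicEdges c) : e ∈ fs.innerEdges S :=
  ⟨fs.bd_subset F he, fun _ hF' =>
    mem_of_notMem_boundary (by rwa [h.boundary_eq]) he hF' hF⟩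

theorem notMem_cyclicEdges_of_mem_innerEdges (h : fs.IsDisk c S) {e : Sym2 V}
    (he : e ∈ fs.innerEdges S) : e ∉ cyclicEdges c := by
  rw [← h.boundary_eq]
  rintro ⟨-, -, F, hF, -, h'⟩
  exact hF (he.2 F h')

theorem sum_ncard_inter [Finite V] [Fintype Φ] [DecidablePred (· ∈ S)] {Y : Set (Sym2 V)}
    (hY : Y ⊆ fs.innerEdges S) :
    ∑ F ∈ Finset.univ.filter (· ∈ S), (fs.bd F ∩ Y).ncard = 2 * Y.ncard := by
  classical
  cases nonempty_fintype V
  have hdc := Finset.sum_card_bipartiteAbove_eq_sum_card_bipartiteBelow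
    (s := Finset.univ.filter fun F => F ∈ S) (t := Finset.univ.filter fun e : Sym2 V => e ∈ Y)
    (fun F e => e ∈ fs.bd F)
  have h1 : ∀ F, ((Finset.univ.filter fun e : Sym2 V => e ∈ Y).bipartiteAbove
      (fun F e => e ∈ fs.bd F) F).card = (fs.bd F ∩ Y).ncard := by
    intro F
    rw [Set.ncard_eq_toFinset_card']
    congr 1
    ext e
    simp [and_comm]
  have h2 : ∀ e ∈ Finset.univ.filter (fun e : Sym2 V => e ∈ Y),
      ((Finset.univ.filter fun F => F ∈ S).bipartiteBelow
        (fun F e => e ∈ fs.bd F) e).card = 2 := by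
    intro e he
    have he' := hY (Finset.mem_filter.1 he).2
    obtain ⟨F, F', hne, hF⟩ := fs.two e he'.1
    have : (Finset.univ.filter fun F => F ∈ S).bipartiteBelow
        (fun F e => e ∈ fs.bd F) e = {F, F'} := by
      ext X
      simp only [Finset.mem_bipartiteBelow, Finset.mem_filter, Finset.mem_univ, true_and,
        Finset.mem_insert, Finset.mem_singleton, ← hF]
      exact and_iff_right_of_imp (he'.2 X)
    rw [this, Finset.card_pair hne]
  simp only [h1] at hdc
  rw [hdc, Finset.sum_congr rfl h2, Finset.sum_const, smul_eq_mul, mul_comm,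
    Set.ncard_eq_toFinset_card']
  congr 2
  ext e
  simp

theorem ncard_bd_inter_cyclicEdges [Finite V] [Fintype Φ] [DecidablePred (· ∈ S)]
    (h : fs.IsDisk c S) :
    ∑ F ∈ Finset.univ.filter (· ∈ S), (fs.bd F ∩ cyclicEdges c).ncard
      = (cyclicEdges c).ncard := by
  classical
  cases nonempty_fintype V
  have hdc := Finset.sum_card_bipartiteAbove_eq_sum_card_bipartiteBelow
    (s := Finset.univ.filter fun F => F ∈ S)
    (t := Finset.univ.filter fun e : Sym2 V => e ∈ cyclicEdges c)
    (fun F e => e ∈ fs.bd F)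
  have h1 : ∀ F, ((Finset.univ.filter fun e : Sym2 V => e ∈ cyclicEdges c).bipartiteAbove
      (fun F e => e ∈ fs.bd F) F).card = (fs.bd F ∩ cyclicEdges c).ncard := by
    intro F
    rw [Set.ncard_eq_toFinset_card']
    congr 1
    ext e
    simp [and_comm]
  have h2 : ∀ e ∈ Finset.univ.filter (fun e : Sym2 V => e ∈ cyclicEdges c),
      ((Finset.univ.filter fun F => F ∈ S).bipartiteBelow
        (fun F e => e ∈ fs.bd F) e).card = 1 := by
    intro e he
    have he' := (Finset.mem_filter.1 he).2
    have he'' := he'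
    rw [← h.boundary_eq] at he'
    obtain ⟨A, hA, B, hB, hA', hB'⟩ := he'
    obtain ⟨F, F', hne, hF⟩ := fs.two e (h.cyclicEdges_subset he'')
    rw [Finset.card_eq_one]
    refine ⟨A, ?_⟩
    ext X
    simp only [Finset.mem_bipartiteBelow, Finset.mem_filter, Finset.mem_univ, true_and,
      Finset.mem_singleton]
    constructor
    · rintro ⟨hX, hX'⟩
      rw [hF] at hX' hA' hB'
      rcases hX' with rfl | rfl <;> rcases hA' with rfl | rfl <;> rcases hB' with rfl | rfl <;>
        first | rfl | contradiction
    · rintro rfl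
      exact ⟨hA, hA'⟩
  simp only [h1] at hdc
  rw [hdc, Finset.sum_congr rfl h2, Finset.sum_const, smul_eq_mul, mul_one,
    Set.ncard_eq_toFinset_card']
  congr 1
  ext e
  simp

/-- Count incidences of edges with the faces in `S`: a face has five, an edge of `c` has one, an
inner edge has two. -/
theorem five_mul_ncard [Finite V] [Finite Φ] (h : fs.IsDisk c S) (hℓ : 3 ≤ ℓ) :
    5 * S.ncard = ℓ + 2 * (fs.innerEdges S).ncard := by
  classical
  cases nonempty_fintype Φ
  rw [← sum_ncard_inter (S := S) subset_rfl, ← ncard_cyclicEdges hℓ h.injective,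
    ← h.ncard_bd_inter_cyclicEdges, ← Finset.sum_add_distrib]
  have : ∀ F ∈ Finset.univ.filter (· ∈ S), (fs.bd F ∩ cyclicEdges c).ncard +
      (fs.bd F ∩ fs.innerEdges S).ncard = 5 := by
    intro F hF
    have hF := (Finset.mem_filter.1 hF).2
    obtain ⟨v, hv, hbd⟩ := fs.pent F
    rw [← Set.ncard_union_eq, ← Set.inter_union_distrib_left, ← ncard_cyclicEdges (by norm_num) hv,
      ← hbd]
    · congr 1
      refine Set.inter_eq_left.2 fun e he => ?_
      by_cases hc : e ∈ cyclicEdges c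
      · exact .inl hc
      · exact .inr (h.mem_innerEdges hF he hc)
    · rw [Set.disjoint_left]
      exact fun e he he' => h.notMem_cyclicEdges_of_mem_innerEdges he'.2 he.2
  rw [Finset.sum_congr rfl this, Finset.sum_const, smul_eq_mul, mul_comm,
    Set.ncard_eq_toFinset_card']
  congr 2
  ext; simp

/-- The number of colour changes is even. Four changes make two runs of each colour; as there are
only five places, one of the two `false` runs has length 1, which is the excluded pattern. -/
theorem card_bichromatic_le_two : ∀ b : Fin 5 → Bool,
    (∀ i, ¬ (b i = true ∧ b (i + 1) = false ∧ b (i + 1 + 1) = true)) →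
    (Finset.univ.filter fun i => b i ≠ b (i + 1)).card ≤ 2 := by
  decide

theorem inside_of_mem_bd {w x : V} {F : Φ} (hF : F ∈ S)
    (he : s(w, x) ∈ fs.bd F) (hw : w ∉ Set.range c) : fs.Inside c S w :=
  ⟨hw, F, hF, _, he, by simp⟩

/-- As there are no chords, a spoke joins a vertex on `c` to one off `c`. Around a pentagon the
pattern on, off, on cannot occur, because the middle vertex would have two neighbours on `c`. So
each face has at most two spokes, and each spoke has two faces in `S`. -/
theorem ncard_spokes_le [Finite V] [Finite Φ] (h : fs.IsDisk c S) (hi : fs.Irreducible c S) :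
    (fs.spokes c S).ncard ≤ S.ncard := by
  classical
  cases nonempty_fintype Φ
  cases nonempty_fintype V
  have hsum := sum_ncard_inter (fs := fs) (S := S) (Y := fs.spokes c S) fun e he => he.1
  have : ∀ F ∈ Finset.univ.filter (· ∈ S), (fs.bd F ∩ fs.spokes c S).ncard ≤ 2 := by
    intro F hF
    have hF := (Finset.mem_filter.1 hF).2
    obtain ⟨v, hv, hbd⟩ := fs.pent F
    have hmem : ∀ i, s(v i, v (i + 1)) ∈ fs.bd F := fun i => hbd ▸ mem_cyclicEdges_self v i
    have hle := card_bichromatic_le_two (fun i => decide (v i ∈ Set.range c)) (by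
      rintro i ⟨h1, h2, h3⟩
      simp only [decide_eq_true_eq, decide_eq_false_iff_not] at h1 h2 h3
      obtain ⟨j, hj⟩ := h1
      obtain ⟨k, hk⟩ := h3
      have hin := inside_of_mem_bd hF (hmem (i + 1)) h2
      have a1 : G.Adj (v i) (v (i + 1)) := fs.bd_subset F (hmem i)
      have a2 : G.Adj (v (i + 1)) (v (i + 1 + 1)) := fs.bd_subset F (hmem (i + 1))
      have := hi.unique _ hin j k (hj ▸ a1) (hk ▸ a2.symm)
      subst this
      exact Fin.add_one_add_one_ne_self (by norm_num) i (hv (hk.symm.trans hj)))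
    refine le_trans ?_ hle
    rw [← Set.ncard_coe_finset]
    refine (Set.ncard_le_ncard ?_ (Set.toFinite _)).trans
      (Set.ncard_image_le (f := fun i => s(v i, v (i + 1))) (Set.toFinite _))
    rintro e ⟨he, hs, hw⟩
    rw [hbd] at he
    obtain ⟨i, rfl⟩ := he
    refine ⟨i, ?_, rfl⟩
    simp only [Finset.coe_filter, Finset.mem_univ, true_and, Set.mem_ofPred_eq, ne_eq,
      decide_eq_decide]
    intro hiff
    have hnc := h.notMem_cyclicEdges_of_mem_innerEdges hs
    obtain ⟨w, hw, hwc⟩ := hw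
    have hboth : v i ∈ Set.range c ∧ v (i + 1) ∈ Set.range c := by
      rcases Sym2.mem_iff.1 hw with rfl | rfl
      · exact ⟨hwc, hiff.1 hwc⟩
      · exact ⟨hiff.2 hwc, hwc⟩
    obtain ⟨⟨j, hj⟩, k, hk⟩ := hboth
    have := hi.no_chord j k F hF (by rw [hj, hk]; exact hmem i)
    rw [hj, hk] at this
    exact hnc this
  have h2 := Finset.sum_le_sum this
  rw [hsum, Finset.sum_const, smul_eq_mul, mul_comm] at h2
  have h3 : (Finset.univ.filter (· ∈ S)).card = S.ncard := by
    rw [Set.ncard_eq_toFinset_card']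
    congr 1
    ext; simp
  omega

end IsDisk

end FaceSystem

/-! ### Counting links over the field with two elements. -/

namespace FaceSystem

variable {V Φ : Type*} {G : SimpleGraph V} {fs : FaceSystem G Φ}
variable {ℓ m : ℕ} [NeZero ℓ] [NeZero m]

namespace IsDisk

variable {c : Fin ℓ → V} {S : Set Φ}

/-- A closed walk with exactly one edge off `c` splits the faces in `S` along a link. -/
theorem exists_separating {W : Fin m → V} (hW : ∀ i, G.Adj (W i) (W (i + 1)))
    (hWc : ∀ i, i ≠ 0 → W i ∈ Set.range c ∨ W (i + 1) ∈ Set.range c) :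
    ∃ T : Set Φ, ∀ e ∈ fs.links c S, ∀ F F', F ≠ F' → e ∈ fs.bd F → e ∈ fs.bd F' →
      ((F ∈ T ↔ F' ∈ T) ↔ e ≠ s(W 0, W (0 + 1))) := by
  obtain ⟨T, -, hT, -⟩ := fs.fill m W hW
  refine ⟨T, fun e he F F' hne hF hF' => (hT e F F' hne hF hF').trans ?_⟩
  have hi : ∀ i, s(W i, W (i + 1)) = e → i = 0 := by
    intro i h
    by_contra h0
    rcases hWc i h0 with h1 | h1
    · exact he.2 _ (h ▸ by simp) h1
    · exact he.2 _ (h ▸ by simp) h1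
  by_cases h0 : e = s(W 0, W (0 + 1))
  · have : {i | s(W i, W (i + 1)) = e} = {0} := by
      ext i
      exact ⟨hi i, by rintro rfl; exact h0.symm⟩
    rw [this]; simp [h0]
  · have : {i | s(W i, W (i + 1)) = e} = ∅ := by
      ext i
      simp only [Set.mem_ofPred_eq, Set.mem_empty_iff_false, iff_false]
      intro h
      have := hi i h
      subst this
      exact h0 h.symm
    rw [this]; simpa using h0

theorem exists_separating_link (h : fs.IsDisk c S) (hdom : fs.Dominates c S)
    (hpath : ∀ i j, i = j ∨ s(c i, c j) ∈ cyclicEdges c ∨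
      ∃ k, s(c i, c k) ∈ cyclicEdges c ∧ s(c k, c j) ∈ cyclicEdges c)
    {e : Sym2 V} (he : e ∈ fs.links c S) :
    ∃ T : Set Φ, ∀ e' ∈ fs.links c S, ∀ F F', F ≠ F' → e' ∈ fs.bd F → e' ∈ fs.bd F' →
      ((F ∈ T ↔ F' ∈ T) ↔ e' ≠ e) := by
  induction e using Sym2.ind with | _ a b
  obtain ⟨F, hF⟩ := exists_mem_bd (fs := fs) he.1.1
  have hFS := he.1.2 F hF
  obtain ⟨i, hi⟩ := hdom a (inside_of_mem_bd hFS hF (he.2 a (by simp)))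
  obtain ⟨j, hj⟩ := hdom b (inside_of_mem_bd hFS (by rwa [Sym2.eq_swap] at hF) (he.2 b (by simp)))
  have hab : G.Adj a b := he.1.1
  -- The link is closed up through neighbours of its ends on `c` and at most two edges of `c`. Every
  -- edge of the walk but the first has an end on `c`, so no other link is used.
  rcases hpath i j with rfl | hij | ⟨k, hik, hkj⟩
  · exact exists_separating (W := ![a, b, c i])
      (by intro n; fin_cases n; exacts [hab, hj.symm, hi])
      (by intro n hn; fin_cases n; exacts [absurd rfl hn, .inr ⟨i, rfl⟩, .inl ⟨i, rfl⟩])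
  · have hij : G.Adj (c i) (c j) := h.cyclicEdges_subset hij
    exact exists_separating (W := ![a, b, c j, c i])
      (by intro n; fin_cases n; exacts [hab, hj.symm, hij.symm, hi])
      (by
        intro n hn; fin_cases n
        exacts [absurd rfl hn, .inr ⟨j, rfl⟩, .inl ⟨j, rfl⟩, .inl ⟨i, rfl⟩])
  · have hik : G.Adj (c i) (c k) := h.cyclicEdges_subset hik
    have hkj : G.Adj (c k) (c j) := h.cyclicEdges_subset hkj
    exact exists_separating (W := ![a, b, c j, c k, c i])
      (by intro n; fin_cases n; exacts [hab, hj.symm, hkj.symm, hik.symm, hi])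
      (by
        intro n hn; fin_cases n
        exacts [absurd rfl hn, .inr ⟨j, rfl⟩, .inl ⟨j, rfl⟩, .inl ⟨k, rfl⟩, .inl ⟨i, rfl⟩])

/-- In the dual graph on `S` each link is a bridge by `exists_separating_link`, so the links form a
forest. The proof is the rank form of this: the coboundary map from functions on `S` to functions on
the links is onto and has a nonzero kernel. -/
theorem ncard_links_lt [Finite V] [Finite Φ] (h : fs.IsDisk c S) (hdom : fs.Dominates c S)
    (hpath : ∀ i j, i = j ∨ s(c i, c j) ∈ cyclicEdges c ∨
      ∃ k, s(c i, c k) ∈ cyclicEdges c ∧ s(c k, c j) ∈ cyclicEdges c) :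
    (fs.links c S).ncard < S.ncard := by
  classical
  cases nonempty_fintype Φ
  cases nonempty_fintype V
  let φ : (S → ZMod 2) →ₗ[ZMod 2] (fs.links c S → ZMod 2) :=
    { toFun := fun g e => ∑ F : S, if (e : Sym2 V) ∈ fs.bd F then g F else 0
      map_add' := by
        intro g g'; ext e
        simp only [Pi.add_apply, ← Finset.sum_add_distrib]
        exact Finset.sum_congr rfl fun F _ => by split_ifs <;> simp
      map_smul' := by
        intro r g; ext e
        simp only [Pi.smul_apply, Finset.smul_sum, RingHom.id_apply]
        exact Finset.sum_congr rfl fun F _ => by split_ifs <;> simp }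
  have hφ : ∀ (g : S → ZMod 2) (e : fs.links c S), ∃ F F' : S, F ≠ F' ∧
      (e : Sym2 V) ∈ fs.bd F ∧ (e : Sym2 V) ∈ fs.bd F' ∧ φ g e = g F + g F' := by
    intro g e
    obtain ⟨F, F', hne, hF⟩ := fs.two e e.2.1.1
    have h1 := (hF F).2 (.inl rfl)
    have h2 := (hF F').2 (.inr rfl)
    refine ⟨⟨F, e.2.1.2 F h1⟩, ⟨F', e.2.1.2 F' h2⟩, by simpa using hne, h1, h2, ?_⟩
    have hne' : (⟨F, e.2.1.2 F h1⟩ : S) ≠ ⟨F', e.2.1.2 F' h2⟩ := by simpa using hne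
    rw [← Finset.sum_pair hne']
    change ∑ F : S, (if (e : Sym2 V) ∈ fs.bd F then g F else 0) = _
    rw [← Finset.sum_filter]
    refine Finset.sum_congr ?_ fun _ _ => rfl
    ext X
    simp [hF, Subtype.ext_iff]
  -- The indicator of the set that separates at `e` is mapped to the unit vector of `e`.
  have hsurj : LinearMap.range φ = ⊤ := by
    rw [eq_top_iff, ← Pi.basisFun (ZMod 2) (fs.links c S) |>.span_eq, Submodule.span_le]
    rintro _ ⟨e, rfl⟩
    obtain ⟨T, hT⟩ := h.exists_separating_link hdom hpath e.2
    refine ⟨fun F => if (F : Φ) ∈ T then 1 else 0, ?_⟩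
    ext e'
    obtain ⟨F, F', hne, h1, h2, h3⟩ := hφ (fun F => if (F : Φ) ∈ T then 1 else 0) e'
    rw [h3]
    have := hT e' e'.2 F F' (fun h => hne (Subtype.ext h)) h1 h2
    rw [Pi.basisFun_apply, Pi.single_apply]
    by_cases hee : e' = e
    · have hx : ¬ ((F : Φ) ∈ T ↔ (F' : Φ) ∈ T) := by rw [this]; simp [hee]
      by_cases hF : (F : Φ) ∈ T <;> by_cases hF' : (F' : Φ) ∈ T <;> simp_all
    · have hx : ((F : Φ) ∈ T ↔ (F' : Φ) ∈ T) := by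
        rw [this]; exact fun h => hee (Subtype.ext h)
      by_cases hF' : (F' : Φ) ∈ T
      · simp only [hx, hF', hee, if_true, if_false]; decide
      · simp [hx, hF', hee]
  -- The constant function 1 is in the kernel, as each link has exactly two faces.
  have hker : LinearMap.ker φ ≠ ⊥ := by
    intro hbot
    have h1 : (fun _ => 1 : S → ZMod 2) ∈ LinearMap.ker φ := by
      rw [LinearMap.mem_ker]
      ext e
      obtain ⟨F, F', -, -, -, h3⟩ := hφ (fun _ => 1) e
      rw [h3]; exact CharTwo.add_self_eq_zero (1 : ZMod 2)
    rw [hbot, Submodule.mem_bot] at h1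
    obtain ⟨F, hF⟩ := h.nonempty
    exact one_ne_zero (congrFun h1 ⟨F, hF⟩)
  have hrn := LinearMap.finrank_range_add_finrank_ker φ
  have hpos : 0 < Module.finrank (ZMod 2) (LinearMap.ker φ) := by
    rw [Nat.pos_iff_ne_zero]
    exact fun h0 => hker (Submodule.finrank_eq_zero.1 h0)
  rw [hsurj, finrank_top, Module.finrank_fintype_fun_eq_card,
    Module.finrank_fintype_fun_eq_card, ← Nat.card_eq_fintype_card, ← Nat.card_eq_fintype_card,
    Nat.card_coe_set_eq, Nat.card_coe_set_eq] at hrn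
  omega

end IsDisk

theorem cyclicEdges_path_three (c : Fin 3 → V) (i j : Fin 3) :
    i = j ∨ s(c i, c j) ∈ cyclicEdges c ∨
      ∃ k, s(c i, c k) ∈ cyclicEdges c ∧ s(c k, c j) ∈ cyclicEdges c := by
  have : ∀ i j : Fin 3, i = j ∨ j = i + 1 ∨ i = j + 1 := by decide
  rcases this i j with h | rfl | rfl
  · exact .inl h
  · exact .inr (.inl (mem_cyclicEdges_self c i))
  · exact .inr (.inl (Sym2.eq_swap ▸ mem_cyclicEdges_self c j))

theorem cyclicEdges_path_four (c : Fin 4 → V) (i j : Fin 4) :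
    i = j ∨ s(c i, c j) ∈ cyclicEdges c ∨
      ∃ k, s(c i, c k) ∈ cyclicEdges c ∧ s(c k, c j) ∈ cyclicEdges c := by
  have : ∀ i j : Fin 4, i = j ∨ j = i + 1 ∨ i = j + 1 ∨ j = i + 1 + 1 := by decide
  rcases this i j with h | rfl | rfl | rfl
  · exact .inl h
  · exact .inr (.inl (mem_cyclicEdges_self c i))
  · exact .inr (.inl (Sym2.eq_swap ▸ mem_cyclicEdges_self c j))
  · exact .inr (.inr ⟨i + 1, mem_cyclicEdges_self c i, mem_cyclicEdges_self c (i + 1)⟩)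

/-- For f faces and m inner edges, 5f = 3 + 2m and m ≤ 2f - 1 force f = m = 1, but an inner edge has
two different faces in `S`. -/
theorem IsDisk.not_irreducible_three [Finite V] [Finite Φ] {c : Fin 3 → V} {S : Set Φ}
    (h : fs.IsDisk c S) (hdom : fs.Dominates c S) : ¬ fs.Irreducible c S := by
  intro hi
  have h1 := h.five_mul_ncard le_rfl
  have h2 := h.ncard_spokes_le hi
  have h3 := h.ncard_links_lt hdom (cyclicEdges_path_three c)
  have h4 := ncard_spokes_add_links (fs := fs) c S
  have h5 : (fs.innerEdges S).ncard ≠ 0 := by omega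
  obtain ⟨e, he⟩ := Set.nonempty_of_ncard_ne_zero h5
  obtain ⟨F, F', hne, hF⟩ := fs.two e he.1
  have h6 := (Set.one_lt_ncard (s := S)).2
    ⟨F, he.2 F ((hF F).2 (.inl rfl)), F', he.2 F' ((hF F').2 (.inr rfl)), hne⟩
  omega

end FaceSystem

/-! ### Strips, and the irreducible 4-cycle as the base case. -/

namespace FaceSystem

variable {V Φ : Type*} {G : SimpleGraph V} {fs : FaceSystem G Φ}

/-- The faces in `S` fill the 4-cycle `u x v y` by a sequence of pentagons that are bounded
alternately by `u`–`v` paths of length 2 (with middle vertices `t 0, t 3, t 6, …`) and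
`u`–`v` paths of length 3 (with inner vertices `t 1, t 2`, and `t 4, t 5`, …). -/
def Strip (fs : FaceSystem G Φ) (u x v y : V) (S : Set Φ) : Prop :=
  ∃ (k : ℕ) (t : ℕ → V), 1 ≤ k ∧ t 0 = x ∧ t (3 * k) = y ∧ u ≠ v ∧
    Set.InjOn t (Set.Iic (3 * k)) ∧ (∀ j ≤ 3 * k, t j ≠ u ∧ t j ≠ v) ∧
    (∀ i < k, ∃ F ∈ S, fs.bd F = cyclicEdges ![u, t (3 * i), v, t (3 * i + 2), t (3 * i + 1)]) ∧
    (∀ i < k, ∃ F ∈ S,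
      fs.bd F = cyclicEdges ![u, t (3 * i + 3), v, t (3 * i + 2), t (3 * i + 1)]) ∧
    ∀ F ∈ S, ∃ i < k, fs.bd F = cyclicEdges ![u, t (3 * i), v, t (3 * i + 2), t (3 * i + 1)] ∨
      fs.bd F = cyclicEdges ![u, t (3 * i + 3), v, t (3 * i + 2), t (3 * i + 1)]

theorem cyclicEdges_five (a b c d e : V) :
    cyclicEdges ![a, b, c, d, e] = {s(a, b), s(b, c), s(c, d), s(d, e), s(e, a)} := by
  ext x
  simp [cyclicEdges, Fin.exists_fin_succ]

theorem cyclicEdges_four (a b c d : V) :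
    cyclicEdges ![a, b, c, d] = {s(a, b), s(b, c), s(c, d), s(d, a)} := by
  ext x
  simp [cyclicEdges, Fin.exists_fin_succ]

theorem exists_pentagon_of_mem_bd {F : Φ} {a b : V} (h : s(a, b) ∈ fs.bd F) :
    ∃ v : Fin 5 → V, Function.Injective v ∧ fs.bd F = cyclicEdges v ∧ v 0 = a ∧ v 1 = b := by
  obtain ⟨v, hv, hbd⟩ := fs.pent F
  rw [hbd] at h
  obtain ⟨i, hi⟩ := h
  rcases Sym2.eq_iff.1 hi with ⟨h1, h2⟩ | ⟨h1, h2⟩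
  · exact ⟨fun j => v (j + i), hv.comp (add_left_injective i), by rw [cyclicEdges_comp_add, hbd],
      by simp [h1], by simp [h2, add_comm]⟩
  · exact ⟨fun j => v (i + 1 - j), hv.comp (sub_right_injective), by
      rw [cyclicEdges_comp_sub, hbd], by simp [h1], by simp [h2]⟩

theorem strip_of_two_faces {u x v y p q : V} {S : Set Φ} {F F' : Φ} (hS : S = {F, F'})
    (huv : u ≠ v) (hx : x ≠ u ∧ x ≠ v) (hy : y ≠ u ∧ y ≠ v) (hp : p ≠ u ∧ p ≠ v)
    (hq : q ≠ u ∧ q ≠ v) (hpq : p ≠ q) (hxy : x ≠ y) (hpx : p ≠ x) (hpy : p ≠ y) (hqx : q ≠ x)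
    (hqy : q ≠ y) (hF : fs.bd F = cyclicEdges ![u, x, v, q, p])
    (hF' : fs.bd F' = cyclicEdges ![u, y, v, q, p]) : fs.Strip u x v y S := by
  refine ⟨1, fun n => if n = 0 then x else if n = 1 then p else if n = 2 then q else y, le_rfl,
    rfl, rfl, huv, ?_, ?_, ?_, ?_, ?_⟩
  · intro i hi j hj hij
    have hi : i ≤ 3 := hi
    have hj : j ≤ 3 := hj
    interval_cases i <;> interval_cases j <;> simp_all
  · intro j hj
    have hj : j ≤ 3 := hj
    interval_cases j <;> simp_all
  · intro i hi
    obtain rfl : i = 0 := by omega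
    exact ⟨F, by simp [hS], hF⟩
  · intro i hi
    obtain rfl : i = 0 := by omega
    exact ⟨F', by simp [hS], hF'⟩
  · intro A hA
    rw [hS] at hA
    refine ⟨0, by omega, ?_⟩
    rcases hA with rfl | rfl
    · exact .inl hF
    · exact .inr hF'

variable {S : Set Φ}

/-- The counts leave two faces, one link and two spokes, so the interior is a single path of length
3; it remains to see that its ends are opposite vertices of `c`. -/
theorem IsDisk.strip_of_irreducible [Finite V] [Finite Φ] {c : Fin 4 → V}
    (h : fs.IsDisk c S) (hdom : fs.Dominates c S) (hirr : fs.Irreducible c S) :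
    fs.Strip (c 0) (c 1) (c 2) (c 3) S ∨ fs.Strip (c 1) (c 2) (c 3) (c 0) S := by
  have h1 := h.five_mul_ncard (by norm_num)
  have h2 := h.ncard_spokes_le hirr
  have h3 := h.ncard_links_lt hdom (cyclicEdges_path_four c)
  have h4 := ncard_spokes_add_links (fs := fs) c S
  -- For f faces and m inner edges, 5f = 4 + 2m and m ≤ 2f - 1 give f ≤ 2. Since f is even and
  -- positive, f = 2 and m = 3, and both bounds on spokes and links are attained.
  have hl : (fs.links c S).ncard = 1 := by omega
  have hf : S.ncard = 2 := by omega
  obtain ⟨e, he⟩ := Set.ncard_eq_one.1 hl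
  have hel : e ∈ fs.links c S := he ▸ rfl
  induction e using Sym2.ind with | _ a b
  obtain ⟨F, F', hne, hFF⟩ := fs.two _ hel.1.1
  have hF1 := (hFF F).2 (.inl rfl)
  have hF1' := (hFF F').2 (.inr rfl)
  have hF := hel.1.2 F hF1
  have hF' := hel.1.2 F' hF1'
  have hS : S = {F, F'} := by
    refine (Set.eq_of_subset_of_ncard_le ?_ ?_ (Set.toFinite S)).symm
    · rintro X (rfl | rfl) <;> assumption
    · rw [hf, Set.ncard_pair hne]
  have hac := hel.2 a (by simp)
  have hbc := hel.2 b (by simp)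
  have hab : a ≠ b := (show G.Adj a b from hel.1.1).ne
  -- As there is only one link, the vertices of the pentagon next to `a` and `b` lie on `c`. So does
  -- the fifth vertex, which otherwise would be an inside vertex with two neighbours on `c`.
  have key : ∀ F ∈ S, s(a, b) ∈ fs.bd F → ∃ i j k : Fin 4, i ≠ k ∧
      fs.bd F = cyclicEdges ![a, b, c i, c j, c k] ∧ G.Adj (c i) b ∧ G.Adj (c k) a ∧
      s(c i, c j) ∈ cyclicEdges c ∧ s(c j, c k) ∈ cyclicEdges c := by
    intro F hF hF1
    obtain ⟨v, hv, hbd, rfl, rfl⟩ := exists_pentagon_of_mem_bd hF1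
    have hmem : ∀ i, s(v i, v (i + 1)) ∈ fs.bd F := fun i => hbd ▸ mem_cyclicEdges_self v i
    have hadj : ∀ i, G.Adj (v i) (v (i + 1)) := fun i => fs.bd_subset F (hmem i)
    have hlink : ∀ i, v i ∉ Set.range c → v (i + 1) ∉ Set.range c → i = 0 := by
      intro i h1 h2
      have hl : s(v i, v (i + 1)) ∈ fs.links c S := by
        refine ⟨h.mem_innerEdges hF (hmem i) fun hc =>
          h1 (mem_range_of_mem_cyclicEdges hc (by simp)), fun w hw => ?_⟩
        rcases Sym2.mem_iff.1 hw with rfl | rfl <;> assumption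
      rw [he] at hl
      exact cyclicEdge_injective (by norm_num) hv (show _ = s(v 0, v (0 + 1)) from hl)
    have hv2 : v 2 ∈ Set.range c := by
      by_contra hcon
      exact absurd (hlink 1 hbc hcon) (by decide)
    have hv4 : v 4 ∈ Set.range c := by
      by_contra hcon
      exact absurd (hlink 4 hcon hac) (by decide)
    obtain ⟨i, hi⟩ := hv2
    obtain ⟨k, hk⟩ := hv4
    have hik : i ≠ k := by
      rintro rfl
      exact absurd (hv (hi.symm.trans hk)) (by decide)
    have hv3 : v 3 ∈ Set.range c := by
      by_contra hcon
      exact hik (hirr.unique _ (inside_of_mem_bd hF (hmem 3) hcon) i k (hi ▸ hadj 2)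
        (hk ▸ (hadj 3).symm))
    obtain ⟨j, hj⟩ := hv3
    refine ⟨i, j, k, hik, ?_, hi ▸ (hadj 1).symm, hk ▸ hadj 4, ?_, ?_⟩
    · rw [hbd, hi, hj, hk]
      congr 1
      ext n
      fin_cases n <;> rfl
    · exact hirr.no_chord i j F hF (by rw [hi, hj]; exact hmem 2)
    · exact hirr.no_chord j k F hF (by rw [hj, hk]; exact hmem 3)
  obtain ⟨i, j, k, hik, hbd, hib, hka, hij, hjk⟩ := key F hF hF1
  obtain ⟨i', j', k', -, hbd', hib', hka', hij', hjk'⟩ := key F' hF' hF1'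
  obtain rfl := hirr.unique b (inside_of_mem_bd hF (by rwa [Sym2.eq_swap] at hF1) hbc) i i' hib hib'
  obtain rfl := hirr.unique a (inside_of_mem_bd hF hF1 hac) k k' hka hka'
  -- Otherwise an edge of `c` would have both its faces in `S`.
  have hjj : j ≠ j' := by
    rintro rfl
    have m1 : s(c i, c j) ∈ fs.bd F := by rw [hbd, cyclicEdges_five]; simp
    have m2 : s(c i, c j) ∈ fs.bd F' := by rw [hbd', cyclicEdges_five]; simp
    obtain ⟨A, B, -, hAB⟩ := fs.two _ (fs.bd_subset F m1)
    have hij'' := hij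
    rw [← h.boundary_eq, mem_boundary_iff hAB] at hij''
    apply hij''
    rcases (hAB F).1 m1 with rfl | rfl <;> rcases (hAB F').1 m2 with rfl | rfl <;>
      first | exact absurd rfl hne | simp [hF, hF']
  have hcyc : ∀ i j, s(c i, c j) ∈ cyclicEdges c → j = i + 1 ∨ i = j + 1 := by
    rintro i j ⟨n, hn⟩
    rcases Sym2.eq_iff.1 hn with ⟨h1, h2⟩ | ⟨h1, h2⟩
    · left; rw [h.injective h1, h.injective h2]
    · right; rw [h.injective h1, h.injective h2]
  have hfin : ∀ i j k j' : Fin 4, i ≠ k → j ≠ j' → (j = i + 1 ∨ i = j + 1) →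
      (k = j + 1 ∨ j = k + 1) → (j' = i + 1 ∨ i = j' + 1) →
      (k = j' + 1 ∨ j' = k + 1) → k = i + 2 ∧ ((j = i + 1 ∧ j' = i + 3) ∨
        (j' = i + 1 ∧ j = i + 3)) := by decide
  have hfin := hfin i j k j' hik hjj (hcyc _ _ hij) (hcyc _ _ hjk) (hcyc _ _ hij') (hcyc _ _ hjk')
  have hci : ∀ n, a ≠ c n ∧ b ≠ c n := fun n => ⟨fun h => hac ⟨n, h.symm⟩, fun h => hbc ⟨n, h.symm⟩⟩
  have hcn : ∀ n n', c n ≠ c n' ↔ n ≠ n' := fun n n' => h.injective.ne_iff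
  have hbd2 : ∀ x, cyclicEdges ![a, b, c i, x, c k] = cyclicEdges ![c i, x, c k, a, b] := by
    intro x
    rw [cyclicEdges_five, cyclicEdges_five]; ext; simp; tauto
  have hbd3 : ∀ x, cyclicEdges ![a, b, c i, x, c k] = cyclicEdges ![c k, x, c i, b, a] := by
    intro x
    rw [cyclicEdges_five, cyclicEdges_five]; ext
    simp [Sym2.eq_swap (a := c k) (b := x), Sym2.eq_swap (a := x) (b := c i),
      Sym2.eq_swap (a := c i) (b := b), Sym2.eq_swap (a := b) (b := a),
      Sym2.eq_swap (a := a) (b := c k)]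
    tauto
  obtain ⟨rfl, hjs⟩ := hfin
  have hij1 : j ≠ i ∧ j ≠ i + 2 ∧ j' ≠ i ∧ j' ≠ i + 2 := by
    have : ∀ i : Fin 4, i + 1 ≠ i ∧ i + 1 ≠ i + 2 ∧ i + 3 ≠ i ∧ i + 3 ≠ i + 2 := by decide
    obtain ⟨m1, m2, m3, m4⟩ := this i
    rcases hjs with ⟨rfl, rfl⟩ | ⟨rfl, rfl⟩
    exacts [⟨m1, m2, m3, m4⟩, ⟨m3, m4, m1, m2⟩]
  obtain ⟨n1, n2, n3, n4⟩ := hij1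
  -- A strip can be read from either side and from either pole. Depending on `i` and on the sides of
  -- the two faces, one of the four readings has the form required in the goal.
  have s1 : fs.Strip (c i) (c j) (c (i + 2)) (c j') S :=
    strip_of_two_faces hS (p := b) (q := a) ((hcn _ _).2 hik) ⟨(hcn _ _).2 n1, (hcn _ _).2 n2⟩
      ⟨(hcn _ _).2 n3, (hcn _ _).2 n4⟩ ⟨(hci _).2, (hci _).2⟩ ⟨(hci _).1, (hci _).1⟩ hab.symm
      ((hcn _ _).2 hjj) (hci _).2 (hci _).2 (hci _).1 (hci _).1 (hbd2 _ ▸ hbd) (hbd2 _ ▸ hbd')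
  have s2 : fs.Strip (c i) (c j') (c (i + 2)) (c j) S :=
    strip_of_two_faces (hS.trans (Set.pair_comm _ _)) (p := b) (q := a) ((hcn _ _).2 hik)
      ⟨(hcn _ _).2 n3, (hcn _ _).2 n4⟩ ⟨(hcn _ _).2 n1, (hcn _ _).2 n2⟩
      ⟨(hci _).2, (hci _).2⟩ ⟨(hci _).1, (hci _).1⟩ hab.symm
      ((hcn _ _).2 hjj.symm) (hci _).2 (hci _).2 (hci _).1 (hci _).1
      (hbd2 _ ▸ hbd') (hbd2 _ ▸ hbd)
  have s3 : fs.Strip (c (i + 2)) (c j) (c i) (c j') S :=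
    strip_of_two_faces hS (p := a) (q := b) ((hcn _ _).2 hik.symm)
      ⟨(hcn _ _).2 n2, (hcn _ _).2 n1⟩
      ⟨(hcn _ _).2 n4, (hcn _ _).2 n3⟩ ⟨(hci _).1, (hci _).1⟩ ⟨(hci _).2, (hci _).2⟩ hab
      ((hcn _ _).2 hjj) (hci _).1 (hci _).1 (hci _).2 (hci _).2 (hbd3 _ ▸ hbd) (hbd3 _ ▸ hbd')
  have s4 : fs.Strip (c (i + 2)) (c j') (c i) (c j) S :=
    strip_of_two_faces (hS.trans (Set.pair_comm _ _)) (p := a) (q := b) ((hcn _ _).2 hik.symm)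
      ⟨(hcn _ _).2 n4, (hcn _ _).2 n3⟩ ⟨(hcn _ _).2 n2, (hcn _ _).2 n1⟩
      ⟨(hci _).1, (hci _).1⟩ ⟨(hci _).2, (hci _).2⟩ hab
      ((hcn _ _).2 hjj.symm) (hci _).1 (hci _).1 (hci _).2 (hci _).2
      (hbd3 _ ▸ hbd') (hbd3 _ ▸ hbd)
  clear! F F'
  fin_cases i <;> rcases hjs with ⟨rfl, rfl⟩ | ⟨rfl, rfl⟩
  · exact .inl s1
  · exact .inl s2
  · exact .inr s1
  · exact .inr s2
  · exact .inl s4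
  · exact .inl s3
  · exact .inr s4
  · exact .inr s3

end FaceSystem

/-! ### Gluing two strips along a path of length 2. -/

namespace FaceSystem

variable {V Φ : Type*} {G : SimpleGraph V} {fs : FaceSystem G Φ} {S : Set Φ}

theorem Strip.exists_at {u v : V} {k : ℕ} {t : ℕ → V}
    (h1 : ∀ i < k, ∃ F ∈ S, fs.bd F = cyclicEdges ![u, t (3 * i), v, t (3 * i + 2), t (3 * i + 1)])
    (h2 : ∀ i < k, ∃ F ∈ S,
      fs.bd F = cyclicEdges ![u, t (3 * i + 3), v, t (3 * i + 2), t (3 * i + 1)])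
    (hk : 1 ≤ k) {j : ℕ} (hj : j ≤ 3 * k) : ∃ F ∈ S, fs.At F (t j) := by
  by_cases h0 : j = 3 * k
  · obtain ⟨F, hF, hbd⟩ := h2 (k - 1) (by omega)
    refine ⟨F, hF, s(u, t j), ?_, by simp⟩
    rw [hbd, cyclicEdges_five, show 3 * (k - 1) + 3 = j by omega]
    simp
  · obtain ⟨F, hF, hbd⟩ := h1 (j / 3) (by omega)
    refine ⟨F, hF, ?_⟩
    have : j = 3 * (j / 3) ∨ j = 3 * (j / 3) + 1 ∨ j = 3 * (j / 3) + 2 := by omega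
    generalize j / 3 = i at *
    unfold At
    rw [hbd, cyclicEdges_five]
    rcases this with rfl | rfl | rfl
    · exact ⟨s(u, t (3 * i)), by simp, by simp⟩
    · exact ⟨s(t (3 * i + 1), u), by simp, by simp⟩
    · exact ⟨s(v, t (3 * i + 2)), by simp, by simp⟩

/-- In a strip there are two inside vertices that have no neighbours on the cycle except for one
pole. -/
theorem Strip.exists_inside {d : Fin 4 → V} (h : fs.IsDisk d S)
    (hs : fs.Strip (d 0) (d 1) (d 2) (d 3) S) :
    (∃ p, fs.Inside d S p ∧ ∀ x, G.Adj x p → x = d 0 ∨ fs.Inside d S x) ∧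
      ∃ q, fs.Inside d S q ∧ ∀ x, G.Adj x q → x = d 2 ∨ fs.Inside d S x := by
  obtain ⟨k, t, hk, ht0, htk, huv, hinj, hne, hf1, hf2, hf⟩ := hs
  have hinside : ∀ j, 0 < j → j < 3 * k → fs.Inside d S (t j) := by
    intro j h0 hj
    refine ⟨?_, Strip.exists_at hf1 hf2 hk hj.le⟩
    rintro ⟨i, hi⟩
    fin_cases i
    · exact (hne j hj.le).1 hi.symm
    · exact h0.ne (hinj (Set.mem_Iic.2 (Nat.zero_le _)) hj.le (ht0.trans hi))
    · exact (hne j hj.le).2 hi.symm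
    · exact hj.ne' (hinj (Set.mem_Iic.2 le_rfl) hj.le (htk.trans hi))
  constructor
  -- The neighbours of `t 1` are the pole `d 0` and `t 2`, and those of `t 2` are the pole `d 2` and
  -- `t 1`.
  · refine ⟨t 1, hinside 1 (by omega) (by omega), fun x hx => ?_⟩
    obtain ⟨F, hF, hxF⟩ := h.exists_bd_of_inside (hinside 1 (by omega) (by omega)) hx
    have hmem : ∀ j, j ≤ 3 * k → t 1 = t j → j = 1 := fun j hj h =>
      (hinj (Set.mem_Iic.2 (by omega)) hj h).symm
    obtain ⟨i, hi, hbd⟩ := hf F hF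
    have h2 := hne 1 (by omega)
    have hxF' : ∃ j ≤ 3 * k, j ≠ 1 ∧ (s(x, t 1) = s(d 0, t j) ∨ s(x, t 1) = s(t j, d 2) ∨
        s(x, t 1) = s(d 2, t (3 * i + 2)) ∨ s(x, t 1) = s(t (3 * i + 2), t (3 * i + 1)) ∨
        s(x, t 1) = s(t (3 * i + 1), d 0)) := by
      rcases hbd with hbd | hbd <;> rw [hbd, cyclicEdges_five] at hxF
      · exact ⟨3 * i, by omega, by omega, by simpa using hxF⟩
      · exact ⟨3 * i + 3, by omega, by omega, by simpa using hxF⟩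
    obtain ⟨j, hj, hj2, hcase⟩ := hxF'
    have e1 := hmem (3 * i + 1) (by omega)
    have e2 := hmem (3 * i + 2) (by omega)
    have ej := hmem j hj
    rcases hcase with hc | hc | hc | hc | hc <;>
      rcases Sym2.eq_iff.1 hc with ⟨c1, c2⟩ | ⟨c1, c2⟩
    · exact absurd (ej c2) hj2
    · exact absurd c2 h2.1
    · exact absurd c2 h2.2
    · exact absurd (ej c2) hj2
    · have := e2 c2; omega
    · exact absurd c2 h2.2
    · exact .inr (c1 ▸ hinside _ (by omega) (by omega))
    · have := e2 c2; omega
    · exact absurd c2 h2.1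
    · exact .inl c1
  · refine ⟨t 2, hinside 2 (by omega) (by omega), fun x hx => ?_⟩
    obtain ⟨F, hF, hxF⟩ := h.exists_bd_of_inside (hinside 2 (by omega) (by omega)) hx
    have hmem : ∀ j, j ≤ 3 * k → t 2 = t j → j = 2 := fun j hj h =>
      (hinj (Set.mem_Iic.2 (by omega)) hj h).symm
    obtain ⟨i, hi, hbd⟩ := hf F hF
    have h2 := hne 2 (by omega)
    have hxF' : ∃ j ≤ 3 * k, j ≠ 2 ∧ (s(x, t 2) = s(d 0, t j) ∨ s(x, t 2) = s(t j, d 2) ∨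
        s(x, t 2) = s(d 2, t (3 * i + 2)) ∨ s(x, t 2) = s(t (3 * i + 2), t (3 * i + 1)) ∨
        s(x, t 2) = s(t (3 * i + 1), d 0)) := by
      rcases hbd with hbd | hbd <;> rw [hbd, cyclicEdges_five] at hxF
      · exact ⟨3 * i, by omega, by omega, by simpa using hxF⟩
      · exact ⟨3 * i + 3, by omega, by omega, by simpa using hxF⟩
    obtain ⟨j, hj, hj2, hcase⟩ := hxF'
    have e1 := hmem (3 * i + 1) (by omega)
    have e2 := hmem (3 * i + 2) (by omega)
    have ej := hmem j hj
    rcases hcase with hc | hc | hc | hc | hc <;>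
      rcases Sym2.eq_iff.1 hc with ⟨c1, c2⟩ | ⟨c1, c2⟩
    · exact absurd (ej c2) hj2
    · exact absurd c2 h2.1
    · exact absurd c2 h2.2
    · exact absurd (ej c2) hj2
    · exact .inl c1
    · exact absurd c2 h2.2
    · have := e1 c2; omega
    · exact .inr (c1 ▸ hinside _ (by omega) (by omega))
    · exact absurd c2 h2.1
    · have := e1 c2; omega

/-- The path from `a` through `w` to `c` is common to both cycles and cancels. -/
theorem symmDiff_four_cycles {a b c d w : V} (h : [a, b, c, d, w].Nodup) :
    symmDiff {s(a, b), s(b, c), s(c, w), s(w, a)} {s(a, w), s(w, c), s(c, d), s(d, a)} =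
      ({s(a, b), s(b, c), s(c, d), s(d, a)} : Set (Sym2 V)) := by
  simp only [List.nodup_cons, List.mem_cons, List.not_mem_nil, or_false, not_or] at h
  obtain ⟨⟨h1, h2, h3, h4⟩, ⟨h5, h6, h7⟩, ⟨h8, h9⟩, h10, -⟩ := h
  rw [Sym2.eq_swap (a := c) (b := w), Sym2.eq_swap (a := w) (b := a)]
  have n1 : s(a, b) ≠ s(a, w) := by simp [*]
  have n2 : s(a, b) ≠ s(w, c) := by simp [*]
  have n3 : s(a, b) ≠ s(c, d) := by simp [*]
  have n4 : s(a, b) ≠ s(d, a) := by simp [*, Ne.symm]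
  have n5 : s(b, c) ≠ s(a, w) := by simp [*]
  have n6 : s(b, c) ≠ s(w, c) := by simp [*]
  have n7 : s(b, c) ≠ s(c, d) := by simp [*]
  have n8 : s(b, c) ≠ s(d, a) := by simp [*]
  have n9 : s(c, d) ≠ s(a, w) := by simp [*, Ne.symm h2]
  have n10 : s(c, d) ≠ s(w, c) := by simp [*]
  have n11 : s(d, a) ≠ s(a, w) := by simp [*, Ne.symm h3]
  have n12 : s(d, a) ≠ s(w, c) := by simp [*]
  ext e
  simp only [Set.mem_symmDiff, Set.mem_insert_iff, Set.mem_singleton_iff]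
  constructor
  · tauto
  · rintro (rfl | rfl | rfl | rfl)
    · simp [*]
    · simp [*]
    · right; refine ⟨by tauto, ?_⟩; push Not; exact ⟨n3.symm, n7.symm, n10, n9⟩
    · right; refine ⟨by tauto, ?_⟩; push Not; exact ⟨n4.symm, n8.symm, n12, n11⟩

/-- The vertex sequences are concatenated at `w`, which ends the first and starts the second. What
needs proof is that they share no other vertex and that `S` is the disjoint union of `T₁` and `T₂`.
-/
theorem Strip.glue [Finite V] [Finite Φ] {c : Fin 4 → V} {w : V} {T₁ T₂ : Set Φ}
    (h : fs.IsDisk c S) (h₁ : fs.IsDisk ![c 0, c 1, c 2, w] T₁)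
    (h₂ : fs.IsDisk ![c 0, w, c 2, c 3] T₂) (hT₁ : T₁ ⊆ S) (hT₂ : T₂ ⊆ S)
    (hw : w ∉ Set.range c)
    (s₁ : fs.Strip (c 0) (c 1) (c 2) w T₁) (s₂ : fs.Strip (c 0) w (c 2) (c 3) T₂) :
    fs.Strip (c 0) (c 1) (c 2) (c 3) S := by
  have hcn : ∀ i j, c i ≠ c j ↔ i ≠ j := fun i j => h.injective.ne_iff
  have hwc : ∀ i, w ≠ c i := fun i hi => hw ⟨i, hi.symm⟩
  have hsd : S = symmDiff T₁ T₂ := by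
    apply eq_of_boundary (fs := fs) _ h.out_notMem
    · simp [Set.mem_symmDiff, h₁.out_notMem, h₂.out_notMem]
    · rw [boundary_symmDiff, h.boundary_eq, h₁.boundary_eq, h₂.boundary_eq, cyclicEdges_four,
        cyclicEdges_four]
      have hc : cyclicEdges c = cyclicEdges ![c 0, c 1, c 2, c 3] := by
        congr 1; ext i; fin_cases i <;> rfl
      rw [hc, cyclicEdges_four, symmDiff_four_cycles]
      simp [h.injective.eq_iff, Ne.symm (hwc _)]
  have hdisj : ∀ F ∈ T₁, F ∉ T₂ := by
    intro F hF hF'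
    have := hsd ▸ hT₁ hF
    simp [Set.mem_symmDiff, hF, hF'] at this
  have hunion : ∀ F ∈ S, F ∈ T₁ ∨ F ∈ T₂ := by
    intro F hF
    rw [hsd] at hF
    rcases hF with hF | hF
    exacts [.inl hF.1, .inr hF.1]
  obtain ⟨k₁, t₁, hk₁, hx₁, hy₁, huv, hinj₁, hne₁, f₁, g₁, a₁⟩ := s₁
  obtain ⟨k₂, t₂, hk₂, hx₂, hy₂, -, hinj₂, hne₂, f₂, g₂, a₂⟩ := s₂
  -- Between `c 1` and `w` the vertices of the first strip are inside `T₁`, so all their faces lie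
  -- in `T₁`; every vertex of the second strip has a face in `T₂`.
  have hout : ∀ j < 3 * k₁, t₁ j = c 1 ∨ ∀ F, fs.At F (t₁ j) → F ∈ T₁ := by
    intro j hj
    by_cases h0 : j = 0
    · left; rw [h0, hx₁]
    right
    intro F hF
    refine h₁.mem_of_inside ⟨?_, exists_at f₁ g₁ hk₁ hj.le⟩ hF
    rintro ⟨i, hi⟩
    fin_cases i
    · exact (hne₁ j hj.le).1 hi.symm
    · exact h0 (hinj₁ hj.le (Set.mem_Iic.2 (Nat.zero_le _)) (hi.symm.trans hx₁.symm))
    · exact (hne₁ j hj.le).2 hi.symm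
    · exact hj.ne' (hinj₁ (Set.mem_Iic.2 le_rfl) hj.le (hy₁.trans hi))
  have hat₂ : ∀ j, j ≤ 3 * k₂ → ∃ F ∈ T₂, fs.At F (t₂ j) := fun j hj => exists_at f₂ g₂ hk₂ hj
  -- If `c 1` occurred in the second strip it would lie strictly inside `T₂`, with all its faces in
  -- `S`; but it has a face outside `S`.
  have hc1 : ∀ j, 0 < j → j ≤ 3 * k₂ → t₂ j ≠ c 1 := by
    intro j h0 hj he
    by_cases hj3 : j = 3 * k₂
    · rw [hj3, hy₂] at he
      exact (hcn 3 1).2 (by decide) he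
    obtain ⟨-, -, F, hF, -, hF'⟩ := h.exists_mem_notMem 1
    refine hF (hT₂ (h₂.mem_of_inside ⟨?_, hat₂ j hj⟩ (he ▸ hF')))
    rintro ⟨i, hi⟩
    rw [he] at hi
    fin_cases i
    · exact (hcn 0 1).2 (by decide) hi
    · exact hwc 1 hi
    · exact (hcn 2 1).2 (by decide) hi
    · exact (hcn 3 1).2 (by decide) hi
  have hcross : ∀ i < 3 * k₁, ∀ j, 0 < j → j ≤ 3 * k₂ → t₁ i ≠ t₂ j := by
    intro i hi j h0 hj he
    rcases hout i hi with h1 | h1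
    · exact hc1 j h0 hj (he ▸ h1)
    · obtain ⟨F, hF, hF'⟩ := hat₂ j hj
      exact hdisj F (h1 F (he ▸ hF')) hF
  have hcross' : ∀ i ≤ 3 * k₁, ∀ j, 0 < j → j ≤ 3 * k₂ → t₁ i ≠ t₂ j := by
    intro i hi j h0 hj he
    rcases hi.lt_or_eq with hi | rfl
    · exact hcross i hi j h0 hj he
    · rw [hy₁, ← hx₂] at he
      exact h0.ne (hinj₂ (Set.mem_Iic.2 (Nat.zero_le _)) hj he)
  let t : ℕ → V := fun j => if j ≤ 3 * k₁ then t₁ j else t₂ (j - 3 * k₁)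
  have ht₁ : ∀ j ≤ 3 * k₁, t j = t₁ j := fun j hj => if_pos hj
  have ht₂ : ∀ j, t (3 * k₁ + j) = t₂ j := by
    intro j
    rcases Nat.eq_zero_or_pos j with rfl | hj
    · rw [Nat.add_zero, ht₁ _ le_rfl, hy₁, hx₂]
    · simp only [t]
      rw [if_neg (by omega), Nat.add_sub_cancel_left]
  have hfst : ∀ i < k₁, t (3 * i) = t₁ (3 * i) ∧ t (3 * i + 1) = t₁ (3 * i + 1) ∧
      t (3 * i + 2) = t₁ (3 * i + 2) ∧ t (3 * i + 3) = t₁ (3 * i + 3) := fun i hi =>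
    ⟨ht₁ _ (by omega), ht₁ _ (by omega), ht₁ _ (by omega), ht₁ _ (by omega)⟩
  have hsnd : ∀ i, t (3 * (k₁ + i)) = t₂ (3 * i) ∧ t (3 * (k₁ + i) + 1) = t₂ (3 * i + 1) ∧
      t (3 * (k₁ + i) + 2) = t₂ (3 * i + 2) ∧ t (3 * (k₁ + i) + 3) = t₂ (3 * i + 3) := by
    intro i
    simp only [Nat.mul_add, Nat.add_assoc, ht₂, and_self]
  refine ⟨k₁ + k₂, t, by omega, ?_, ?_, huv, ?_, ?_, ?_, ?_, ?_⟩
  · rw [ht₁ _ (by omega), hx₁]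
  · rw [Nat.mul_add, ht₂, hy₂]
  · intro i hi j hj hij
    simp only [Set.mem_Iic] at hi hj
    rcases le_or_gt i (3 * k₁) with h1 | h1 <;> rcases le_or_gt j (3 * k₁) with h2 | h2
    · rw [ht₁ i h1, ht₁ j h2] at hij
      exact hinj₁ h1 h2 hij
    · obtain ⟨j, rfl⟩ := Nat.exists_eq_add_of_lt h2
      rw [ht₁ i h1, Nat.add_assoc, ht₂] at hij
      exact absurd hij (hcross' i h1 _ (by omega) (by omega))
    · obtain ⟨i, rfl⟩ := Nat.exists_eq_add_of_lt h1
      rw [ht₁ j h2, Nat.add_assoc, ht₂] at hij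
      exact absurd hij.symm (hcross' j h2 _ (by omega) (by omega))
    · obtain ⟨i, rfl⟩ := Nat.exists_eq_add_of_lt h1
      obtain ⟨j, rfl⟩ := Nat.exists_eq_add_of_lt h2
      rw [Nat.add_assoc, Nat.add_assoc, ht₂, ht₂] at hij
      have := hinj₂ (Set.mem_Iic.2 (by omega)) (Set.mem_Iic.2 (by omega)) hij
      omega
  · intro j hj
    rcases le_or_gt j (3 * k₁) with h1 | h1
    · rw [ht₁ j h1]; exact hne₁ j h1
    · obtain ⟨j, rfl⟩ := Nat.exists_eq_add_of_lt h1
      rw [Nat.add_assoc, ht₂]; exact hne₂ _ (by omega)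
  · intro i hi
    rcases lt_or_ge i k₁ with h1 | h1
    · obtain ⟨e1, e2, e3, -⟩ := hfst i h1
      rw [e1, e2, e3]
      obtain ⟨F, hF, hbd⟩ := f₁ i h1
      exact ⟨F, hT₁ hF, hbd⟩
    · obtain ⟨i, rfl⟩ := Nat.exists_eq_add_of_le h1
      obtain ⟨e1, e2, e3, -⟩ := hsnd i
      rw [e1, e2, e3]
      obtain ⟨F, hF, hbd⟩ := f₂ i (by omega)
      exact ⟨F, hT₂ hF, hbd⟩
  · intro i hi
    rcases lt_or_ge i k₁ with h1 | h1
    · obtain ⟨-, e2, e3, e4⟩ := hfst i h1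
      rw [e2, e3, e4]
      obtain ⟨F, hF, hbd⟩ := g₁ i h1
      exact ⟨F, hT₁ hF, hbd⟩
    · obtain ⟨i, rfl⟩ := Nat.exists_eq_add_of_le h1
      obtain ⟨-, e2, e3, e4⟩ := hsnd i
      rw [e2, e3, e4]
      obtain ⟨F, hF, hbd⟩ := g₂ i (by omega)
      exact ⟨F, hT₂ hF, hbd⟩
  · intro F hF
    rcases hunion F hF with hF | hF
    · obtain ⟨i, hi, hbd⟩ := a₁ F hF
      obtain ⟨e1, e2, e3, e4⟩ := hfst i hi
      refine ⟨i, by omega, ?_⟩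
      rwa [e1, e2, e3, e4]
    · obtain ⟨i, hi, hbd⟩ := a₂ F hF
      obtain ⟨e1, e2, e3, e4⟩ := hsnd i
      refine ⟨k₁ + i, by omega, ?_⟩
      rwa [e1, e2, e3, e4]

end FaceSystem

/-! ### The induction on the number of faces. -/

namespace FaceSystem

variable {V Φ : Type*} {G : SimpleGraph V} {fs : FaceSystem G Φ}

/-- An inside vertex with two opposite neighbours on a 4-cycle splits it into two strips. -/
theorem IsDisk.strip_of_opposite [Finite V] [Finite Φ] {S : Set Φ} {c : Fin 4 → V}
    (h : fs.IsDisk c S) (hdom : fs.Dominates c S)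
    (ih : ∀ (d : Fin 4 → V) (T : Set Φ), T.ncard < S.ncard → fs.IsDisk d T →
      fs.Dominates d T →
      fs.Strip (d 0) (d 1) (d 2) (d 3) T ∨ fs.Strip (d 1) (d 2) (d 3) (d 0) T)
    {w : V} (hw : fs.Inside c S w) (h0 : G.Adj (c 0) w) (h2 : G.Adj (c 2) w) :
    fs.Strip (c 0) (c 1) (c 2) (c 3) S := by
  have hwc : ∀ i, w ≠ c i := fun i hi => hw.1 ⟨i, hi.symm⟩
  have hin : ∀ i, G.Adj (c i) w → ∃ F ∈ S, s(w, c i) ∈ fs.bd F := by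
    intro i hi
    obtain ⟨F, hF, hF'⟩ := h.exists_bd_of_inside hw hi
    exact ⟨F, hF, by rwa [Sym2.eq_swap] at hF'⟩
  obtain ⟨T₁, hT₁, hs₁, hl₁, hd₁⟩ := h.exists_smaller hdom (d := ![c 0, c 1, c 2, w]) (by norm_num)
    (by
      intro a b hab
      fin_cases a <;> fin_cases b <;>
        simp_all [h.injective.eq_iff, Ne.symm (hwc _)])
    (by
      intro a
      fin_cases a
      exacts [h.adj 0, h.adj 1, h2, h0.symm])
    (by
      intro a
      fin_cases a
      · exact fun hx => absurd (mem_cyclicEdges_self c 0) hx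
      · exact fun hx => absurd (mem_cyclicEdges_self c 1) hx
      · exact fun _ => h.exists_bd_of_inside hw h2
      · exact fun _ => hin 0 h0)
    (mem_cyclicEdges_self _ 2)
    (fun he => hw.1 (mem_range_of_mem_cyclicEdges he (by simp)))
  obtain ⟨T₂, hT₂, hs₂, hl₂, hd₂⟩ := h.exists_smaller hdom (d := ![c 0, w, c 2, c 3]) (by norm_num)
    (by
      intro a b hab
      fin_cases a <;> fin_cases b <;>
        simp_all [h.injective.eq_iff, Ne.symm (hwc _)])
    (by
      intro a
      fin_cases a
      exacts [h0, h2.symm, h.adj 2, h.adj 3])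
    (by
      intro a
      fin_cases a
      · exact fun _ => h.exists_bd_of_inside hw h0
      · exact fun _ => hin 2 h2
      · exact fun hx => absurd (mem_cyclicEdges_self c 2) hx
      · exact fun hx => absurd (mem_cyclicEdges_self c 3) hx)
    (mem_cyclicEdges_self _ 0)
    (fun he => hw.1 (mem_range_of_mem_cyclicEdges he (by simp)))
  -- Such a `q` has no neighbour on `c`: `w` is not on `c`, and a vertex inside `d` is inside `c`.
  have hcontra : ∀ {d : Fin 4 → V} {T : Set Φ}, fs.IsDisk d T → T ⊆ S →
      ∀ q, fs.Inside d T q → (∀ x, G.Adj x q → x = w ∨ fs.Inside d T x) → False := by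
    intro d T hT hTS q hq hx
    obtain ⟨i, hi⟩ := hdom q (h.inside_of_subset hT hTS hq)
    rcases hx _ hi with h1 | h1
    · exact hwc i h1.symm
    · exact h.notMem_range_of_inside hT hTS h1 i rfl
  refine Strip.glue h hT₁ hT₂ hs₁ hs₂ hw.1 ?_ ?_
  -- A strip in the other direction has `w` as a pole; the vertex next to `w` on a path of length 3
  -- is then excluded by `hcontra`.
  · refine (ih _ _ hl₁ hT₁ hd₁).resolve_right fun hs => ?_
    obtain ⟨-, q, hq, hq'⟩ := Strip.exists_inside (hT₁.comp_add 1) hs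
    exact hcontra (hT₁.comp_add 1) hs₁ q hq hq'
  · refine (ih _ _ hl₂ hT₂ hd₂).resolve_right fun hs => ?_
    obtain ⟨⟨q, hq, hq'⟩, -⟩ := Strip.exists_inside (hT₂.comp_add 1) hs
    exact hcontra (hT₂.comp_add 1) hs₂ q hq hq'

/-- Triangles and 4-cycles share one induction, because a 4-cycle that is not irreducible either
contains a triangle with fewer faces or is split by a vertex with two opposite neighbours. -/
theorem not_dominates_three_and_strip [Finite V] [Finite Φ] (n : ℕ) : ∀ S : Set Φ, S.ncard = n →
    (∀ c : Fin 3 → V, fs.IsDisk c S → ¬ fs.Dominates c S) ∧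
    ∀ c : Fin 4 → V, fs.IsDisk c S → fs.Dominates c S →
      fs.Strip (c 0) (c 1) (c 2) (c 3) S ∨ fs.Strip (c 1) (c 2) (c 3) (c 0) S := by
  induction n using Nat.strong_induction_on with | _ n ih
  rintro S rfl
  have htri : ¬ ∃ (d : Fin 3 → V) (T : Set Φ),
      fs.IsDisk d T ∧ T.ncard < S.ncard ∧ fs.Dominates d T := by
    rintro ⟨d, T, hT, hlt, hd⟩
    exact (ih _ hlt T rfl).1 d hT hd
  constructor
  · intro c h hdom
    have hadj : ∀ i j : Fin 3, i = j ∨ j = i + 1 ∨ i = j + 1 := by decide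
    refine h.not_irreducible_three hdom ⟨?_, ?_⟩
    · intro i j F hF he
      rcases hadj i j with rfl | rfl | rfl
      · exact absurd (fs.bd_subset F he) (by simp)
      · exact mem_cyclicEdges_self c i
      · rw [Sym2.eq_swap]; exact mem_cyclicEdges_self c j
    · intro w hw i j hi hj
      by_contra hne
      rcases hadj i j with rfl | rfl | rfl
      · exact hne rfl
      · exact htri (h.triangle_of_inside hdom hw hi hj)
      · exact htri (h.triangle_of_inside hdom hw hj hi)
  · intro c h hdom
    have hadj : ∀ i j : Fin 4, i = j ∨ j = i + 1 ∨ i = j + 1 ∨ j = i + 1 + 1 := by decide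
    have ih4 : ∀ (d : Fin 4 → V) (T : Set Φ), T.ncard < S.ncard → fs.IsDisk d T →
        fs.Dominates d T →
        fs.Strip (d 0) (d 1) (d 2) (d 3) T ∨ fs.Strip (d 1) (d 2) (d 3) (d 0) T :=
      fun d T hlt => (ih _ hlt T rfl).2 d
    by_cases hopp0 : ∃ w, fs.Inside c S w ∧ G.Adj (c 0) w ∧ G.Adj (c 2) w
    · obtain ⟨w, hw, h0, h2⟩ := hopp0
      exact .inl (h.strip_of_opposite hdom ih4 hw h0 h2)
    by_cases hopp1 : ∃ w, fs.Inside c S w ∧ G.Adj (c 1) w ∧ G.Adj (c 3) w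
    · obtain ⟨w, hw, h0, h2⟩ := hopp1
      have hr : ∀ x, x ∈ Set.range (fun i => c (i + 1)) ↔ x ∈ Set.range c := fun x =>
        ⟨fun ⟨i, hi⟩ => ⟨i + 1, hi⟩, fun ⟨i, hi⟩ => ⟨i - 1, by simpa using hi⟩⟩
      refine .inr ((h.comp_add 1).strip_of_opposite ?_ ih4 (w := w) ?_ h0 h2)
      · intro x hx
        obtain ⟨i, hi⟩ := hdom x ⟨fun hc => hx.1 ((hr x).2 hc), hx.2⟩
        exact ⟨i - 1, by simpa using hi⟩
      · exact ⟨fun hc => hw.1 ((hr w).1 hc), hw.2⟩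
    refine h.strip_of_irreducible hdom ⟨?_, ?_⟩
    · intro i j F hF he
      rcases hadj i j with rfl | rfl | rfl | rfl
      · exact absurd (fs.bd_subset F he) (by simp)
      · exact mem_cyclicEdges_self c i
      · rw [Sym2.eq_swap]; exact mem_cyclicEdges_self c j
      · by_contra hc
        exact htri (h.triangle_of_chord hdom hF he hc)
    · intro w hw i j hi hj
      by_contra hne
      rcases hadj i j with rfl | rfl | rfl | rfl
      · exact hne rfl
      · exact htri (h.triangle_of_inside hdom hw hi hj)
      · exact htri (h.triangle_of_inside hdom hw hj hi)
      · fin_cases i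
        · exact hopp0 ⟨w, hw, hi, hj⟩
        · exact hopp1 ⟨w, hw, hi, hj⟩
        · exact hopp0 ⟨w, hw, hj, hi⟩
        · exact hopp1 ⟨w, hw, hj, hi⟩

/-- A 4-cycle that dominates its interior is filled by an alternating sequence of paths. -/
theorem IsDisk.strip [Finite V] [Finite Φ] {S : Set Φ} {c : Fin 4 → V} (h : fs.IsDisk c S)
    (hdom : fs.Dominates c S) :
    fs.Strip (c 0) (c 1) (c 2) (c 3) S ∨ fs.Strip (c 1) (c 2) (c 3) (c 0) S :=
  (not_dominates_three_and_strip _ S rfl).2 c h hdom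

end FaceSystem

/-! ### A square root that changes sign across a polygonal arc. -/

open Filter Topology

/-- The plane as the complex line. -/
noncomputable def toComplex : Plane ≃ₗᵢ[ℝ] ℂ := Complex.orthonormalBasisOneI.repr.symm

/-- The principal square root. -/
noncomputable def halfExpLog (z : ℂ) : ℂ := Complex.exp (Complex.log z / 2)

theorem halfExpLog_sq {z : ℂ} (hz : z ≠ 0) : halfExpLog z ^ 2 = z := by
  rw [halfExpLog, ← Complex.exp_nat_mul]
  push_cast
  rw [mul_div_cancel₀ _ two_ne_zero, Complex.exp_log hz]

theorem halfExpLog_ne_zero (z : ℂ) : halfExpLog z ≠ 0 := Complex.exp_ne_zero _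

theorem continuousAt_halfExpLog {z : ℂ} (hz : z ∈ Complex.slitPlane) :
    ContinuousAt halfExpLog z :=
  ((Complex.differentiableAt_log hz).continuousAt.div_const 2).cexp

theorem halfExpLog_one : halfExpLog 1 = 1 := by simp [halfExpLog]

/-- At the branch cut the argument tends to π from above and to -π from below, so the two limits of
the root at -1 differ by a sign. -/
theorem tendsto_halfExpLog_above :
    Tendsto halfExpLog (𝓝[{z | 0 < z.im}] (-1)) (𝓝 Complex.I) := by
  have h := Complex.tendsto_log_nhdsWithin_im_nonneg_of_re_neg_of_im_zero (z := -1) (by simp)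
    (by simp)
  have h2 := ((h.mono_left (nhdsWithin_mono _ fun z (hz : 0 < z.im) => hz.le)).div_const 2).cexp
  have h3 : Complex.exp ((↑(Real.log ‖(-1 : ℂ)‖) + Real.pi * Complex.I) / 2) = Complex.I := by
    rw [norm_neg, norm_one, Real.log_one, Complex.ofReal_zero, zero_add, mul_div_right_comm,
      Complex.exp_pi_div_two_mul_I]
  rwa [h3] at h2

theorem tendsto_halfExpLog_below :
    Tendsto halfExpLog (𝓝[{z | z.im < 0}] (-1)) (𝓝 (-Complex.I)) := by
  have h := Complex.tendsto_log_nhdsWithin_im_neg_of_re_neg_of_im_zero (z := -1) (by simp)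
    (by simp)
  have h2 := (h.div_const 2).cexp
  have h3 : Complex.exp ((↑(Real.log ‖(-1 : ℂ)‖) - Real.pi * Complex.I) / 2) = -Complex.I := by
    rw [norm_neg, norm_one, Real.log_one, Complex.ofReal_zero, zero_sub, neg_div,
      Complex.exp_neg, mul_div_right_comm, Complex.exp_pi_div_two_mul_I, Complex.inv_I]
  rwa [h3] at h2

/-- The complex ratio of the vectors from `w` to `q` and to `p`. -/
noncomputable def viewRatio (p q w : Plane) : ℂ :=
  (toComplex q - toComplex w) / (toComplex p - toComplex w)

theorem toComplex_sub_ne_zero {p q : Plane} (h : p ≠ q) : toComplex p - toComplex q ≠ 0 :=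
  sub_ne_zero.2 fun e => h (toComplex.injective e)

/-- If the ratio is `-t` with `t ≥ 0`, then `w = (t p + q) / (1 + t)`, a point of the segment. -/
theorem viewRatio_mem_slitPlane {p q w : Plane} (hw : w ∉ segment ℝ p q) :
    viewRatio p q w ∈ Complex.slitPlane := by
  by_contra hcon
  rw [Complex.mem_slitPlane_iff, not_or, not_lt, not_not] at hcon
  obtain ⟨hre, him⟩ := hcon
  have hp : toComplex p - toComplex w ≠ 0 :=
    toComplex_sub_ne_zero fun e => hw (e ▸ left_mem_segment ℝ p q)
  obtain ⟨t, ht⟩ : ∃ t : ℝ, viewRatio p q w = -(t : ℂ) :=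
    ⟨-(viewRatio p q w).re, by apply Complex.ext <;> simp [him]⟩
  have ht0 : 0 ≤ t := by simpa [ht] using hre
  have ht1 : (1 : ℂ) + t ≠ 0 := by
    norm_cast; positivity
  rw [viewRatio, div_eq_iff hp] at ht
  apply hw
  refine ⟨t / (1 + t), 1 / (1 + t), by positivity, by positivity, ?_, ?_⟩
  · field_simp; ring
  · apply toComplex.injective
    rw [map_add, map_smul, map_smul, Complex.real_smul, Complex.real_smul]
    push_cast
    field_simp
    linear_combination ht

theorem continuousAt_viewRatio {p q w : Plane} (h : p ≠ w) : ContinuousAt (viewRatio p q) w := by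
  unfold viewRatio
  exact (continuousAt_const.sub toComplex.continuous.continuousAt).div
    (continuousAt_const.sub toComplex.continuous.continuousAt) (toComplex_sub_ne_zero h)

/-- The ratio is `1 + (q - p) / (p - w)`. -/
theorem tendsto_viewRatio_cobounded (p q : Plane) :
    Tendsto (viewRatio p q) (Bornology.cobounded Plane) (𝓝 1) := by
  have h1 : Tendsto (fun w => toComplex p - toComplex w) (Bornology.cobounded Plane)
      (Bornology.cobounded ℂ) :=
    (tendsto_const_sub_cobounded _).comp toComplex.isometry.antilipschitz.tendsto_cobounded
  have h2 := (tendsto_inv₀_cobounded.comp h1).const_mul (toComplex q - toComplex p)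
  have h3 := h2.const_add 1
  rw [mul_zero, add_zero] at h3
  refine h3.congr' ?_
  have : ∀ᶠ w in Bornology.cobounded Plane, w ∈ ({p} : Set Plane)ᶜ :=
    Bornology.isBounded_def.1 Bornology.isBounded_singleton
  filter_upwards [this] with w hw
  have hp : toComplex p - toComplex w ≠ 0 := toComplex_sub_ne_zero fun e => hw e.symm
  simp only [viewRatio, Function.comp_apply]
  field_simp
  ring

/-- The square root of the ratio `viewRatio p q`, continuous off the segment. -/
noncomputable def segmentRoot (p q w : Plane) : ℂ := halfExpLog (viewRatio p q w)

theorem continuousAt_segmentRoot {p q w : Plane} (hw : w ∉ segment ℝ p q) :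
    ContinuousAt (segmentRoot p q) w :=
  ContinuousAt.comp (f := viewRatio p q) (continuousAt_halfExpLog (viewRatio_mem_slitPlane hw))
    (continuousAt_viewRatio fun e => hw (e ▸ left_mem_segment ℝ p q))

theorem tendsto_segmentRoot_cobounded (p q : Plane) :
    Tendsto (segmentRoot p q) (Bornology.cobounded Plane) (𝓝 1) := by
  have := (continuousAt_halfExpLog Complex.one_mem_slitPlane).tendsto.comp
    (tendsto_viewRatio_cobounded p q)
  rwa [halfExpLog_one] at this

/-- The linear form that vanishes in the direction from `q` to `p`. -/
noncomputable def sideForm (p q : Plane) : Plane →L[ℝ] ℝ :=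
  Complex.imCLM.comp ((ContinuousLinearMap.mul ℝ ℂ
    ((starRingEnd ℂ) (toComplex q - toComplex p))).comp
      (toComplex.toContinuousLinearEquiv : Plane →L[ℝ] ℂ))

theorem sideForm_apply (p q w : Plane) : sideForm p q w =
    ((starRingEnd ℂ) (toComplex q - toComplex p) * toComplex w).im := rfl

/-- The denominator is positive off `p`, so the side of the line through `p` and `q` determines the
side of the branch cut from which the ratio approaches -1 at the midpoint. -/
theorem im_viewRatio_midpoint (p q w : Plane) : (viewRatio p q w).im =
    (sideForm p q w - sideForm p q (midpoint ℝ p q)) /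
      Complex.normSq (toComplex p - toComplex w) := by
  have hm : toComplex (midpoint ℝ p q) = (1 / 2 : ℝ) • (toComplex p + toComplex q) := by
    rw [midpoint_eq_smul_add, map_smul, map_add]; norm_num
  rw [viewRatio, Complex.div_im, sideForm_apply, sideForm_apply, hm]
  simp only [Complex.sub_re, Complex.sub_im, Complex.mul_im, Complex.conj_re, Complex.conj_im,
    Complex.smul_re, Complex.smul_im, Complex.add_re, Complex.add_im, smul_eq_mul]
  ring

theorem viewRatio_midpoint {p q : Plane} (h : p ≠ q) :
    viewRatio p q (midpoint ℝ p q) = -1 := by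
  have hm : toComplex (midpoint ℝ p q) = (1 / 2 : ℂ) * (toComplex p + toComplex q) := by
    rw [midpoint_eq_smul_add, map_smul, map_add, Complex.real_smul]; norm_num
  have hne := toComplex_sub_ne_zero h
  rw [viewRatio, hm, div_eq_iff]
  · ring
  · intro h0
    apply hne
    linear_combination 2 * h0

theorem left_ne_midpoint {p q : Plane} (h : p ≠ q) : p ≠ midpoint ℝ p q := fun e =>
  h ((midpoint_eq_left_iff ℝ).1 e.symm)

theorem right_ne_midpoint {p q : Plane} (h : p ≠ q) : q ≠ midpoint ℝ p q := fun e =>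
  h ((midpoint_eq_right_iff ℝ).1 e.symm)

theorem tendsto_segmentRoot_above {p q : Plane} (h : p ≠ q) :
    Tendsto (segmentRoot p q)
      (𝓝[{w | sideForm p q (midpoint ℝ p q) < sideForm p q w}] (midpoint ℝ p q))
      (𝓝 Complex.I) := by
  refine tendsto_halfExpLog_above.comp (tendsto_nhdsWithin_iff.2 ⟨?_, ?_⟩)
  · rw [← viewRatio_midpoint h]
    exact (continuousAt_viewRatio (left_ne_midpoint h)).tendsto.mono_left nhdsWithin_le_nhds
  · filter_upwards [self_mem_nhdsWithin,
      nhdsWithin_le_nhds (isOpen_compl_singleton.mem_nhds (left_ne_midpoint h).symm)] with w hw hp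
    rw [im_viewRatio_midpoint]
    exact div_pos (sub_pos.2 hw) (Complex.normSq_pos.2 (toComplex_sub_ne_zero (Ne.symm hp)))

theorem tendsto_segmentRoot_below {p q : Plane} (h : p ≠ q) :
    Tendsto (segmentRoot p q)
      (𝓝[{w | sideForm p q w < sideForm p q (midpoint ℝ p q)}] (midpoint ℝ p q))
      (𝓝 (-Complex.I)) := by
  refine tendsto_halfExpLog_below.comp (tendsto_nhdsWithin_iff.2 ⟨?_, ?_⟩)
  · rw [← viewRatio_midpoint h]
    exact (continuousAt_viewRatio (left_ne_midpoint h)).tendsto.mono_left nhdsWithin_le_nhds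
  · filter_upwards [self_mem_nhdsWithin,
      nhdsWithin_le_nhds (isOpen_compl_singleton.mem_nhds (left_ne_midpoint h).symm)] with w hw hp
    rw [im_viewRatio_midpoint]
    exact div_neg_of_neg_of_pos (sub_neg.2 hw)
      (Complex.normSq_pos.2 (toComplex_sub_ne_zero (Ne.symm hp)))

theorem sideForm_eq_iff {p q : Plane} (h : p ≠ q) (w z : Plane) :
    sideForm p q w = sideForm p q z ↔ ∃ t : ℝ, w - z = t • (q - p) := by
  rw [← sub_eq_zero, ← map_sub, sideForm_apply]
  have hd : toComplex q - toComplex p ≠ 0 := toComplex_sub_ne_zero h.symm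
  set d := toComplex q - toComplex p with hd'
  constructor
  · intro h0
    refine ⟨((starRingEnd ℂ) d * toComplex (w - z)).re / Complex.normSq d, ?_⟩
    apply toComplex.injective
    rw [map_smul, map_sub toComplex q p, ← hd', Complex.real_smul]
    have h1 : (starRingEnd ℂ) d * toComplex (w - z) =
        (((starRingEnd ℂ) d * toComplex (w - z)).re : ℂ) := by
      apply Complex.ext
      · rw [Complex.ofReal_re]
      · rw [Complex.ofReal_im, h0]
    have h2 : ((Complex.normSq d : ℝ) : ℂ) = (starRingEnd ℂ) d * d := by
      rw [mul_comm, Complex.mul_conj]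
    have h3 : (starRingEnd ℂ) d ≠ 0 := by simpa using hd
    push_cast
    rw [← h1, h2]
    field_simp
  · rintro ⟨t, ht⟩
    rw [ht, map_smul toComplex, map_sub toComplex q p, ← hd', Complex.real_smul]
    have : (starRingEnd ℂ) d * (t * d) = ((t * Complex.normSq d : ℝ) : ℂ) := by
      push_cast
      rw [← Complex.mul_conj]; ring
    rw [this, Complex.ofReal_im]

theorem sideForm_eq_of_mem_segment {p q w z : Plane} (h : p ≠ q) (hw : w ∈ segment ℝ p q)
    (hz : z ∈ segment ℝ p q) : sideForm p q w = sideForm p q z := by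
  rw [segment_eq_image'] at hw hz
  obtain ⟨a, -, rfl⟩ := hw
  obtain ⟨b, -, rfl⟩ := hz
  rw [sideForm_eq_iff h]
  exact ⟨a - b, by module⟩

theorem mem_segment_of_sideForm_eq {p q w : Plane} (h : p ≠ q)
    (hw : sideForm p q w = sideForm p q (midpoint ℝ p q))
    (hd : dist w (midpoint ℝ p q) < dist p q / 2) : w ∈ segment ℝ p q := by
  obtain ⟨t, ht⟩ := (sideForm_eq_iff h _ _).1 hw
  have hpq : 0 < dist p q := dist_pos.2 h
  have ht' : |t| < 1 / 2 := by
    rw [dist_eq_norm, ht, norm_smul, Real.norm_eq_abs, ← dist_eq_norm, dist_comm q p] at hd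
    by_contra hcon
    push Not at hcon
    nlinarith
  rw [abs_lt] at ht'
  rw [segment_eq_image']
  refine ⟨t + 1 / 2, ⟨by linarith, by linarith⟩, ?_⟩
  rw [sub_eq_iff_eq_add] at ht
  rw [ht, midpoint_eq_smul_add]
  norm_num
  module

theorem sideForm_ne_zero {p q : Plane} (h : p ≠ q) : sideForm p q ≠ 0 := by
  intro h0
  have hd : toComplex q - toComplex p ≠ 0 := toComplex_sub_ne_zero h.symm
  have := congrArg (fun L => L (toComplex.symm (Complex.I * (toComplex q - toComplex p)))) h0
  simp only [sideForm_apply, LinearIsometryEquiv.apply_symm_apply,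
    zero_apply] at this
  rw [mul_left_comm, mul_comm _ (toComplex q - toComplex p), Complex.mul_conj] at this
  simp only [Complex.I_mul_im, Complex.ofReal_re, Complex.normSq_eq_zero] at this
  exact hd this

/-- Near `z`, the set `A` is the line `L = L z`. -/
structure IsCrossing (A : Set Plane) (z : Plane) (L : Plane →L[ℝ] ℝ) : Prop where
  mem : z ∈ A
  ne_zero : L ≠ 0
  mem_of_eq : ∀ᶠ w in 𝓝 z, L w = L z → w ∈ A
  eq_of_mem : ∀ᶠ w in 𝓝 z, w ∈ A → L w = L z

theorem isClosed_segment_plane (p q : Plane) : IsClosed (segment ℝ p q) := by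
  rw [segment_eq_image_lineMap]
  exact (isCompact_Icc.image AffineMap.lineMap_continuous).isClosed

theorem IsPolygonalArc.isCompact {A : Set Plane} {x y : Plane} (h : IsPolygonalArc A x y) :
    IsCompact A := by
  obtain ⟨n, p, -, -, -, -, -, -, rfl⟩ := h
  have : {z | ∃ i, i < n ∧ z ∈ segment ℝ (p i) (p (i + 1))} =
      ⋃ i ∈ Set.Iio n, segment ℝ (p i) (p (i + 1)) := by
    ext z; simp
  rw [this]
  refine (Set.finite_Iio n).isCompact_biUnion fun i _ => ?_
  rw [segment_eq_image_lineMap]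
  exact isCompact_Icc.image AffineMap.lineMap_continuous

/-- A square root of the ratio of the views of the two ends of an arc, which is continuous off the
arc and changes its sign across it. -/
theorem IsPolygonalArc.exists_root {A : Set Plane} {x y : Plane} (h : IsPolygonalArc A x y) :
    ∃ (R : Plane → ℂ) (z : Plane) (L : Plane →L[ℝ] ℝ),
      ContinuousOn R Aᶜ ∧ (∀ w ∉ A, R w ^ 2 = viewRatio x y w) ∧
      Tendsto R (Bornology.cobounded Plane) (𝓝 1) ∧ IsCrossing A z L ∧ z ≠ x ∧ z ≠ y ∧
      ∃ l ≠ 0, Tendsto R (𝓝[{w | L z < L w}] z) (𝓝 l) ∧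
        Tendsto R (𝓝[{w | L w < L z}] z) (𝓝 (-l)) := by
  obtain ⟨n, p, hn, rfl, rfl, hne, hcons, hdisj, rfl⟩ := h
  have h01 : p 0 ≠ p 1 := hne 0 hn
  -- The midpoint of the first segment lies on no other segment, so in the product of the segment
  -- roots only the first factor jumps there.
  set z := midpoint ℝ (p 0) (p 1) with hz
  have hzs : z ∈ segment ℝ (p 0) (p 1) := midpoint_mem_segment _ _
  have hzn : ∀ i, 0 < i → i < n → z ∉ segment ℝ (p i) (p (i + 1)) := by
    intro i h0 hi hzi
    rcases Nat.lt_or_ge 1 i with h1 | h1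
    · exact Set.disjoint_left.1 (hdisj 0 i h1 hi) hzs hzi
    · obtain rfl : i = 1 := by omega
      have : z ∈ ({p 1} : Set Plane) := hcons 0 hi ▸ ⟨hzs, hzi⟩
      exact right_ne_midpoint h01 this.symm
  have hR : ∀ w, w ∉ {z | ∃ i, i < n ∧ z ∈ segment ℝ (p i) (p (i + 1))} →
      ∀ i < n, w ∉ segment ℝ (p i) (p (i + 1)) := fun w hw i hi hwi => hw ⟨i, hi, hwi⟩
  have hsplit : ∀ w, ∏ i ∈ Finset.range n, segmentRoot (p i) (p (i + 1)) w =
      segmentRoot (p 0) (p 1) w *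
        ∏ i ∈ Finset.Ico 1 n, segmentRoot (p i) (p (i + 1)) w := by
    intro w
    rw [Finset.range_eq_Ico, Finset.prod_eq_prod_Ico_succ_bot hn]
  have hrest : Tendsto (fun w => ∏ i ∈ Finset.Ico 1 n, segmentRoot (p i) (p (i + 1)) w) (𝓝 z)
      (𝓝 (∏ i ∈ Finset.Ico 1 n, segmentRoot (p i) (p (i + 1)) z)) := by
    refine tendsto_finsetProd _ fun i hi => ?_
    rw [Finset.mem_Ico] at hi
    exact continuousAt_segmentRoot (hzn i (by omega) hi.2)
  refine ⟨fun w => ∏ i ∈ Finset.range n, segmentRoot (p i) (p (i + 1)) w, z, sideForm (p 0) (p 1),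
    ?_, ?_, ?_, ⟨⟨0, hn, hzs⟩, sideForm_ne_zero h01, ?_, ?_⟩, (left_ne_midpoint h01).symm, ?_,
    Complex.I * ∏ i ∈ Finset.Ico 1 n, segmentRoot (p i) (p (i + 1)) z, ?_, ?_, ?_⟩
  · intro w hw
    have : ContinuousAt (fun w => ∏ i ∈ Finset.range n, segmentRoot (p i) (p (i + 1)) w) w :=
      tendsto_finsetProd _ fun i hi =>
        continuousAt_segmentRoot (hR w hw i (Finset.mem_range.1 hi))
    exact this.continuousWithinAt
  · intro w hw
    have hw' := hR w hw
    have hpw : ∀ i ≤ n, toComplex (p i) - toComplex w ≠ 0 := by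
      intro i hi
      apply toComplex_sub_ne_zero
      rintro rfl
      rcases hi.lt_or_eq with hi | rfl
      · exact hw' i hi (left_mem_segment ℝ _ _)
      · refine hw' (i - 1) (by omega) ?_
        rw [show i - 1 + 1 = i by omega]
        exact right_mem_segment ℝ _ _
    rw [← Finset.prod_pow]
    -- The ratios telescope along the arc.
    have : ∀ m ≤ n, ∏ i ∈ Finset.range m, segmentRoot (p i) (p (i + 1)) w ^ 2 =
        viewRatio (p 0) (p m) w := by
      intro m hm
      induction m with
      | zero => simp [viewRatio, div_self (hpw 0 hm)]
      | succ m ih =>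
        rw [Finset.prod_range_succ, ih (by omega), segmentRoot, halfExpLog_sq]
        · have := hpw m (by omega)
          have := hpw 0 (by omega)
          simp only [viewRatio]
          field_simp
        · exact div_ne_zero (hpw _ hm) (hpw _ (by omega))
    exact this n le_rfl
  · have : Tendsto (fun w => ∏ i ∈ Finset.range n, segmentRoot (p i) (p (i + 1)) w)
        (Bornology.cobounded Plane) (𝓝 (∏ i ∈ Finset.range n, 1)) :=
      tendsto_finsetProd _ fun i _ => tendsto_segmentRoot_cobounded _ _
    rwa [Finset.prod_const_one] at this
  · have hpos : 0 < dist (p 0) (p 1) / 2 := by have := dist_pos.2 h01; positivity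
    filter_upwards [Metric.ball_mem_nhds z hpos] with w hw hL
    exact ⟨0, hn, mem_segment_of_sideForm_eq h01 hL hw⟩
  · have : ∀ i ∈ Finset.Ico 1 n, ∀ᶠ w in 𝓝 z, w ∉ segment ℝ (p i) (p (i + 1)) := by
      intro i hi
      rw [Finset.mem_Ico] at hi
      exact (isClosed_segment_plane _ _).isOpen_compl.mem_nhds (hzn i (by omega) hi.2)
    rw [← Filter.eventually_all_finset] at this
    filter_upwards [this] with w hw
    rintro ⟨i, hi, hwi⟩
    rcases Nat.eq_zero_or_pos i with rfl | h0
    · exact sideForm_eq_of_mem_segment h01 hwi hzs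
    · exact absurd hwi (hw i (Finset.mem_Ico.2 ⟨h0, hi⟩))
  · intro hzn'
    by_cases h1 : n = 1
    · subst h1
      exact right_ne_midpoint h01 hzn'.symm
    · refine hzn (n - 1) (by omega) (by omega) ?_
      rw [show n - 1 + 1 = n by omega, hzn']
      exact right_mem_segment ℝ _ _
  · exact mul_ne_zero Complex.I_ne_zero
      (Finset.prod_ne_zero_iff.2 fun i _ => halfExpLog_ne_zero _)
  · simp only [hsplit]
    exact (tendsto_segmentRoot_above h01).mul (hrest.mono_left nhdsWithin_le_nhds)
  · simp only [hsplit, ← neg_mul]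
    exact (tendsto_segmentRoot_below h01).mul (hrest.mono_left nhdsWithin_le_nhds)

namespace IsCrossing

variable {A : Set Plane} {z : Plane} {L : Plane →L[ℝ] ℝ}

theorem exists_direction (h : L ≠ 0) : ∃ v, 0 < L v := by
  obtain ⟨v, hv⟩ : ∃ v, L v ≠ 0 := by
    by_contra hcon
    push Not at hcon
    exact h (by ext v; simp [hcon v])
  rcases hv.lt_or_gt with hv | hv
  · exact ⟨-v, by simpa using hv⟩
  · exact ⟨v, hv⟩

theorem nhdsWithin_above_neBot (h : L ≠ 0) : (𝓝[{w | L z < L w}] z).NeBot := by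
  obtain ⟨v, hv⟩ := exists_direction h
  have ht : Tendsto (fun t : ℝ => z + t • v) (𝓝[>] 0) (𝓝[{w | L z < L w}] z) := by
    refine tendsto_nhdsWithin_iff.2 ⟨?_, ?_⟩
    · have : Continuous fun t : ℝ => z + t • v := by fun_prop
      simpa using (this.tendsto 0).mono_left nhdsWithin_le_nhds
    · filter_upwards [self_mem_nhdsWithin] with t ht
      have : 0 < t * L v := mul_pos ht hv
      simpa using this
  exact ht.neBot

theorem nhdsWithin_below_neBot (h : L ≠ 0) : (𝓝[{w | L w < L z}] z).NeBot := by
  have := nhdsWithin_above_neBot (z := z) (neg_ne_zero.2 h)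
  simpa using this

end IsCrossing

theorem dense_compl_segment (p q : Plane) : Dense (segment ℝ p q)ᶜ := by
  rw [← interior_eq_empty_iff_dense_compl, Set.eq_empty_iff_forall_notMem]
  intro z hz
  rw [mem_interior_iff_mem_nhds] at hz
  by_cases hpq : p = q
  · subst hpq
    rw [segment_same] at hz
    have h1 : Tendsto (fun t : ℝ => z + t • (EuclideanSpace.single 0 1 : Plane)) (𝓝[>] 0) (𝓝 z) := by
      have : Continuous fun t : ℝ => z + t • (EuclideanSpace.single 0 1 : Plane) := by fun_prop
      simpa using (this.tendsto 0).mono_left nhdsWithin_le_nhds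
    obtain ⟨t, ht, ht0⟩ := ((h1.eventually hz).and self_mem_nhdsWithin).exists
    have hzp : z = p := Set.mem_singleton_iff.1 (mem_of_mem_nhds hz)
    have : t • (EuclideanSpace.single 0 1 : Plane) = 0 := by
      have ht' : z + t • (EuclideanSpace.single 0 1 : Plane) = p := ht
      rw [hzp] at ht'
      simpa using ht'
    have := congrArg (fun v : Plane => v 0) this
    simp at this
    exact (ne_of_gt ht0) this
  · have := IsCrossing.nhdsWithin_above_neBot (z := z) (sideForm_ne_zero hpq)
    have hz' : ∀ᶠ w in 𝓝[{w | sideForm p q z < sideForm p q w}] z, w ∈ segment ℝ p q :=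
      nhdsWithin_le_nhds hz
    obtain ⟨w, hw, hw'⟩ := (hz'.and self_mem_nhdsWithin).exists
    exact (ne_of_gt hw') (sideForm_eq_of_mem_segment hpq hw (mem_of_mem_nhds hz))

theorem IsPolygonalArc.dense_compl {A : Set Plane} {x y : Plane} (h : IsPolygonalArc A x y) :
    Dense Aᶜ := by
  obtain ⟨n, p, -, -, -, -, -, -, rfl⟩ := h
  have : {z | ∃ i, i < n ∧ z ∈ segment ℝ (p i) (p (i + 1))}ᶜ =
      ⋂ i ∈ Set.Iio n, (segment ℝ (p i) (p (i + 1)))ᶜ := by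
    ext z; simp
  rw [this]
  exact dense_biInter_of_isOpen (fun i _ => (isClosed_segment_plane _ _).isOpen_compl)
    (Set.to_countable _) fun i _ => dense_compl_segment _ _

/-! ### The sign of a closed walk. -/

namespace PlaneGraph

variable {V : Type*} (G : PlaneGraph V)

/-- For every edge a point at which its arc is locally a line, and for every dart a function whose
square is the ratio of the views of its ends and which changes its sign across the arc. -/
structure RootSystem where
  root : V → V → Plane → ℂ
  pt : Sym2 V → Plane
  form : Sym2 V → Plane →L[ℝ] ℝ
  continuousOn : ∀ a b, G.graph.Adj a b → ContinuousOn (root a b) (G.arc s(a, b))ᶜ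
  sq_eq : ∀ a b, G.graph.Adj a b → ∀ w ∉ G.arc s(a, b),
    root a b w ^ 2 = viewRatio (G.pos a) (G.pos b) w
  tendsto_one : ∀ a b, G.graph.Adj a b → Tendsto (root a b) (Bornology.cobounded Plane) (𝓝 1)
  crossing : ∀ e ∈ G.graph.edgeSet, IsCrossing (G.arc e) (pt e) (form e)
  pt_ne : ∀ e ∈ G.graph.edgeSet, ∀ w, pt e ≠ G.pos w
  jump : ∀ a b, G.graph.Adj a b → ∃ l ≠ 0,
    Tendsto (root a b) (𝓝[{w | form s(a, b) (pt s(a, b)) < form s(a, b) w}] (pt s(a, b))) (𝓝 l) ∧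
    Tendsto (root a b) (𝓝[{w | form s(a, b) w < form s(a, b) (pt s(a, b))}] (pt s(a, b))) (𝓝 (-l))

theorem viewRatio_inv (p q w : Plane) : (viewRatio p q w)⁻¹ = viewRatio q p w := inv_div _ _

/-- `exists_root` is applied once per unordered edge, in some direction. For the reverse direction
the inverse is taken: its square is the inverse ratio, and it still changes sign across the arc. -/
theorem nonempty_rootSystem : Nonempty G.RootSystem := by
  classical
  have h : ∀ e, e ∈ G.graph.edgeSet → ∃ (R : Plane → ℂ) (z : Plane) (L : Plane →L[ℝ] ℝ),
      ∃ u v, e = s(u, v) ∧ ContinuousOn R (G.arc e)ᶜ ∧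
      (∀ w ∉ G.arc e, R w ^ 2 = viewRatio (G.pos u) (G.pos v) w) ∧
      Tendsto R (Bornology.cobounded Plane) (𝓝 1) ∧ IsCrossing (G.arc e) z L ∧
      z ≠ G.pos u ∧ z ≠ G.pos v ∧
      ∃ l ≠ 0, Tendsto R (𝓝[{w | L z < L w}] z) (𝓝 l) ∧
        Tendsto R (𝓝[{w | L w < L z}] z) (𝓝 (-l)) := by
    intro e he
    induction e using Sym2.ind with | _ u v
    obtain ⟨R, z, L, h⟩ := (G.arc_isArc u v he).exists_root
    exact ⟨R, z, L, u, v, rfl, h⟩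
  choose! R z L hR using h
  let good : V → V → Prop := fun a b =>
    ∀ w ∉ G.arc s(a, b), R s(a, b) w ^ 2 = viewRatio (G.pos a) (G.pos b) w
  have hne : ∀ a b, G.graph.Adj a b → ∀ w ∉ G.arc s(a, b),
      viewRatio (G.pos a) (G.pos b) w ≠ 0 := by
    intro a b hab w hw
    refine div_ne_zero (toComplex_sub_ne_zero ?_) (toComplex_sub_ne_zero ?_)
    · rintro rfl; exact hw (G.arc_isArc a b hab).right_mem
    · rintro rfl; exact hw (G.arc_isArc a b hab).left_mem
  have hgood : ∀ a b, G.graph.Adj a b → ¬ good a b → ∀ w ∉ G.arc s(a, b),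
      R s(a, b) w ^ 2 = viewRatio (G.pos b) (G.pos a) w := by
    intro a b hab hg
    obtain ⟨u, v, he, -, hsq, -⟩ := hR s(a, b) hab
    rcases Sym2.eq_iff.1 he with ⟨rfl, rfl⟩ | ⟨rfl, rfl⟩
    · exact absurd hsq hg
    · exact hsq
  refine ⟨⟨fun a b w => if good a b then R s(a, b) w else (R s(a, b) w)⁻¹, z, L, ?_, ?_, ?_, ?_,
    ?_, ?_⟩⟩
  · intro a b hab
    obtain ⟨u, v, -, hc, -⟩ := hR s(a, b) hab
    by_cases hg : good a b
    · simpa only [if_pos hg] using hc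
    · simp only [if_neg hg]
      refine hc.inv₀ fun w hw h0 => hne b a hab.symm w ?_ ?_
      · rwa [Sym2.eq_swap]
      · rw [← hgood a b hab hg w hw, h0]; simp
  · intro a b hab w hw
    by_cases hg : good a b
    · simpa only [if_pos hg] using hg w hw
    · simp only [if_neg hg]
      rw [inv_pow, hgood a b hab hg w hw, viewRatio_inv]
  · intro a b hab
    obtain ⟨u, v, -, -, -, ht, -⟩ := hR s(a, b) hab
    by_cases hg : good a b
    · simpa only [if_pos hg] using ht
    · simp only [if_neg hg]
      simpa using ht.inv₀ one_ne_zero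
  · intro e he
    obtain ⟨u, v, -, -, -, -, h, -⟩ := hR e he
    exact h
  · intro e he w hw
    obtain ⟨u, v, he', -, -, -, h, hu, hv, -⟩ := hR e he
    have := G.vertex_of_mem_arc e he w (hw ▸ h.mem)
    rw [he'] at this
    rcases Sym2.mem_iff.1 this with rfl | rfl
    exacts [hu hw, hv hw]
  · intro a b hab
    obtain ⟨u, v, -, -, -, -, -, -, -, l, hl, h1, h2⟩ := hR s(a, b) hab
    by_cases hg : good a b
    · simp only [if_pos hg]
      exact ⟨l, hl, h1, h2⟩
    · simp only [if_neg hg]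
      refine ⟨l⁻¹, inv_ne_zero hl, h1.inv₀ hl, ?_⟩
      have := h2.inv₀ (neg_ne_zero.2 hl)
      rwa [inv_neg] at this

variable {G}

/-- The point set of the closed walk with consecutive vertices `c 0, c 1, …`. -/
def polygon (G : PlaneGraph V) {ℓ : ℕ} [NeZero ℓ] (c : Fin ℓ → V) : Set Plane :=
  ⋃ i, G.arc s(c i, c (i + 1))

namespace RootSystem

variable (ρ : G.RootSystem) {ℓ : ℕ} [NeZero ℓ] (c : Fin ℓ → V)

/-- The sign that tells the points inside a closed walk (sign `-1`) from those outside. -/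
noncomputable def sign (w : Plane) : ℂ := ∏ i, ρ.root (c i) (c (i + 1)) w

variable {ρ c}

theorem isClosed_polygon (hc : ∀ i, G.graph.Adj (c i) (c (i + 1))) : IsClosed (G.polygon c) :=
  isClosed_iUnion_of_finite fun i => (G.arc_isArc _ _ (hc i)).isCompact.isClosed

/-- The squares are ratios of the views of consecutive vertices, and around a closed walk numerators
and denominators are the same up to a shift. -/
theorem sign_sq (hc : ∀ i, G.graph.Adj (c i) (c (i + 1)))
    {w : Plane} (hw : w ∉ G.polygon c) : ρ.sign c w ^ 2 = 1 := by
  have hw' : ∀ i, w ∉ G.arc s(c i, c (i + 1)) := fun i h => hw (Set.mem_iUnion.2 ⟨i, h⟩)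
  have hne : ∀ i, toComplex (G.pos (c i)) - toComplex w ≠ 0 := fun i =>
    toComplex_sub_ne_zero fun e => hw' i (e ▸ (G.arc_isArc _ _ (hc i)).left_mem)
  rw [sign, ← Finset.prod_pow, Finset.prod_congr rfl fun i _ => ρ.sq_eq _ _ (hc i) w (hw' i)]
  simp only [viewRatio]
  rw [Finset.prod_div_distrib,
    show ∏ i, (toComplex (G.pos (c (i + 1))) - toComplex w) =
        ∏ i, (toComplex (G.pos (c i)) - toComplex w) from
      Equiv.prod_comp (Equiv.addRight (1 : Fin ℓ)) fun i => toComplex (G.pos (c i)) - toComplex w]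
  exact div_self (Finset.prod_ne_zero_iff.2 fun i _ => hne i)

theorem continuousAt_sign (hc : ∀ i, G.graph.Adj (c i) (c (i + 1)))
    {w : Plane} (hw : w ∉ G.polygon c) : ContinuousAt (ρ.sign c) w := by
  refine tendsto_finsetProd _ fun i _ => ?_
  refine (ρ.continuousOn _ _ (hc i)).continuousAt
    ((G.arc_isArc _ _ (hc i)).isCompact.isClosed.isOpen_compl.mem_nhds fun h => ?_)
  exact hw (Set.mem_iUnion.2 ⟨i, h⟩)

theorem tendsto_sign (hc : ∀ i, G.graph.Adj (c i) (c (i + 1))) :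
    Tendsto (ρ.sign c) (Bornology.cobounded Plane) (𝓝 1) := by
  have : Tendsto (ρ.sign c) (Bornology.cobounded Plane) (𝓝 (∏ _i : Fin ℓ, 1)) :=
    tendsto_finsetProd _ fun i _ => ρ.tendsto_one _ _ (hc i)
  rwa [Finset.prod_const_one] at this

theorem sign_eq_one_or (hc : ∀ i, G.graph.Adj (c i) (c (i + 1)))
    {w : Plane} (hw : w ∉ G.polygon c) :
    ρ.sign c w = 1 ∨ ρ.sign c w = -1 := sq_eq_one_iff.1 (sign_sq hc hw)

/-- Off the polygon the sign is continuous and its square is 1. -/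
theorem sign_eq_of_isPreconnected (hc : ∀ i, G.graph.Adj (c i) (c (i + 1)))
    {S : Set Plane} (hS : IsPreconnected S)
    (hd : ∀ w ∈ S, w ∉ G.polygon c) {x y : Plane} (hx : x ∈ S) (hy : y ∈ S) :
    ρ.sign c x = ρ.sign c y := by
  have h := hS.eq_or_eq_neg_of_sq_eq (f := ρ.sign c) (g := fun _ => (1 : ℂ))
    (fun w hw => (continuousAt_sign hc (hd w hw)).continuousWithinAt) continuousOn_const
    (fun w hw => by simp [sign_sq hc (hd w hw)]) (fun _ => one_ne_zero)
  rcases h with h | h <;> rw [h hx, h hy]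
  rfl

theorem eventually_sign_eq (hc : ∀ i, G.graph.Adj (c i) (c (i + 1)))
    {w : Plane} (hw : w ∉ G.polygon c) :
    ∀ᶠ x in 𝓝 w, ρ.sign c x = ρ.sign c w := by
  obtain ⟨r, hr, hball⟩ := Metric.isOpen_iff.1 (isClosed_polygon hc).isOpen_compl w hw
  filter_upwards [Metric.ball_mem_nhds w hr] with x hx
  exact sign_eq_of_isPreconnected hc (convex_ball w r).isPreconnected (fun y hy => hball hy) hx
    (Metric.mem_ball_self hr)

end RootSystem

end PlaneGraph

/-! ### Faces, and the two sides of an edge. -/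

namespace PlaneGraph

variable {V : Type*} {G : PlaneGraph V}

theorem isClosed_pointSet [Finite V] : IsClosed G.pointSet := by
  have : {x | ∃ e ∈ G.graph.edgeSet, x ∈ G.arc e} = ⋃ e ∈ G.graph.edgeSet, G.arc e := by
    ext; simp
  rw [pointSet, this]
  refine (Set.finite_range _).isClosed.union ((Set.toFinite _).isClosed_biUnion fun e he => ?_)
  induction e using Sym2.ind with | _ u v
  exact (G.arc_isArc u v he).isCompact.isClosed

theorem isBounded_pointSet [Finite V] : Bornology.IsBounded G.pointSet := by
  have : {x | ∃ e ∈ G.graph.edgeSet, x ∈ G.arc e} = ⋃ e ∈ G.graph.edgeSet, G.arc e := by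
    ext; simp
  rw [pointSet, this]
  refine (Set.finite_range _).isBounded.union
    ((Bornology.isBounded_biUnion (Set.toFinite _)).2 fun e he => ?_)
  induction e using Sym2.ind with | _ u v
  exact (G.arc_isArc u v he).isCompact.isBounded

theorem dense_compl_pointSet [Finite V] : Dense G.pointSetᶜ := by
  have : G.pointSetᶜ = (Set.range G.pos)ᶜ ∩ ⋂ e ∈ G.graph.edgeSet, (G.arc e)ᶜ := by
    ext; simp [pointSet]
  rw [this]
  refine Dense.inter_of_isOpen_left ?_ ?_ (Set.finite_range _).isClosed.isOpen_compl
  · exact (Set.finite_range G.pos).countable.dense_compl ℝ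
  · refine dense_biInter_of_isOpen (fun e he => ?_) (Set.to_countable _) fun e he => ?_ <;>
      induction e using Sym2.ind with | _ u v
    · exact (G.arc_isArc u v he).isCompact.isClosed.isOpen_compl
    · exact (G.arc_isArc u v he).dense_compl

theorem arc_subset_pointSet {e : Sym2 V} (he : e ∈ G.graph.edgeSet) : G.arc e ⊆ G.pointSet :=
  fun _ hx => .inr ⟨e, he, hx⟩

theorem edge_eq_of_mem {e e' : Sym2 V} (he : e ∈ G.graph.edgeSet) (he' : e' ∈ G.graph.edgeSet)
    {x : Plane} (hx : x ∈ G.arc e) (hx' : x ∈ G.arc e') (hv : ∀ w, x ≠ G.pos w) : e = e' := by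
  by_contra hne
  obtain ⟨w, -, hw⟩ := G.endpoint_of_mem_arcs e he e' he' hne x hx hx'
  exact hv w hw

theorem polygon_subset_pointSet {ℓ : ℕ} [NeZero ℓ] {c : Fin ℓ → V}
    (hc : ∀ i, G.graph.Adj (c i) (c (i + 1))) : G.polygon c ⊆ G.pointSet :=
  Set.iUnion_subset fun i => arc_subset_pointSet (hc i)

theorem mem_range_of_pos_mem_polygon {ℓ : ℕ} [NeZero ℓ] {c : Fin ℓ → V}
    (hc : ∀ i, G.graph.Adj (c i) (c (i + 1))) {w : V} (hw : G.pos w ∈ G.polygon c) :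
    w ∈ Set.range c := by
  obtain ⟨i, hi⟩ := Set.mem_iUnion.1 hw
  rcases Sym2.mem_iff.1 (G.vertex_of_mem_arc _ (hc i) w hi) with rfl | rfl
  exacts [⟨_, rfl⟩, ⟨_, rfl⟩]

/-! ### Faces -/

theorem IsFace.isOpen [Finite V] {F : Set Plane} (h : G.IsFace F) : IsOpen F := by
  obtain ⟨x, -, rfl⟩ := h
  exact isClosed_pointSet.isOpen_compl.connectedComponentIn

theorem IsFace.isPreconnected {F : Set Plane} (h : G.IsFace F) : IsPreconnected F := by
  obtain ⟨x, -, rfl⟩ := h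
  exact isPreconnected_connectedComponentIn

theorem IsFace.subset {F : Set Plane} (h : G.IsFace F) : F ⊆ G.pointSetᶜ := by
  obtain ⟨x, -, rfl⟩ := h
  exact connectedComponentIn_subset _ _

theorem IsFace.nonempty {F : Set Plane} (h : G.IsFace F) : F.Nonempty := by
  obtain ⟨x, hx, rfl⟩ := h
  exact ⟨x, mem_connectedComponentIn hx⟩

theorem IsFace.eq_connectedComponentIn {F : Set Plane} (h : G.IsFace F) {x : Plane} (hx : x ∈ F) :
    F = connectedComponentIn G.pointSetᶜ x := by
  obtain ⟨y, -, rfl⟩ := h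
  exact connectedComponentIn_eq hx

theorem IsFace.eq_of_mem {F F' : Set Plane} (h : G.IsFace F) (h' : G.IsFace F') {x : Plane}
    (hx : x ∈ F) (hx' : x ∈ F') : F = F' := by
  rw [h.eq_connectedComponentIn hx, h'.eq_connectedComponentIn hx']

theorem IsFace.subset_of_isPreconnected {F S : Set Plane} (h : G.IsFace F) (hS : IsPreconnected S)
    (hSP : S ⊆ G.pointSetᶜ) {x : Plane} (hx : x ∈ S) (hxF : x ∈ F) : S ⊆ F := by
  rw [h.eq_connectedComponentIn hxF]
  exact hS.subset_connectedComponentIn hx hSP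

theorem exists_isFace_mem {x : Plane} (hx : x ∉ G.pointSet) : ∃ F, G.IsFace F ∧ x ∈ F :=
  ⟨_, ⟨x, hx, rfl⟩, mem_connectedComponentIn hx⟩

theorem IsFace.frontier_eq [Finite V] {F : Set Plane} (h : G.IsFace F) :
    frontier F = closure F \ F := h.isOpen.frontier_eq

theorem IsFace.mem_frontier [Finite V] {F : Set Plane} (h : G.IsFace F) {x : Plane}
    (hx : x ∈ closure F) (hxP : x ∈ G.pointSet) : x ∈ frontier F := by
  rw [h.frontier_eq]
  exact ⟨hx, fun hF => h.subset hF hxP⟩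

/-- The complement of a disc is connected. -/
theorem isPreconnected_norm_gt {R : ℝ} (hR : 0 ≤ R) : IsPreconnected {x : Plane | R < ‖x‖} := by
  -- Polar coordinates: the set is a continuous image of a product of two connected sets of reals.
  have : {x : Plane | R < ‖x‖} = (fun q : ℝ × ℝ =>
      toComplex.symm (q.1 * Complex.exp (q.2 * Complex.I))) '' (Set.Ioi R ×ˢ Set.univ) := by
    ext x
    constructor
    · intro hx
      refine ⟨(‖toComplex x‖, (toComplex x).arg), ⟨?_, trivial⟩, ?_⟩
      · simpa using hx
      · change toComplex.symm (‖toComplex x‖ * Complex.exp ((toComplex x).arg * Complex.I)) = x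
        rw [Complex.norm_mul_exp_arg_mul_I, LinearIsometryEquiv.symm_apply_apply]
    · rintro ⟨⟨r, t⟩, ⟨hr, -⟩, rfl⟩
      have hr : R < r := hr
      simp [abs_of_pos (hR.trans_lt hr), hr]
  rw [this]
  exact (isPreconnected_Ioi.prod isPreconnected_univ).image _
    (Continuous.continuousOn (by fun_prop))

namespace RootSystem

variable (ρ : G.RootSystem)

/-- On either side of an edge there is a face. -/
theorem exists_sides [Finite V] {e : Sym2 V} (he : e ∈ G.graph.edgeSet) :
    ∃ F F', G.IsFace F ∧ G.IsFace F' ∧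
      (∀ᶠ w in 𝓝[{w | ρ.form e (ρ.pt e) < ρ.form e w}] (ρ.pt e), w ∈ F) ∧
      (∀ᶠ w in 𝓝[{w | ρ.form e w < ρ.form e (ρ.pt e)}] (ρ.pt e), w ∈ F') ∧
      ∀ᶠ w in 𝓝 (ρ.pt e), w ∉ G.pointSet → w ∈ F ∨ w ∈ F' := by
  set z := ρ.pt e with hz
  set L := ρ.form e with hL
  have hcr : IsCrossing (G.arc e) z L := ρ.crossing e he
  have h1 : ∀ᶠ w in 𝓝 z, w ∉ Set.range G.pos :=
    (Set.finite_range G.pos).isClosed.isOpen_compl.mem_nhds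
      (by rintro ⟨w, hw⟩; exact ρ.pt_ne e he w hw.symm)
  have h2 : ∀ᶠ w in 𝓝 z, ∀ e' ∈ {e' | e' ∈ G.graph.edgeSet ∧ e' ≠ e}, w ∉ G.arc e' := by
    rw [Set.Finite.eventually_all (Set.toFinite _)]
    rintro e' ⟨he', hne⟩
    have hcl : IsClosed (G.arc e') := by
      induction e' using Sym2.ind with | _ u v
      exact (G.arc_isArc u v he').isCompact.isClosed
    exact hcl.isOpen_compl.mem_nhds fun h =>
      hne (edge_eq_of_mem he' he h hcr.mem (ρ.pt_ne e he))
  -- Near `z` the whole drawing is a line, so both half balls miss it and each lies in a single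
  -- face.
  have h3 : ∀ᶠ w in 𝓝 z, (w ∈ G.pointSet ↔ L w = L z) := by
    filter_upwards [h1, h2, hcr.mem_of_eq, hcr.eq_of_mem] with w a1 a2 a3 a4
    constructor
    · rintro (h | ⟨e', he', h⟩)
      · exact absurd h a1
      · by_cases hne : e' = e
        · exact a4 (hne ▸ h)
        · exact absurd h (a2 e' ⟨he', hne⟩)
    · exact fun h => arc_subset_pointSet he (a3 h)
  obtain ⟨r, hr, hball⟩ := Metric.eventually_nhds_iff_ball.1 h3
  have hlin : IsLinearMap ℝ L := ⟨map_add L, map_smul L⟩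
  have hup : Convex ℝ (Metric.ball z r ∩ {w | L z < L w}) :=
    (convex_ball z r).inter (convex_halfSpace_gt hlin _)
  have hdown : Convex ℝ (Metric.ball z r ∩ {w | L w < L z}) :=
    (convex_ball z r).inter (convex_halfSpace_lt hlin _)
  have hupP : Metric.ball z r ∩ {w | L z < L w} ⊆ G.pointSetᶜ := fun w hw hP =>
    (ne_of_gt hw.2) ((hball w hw.1).1 hP)
  have hdownP : Metric.ball z r ∩ {w | L w < L z} ⊆ G.pointSetᶜ := fun w hw hP =>
    (ne_of_lt hw.2) ((hball w hw.1).1 hP)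
  have hupE : ∀ᶠ w in 𝓝[{w | L z < L w}] z, w ∈ Metric.ball z r ∩ {w | L z < L w} := by
    rw [Set.inter_comm]
    exact inter_mem_nhdsWithin _ (Metric.ball_mem_nhds z hr)
  have hdownE : ∀ᶠ w in 𝓝[{w | L w < L z}] z, w ∈ Metric.ball z r ∩ {w | L w < L z} := by
    rw [Set.inter_comm]
    exact inter_mem_nhdsWithin _ (Metric.ball_mem_nhds z hr)
  have := IsCrossing.nhdsWithin_above_neBot (z := z) hcr.ne_zero
  have := IsCrossing.nhdsWithin_below_neBot (z := z) hcr.ne_zero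
  obtain ⟨a, ha⟩ := hupE.exists
  obtain ⟨b, hb⟩ := hdownE.exists
  obtain ⟨F, hF, haF⟩ := exists_isFace_mem (hupP ha)
  obtain ⟨F', hF', hbF'⟩ := exists_isFace_mem (hdownP hb)
  have s1 := hF.subset_of_isPreconnected hup.isPreconnected hupP ha haF
  have s2 := hF'.subset_of_isPreconnected hdown.isPreconnected hdownP hb hbF'
  refine ⟨F, F', hF, hF', hupE.mono fun w hw => s1 hw, hdownE.mono fun w hw => s2 hw, ?_⟩
  filter_upwards [Metric.ball_mem_nhds z hr] with w hw hwP
  rcases lt_trichotomy (L w) (L z) with h | h | h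
  · exact .inr (s2 ⟨hw, h⟩)
  · exact absurd ((hball w hw).2 h) hwP
  · exact .inl (s1 ⟨hw, h⟩)

/-- The sign of a closed walk changes across an edge according to the number of times that the
walk uses it. -/
theorem exists_sign_jump {ℓ : ℕ} [NeZero ℓ] {c : Fin ℓ → V}
    (hc : ∀ i, G.graph.Adj (c i) (c (i + 1))) {e : Sym2 V} (he : e ∈ G.graph.edgeSet) :
    ∃ l, Tendsto (ρ.sign c) (𝓝[{w | ρ.form e (ρ.pt e) < ρ.form e w}] (ρ.pt e)) (𝓝 l) ∧
      Tendsto (ρ.sign c) (𝓝[{w | ρ.form e w < ρ.form e (ρ.pt e)}] (ρ.pt e))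
        (𝓝 ((-1) ^ {i | s(c i, c (i + 1)) = e}.ncard * l)) := by
  classical
  have h : ∀ i, ∃ l, Tendsto (ρ.root (c i) (c (i + 1)))
        (𝓝[{w | ρ.form e (ρ.pt e) < ρ.form e w}] (ρ.pt e)) (𝓝 l) ∧
      Tendsto (ρ.root (c i) (c (i + 1))) (𝓝[{w | ρ.form e w < ρ.form e (ρ.pt e)}] (ρ.pt e))
        (𝓝 ((if s(c i, c (i + 1)) = e then -1 else 1) * l)) := by
    intro i
    by_cases hi : s(c i, c (i + 1)) = e
    · obtain ⟨l, -, h1, h2⟩ := ρ.jump _ _ (hc i)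
      rw [hi] at h1 h2
      exact ⟨l, h1, by simpa [hi] using h2⟩
    · have hcont : ContinuousAt (ρ.root (c i) (c (i + 1))) (ρ.pt e) := by
        refine (ρ.continuousOn _ _ (hc i)).continuousAt
          ((G.arc_isArc _ _ (hc i)).isCompact.isClosed.isOpen_compl.mem_nhds fun h => ?_)
        exact hi (edge_eq_of_mem (hc i) he h (ρ.crossing e he).mem (ρ.pt_ne e he))
      refine ⟨ρ.root (c i) (c (i + 1)) (ρ.pt e), hcont.tendsto.mono_left nhdsWithin_le_nhds, ?_⟩
      rw [if_neg hi, one_mul]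
      exact hcont.tendsto.mono_left nhdsWithin_le_nhds
  choose l hl1 hl2 using h
  refine ⟨∏ i, l i, tendsto_finsetProd _ fun i _ => hl1 i, ?_⟩
  have := tendsto_finsetProd (Finset.univ : Finset (Fin ℓ)) fun i _ => hl2 i
  rw [Finset.prod_mul_distrib, Finset.prod_ite, Finset.prod_const, Finset.prod_const_one,
    mul_one] at this
  have hcard : {i | s(c i, c (i + 1)) = e}.ncard =
      (Finset.univ.filter fun i => s(c i, c (i + 1)) = e).card := by
    rw [Set.ncard_eq_toFinset_card']
    congr 1
    ext i; simp
  rwa [hcard]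

variable {ρ} {ℓ : ℕ} [NeZero ℓ] {c : Fin ℓ → V}

theorem sign_eq_of_mem_face (hc : ∀ i, G.graph.Adj (c i) (c (i + 1))) {F : Set Plane}
    (hF : G.IsFace F) {x y : Plane} (hx : x ∈ F) (hy : y ∈ F) : ρ.sign c x = ρ.sign c y :=
  sign_eq_of_isPreconnected hc hF.isPreconnected
    (fun _ hw hP => hF.subset hw (polygon_subset_pointSet hc hP)) hx hy

theorem sign_eq_of_mem_closure_face (hc : ∀ i, G.graph.Adj (c i) (c (i + 1))) {F : Set Plane}
    (hF : G.IsFace F) {x y : Plane} (hx : x ∈ F) (hy : y ∈ closure F) (hyc : y ∉ G.polygon c) :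
    ρ.sign c x = ρ.sign c y := by
  obtain ⟨w, hw, hwF⟩ := ((mem_closure_iff_frequently.1 hy).and_eventually
    (eventually_sign_eq (ρ := ρ) hc hyc)).exists
  rw [← hwF]
  exact sign_eq_of_mem_face hc hF hx hw

/-- Two faces on either side of an edge have the same sign if and only if the walk uses the edge
an even number of times. -/
theorem sign_sides (hc : ∀ i, G.graph.Adj (c i) (c (i + 1))) {e : Sym2 V}
    (he : e ∈ G.graph.edgeSet) {F F' : Set Plane} (hF : G.IsFace F) (hF' : G.IsFace F')
    (h1 : ∀ᶠ w in 𝓝[{w | ρ.form e (ρ.pt e) < ρ.form e w}] (ρ.pt e), w ∈ F)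
    (h2 : ∀ᶠ w in 𝓝[{w | ρ.form e w < ρ.form e (ρ.pt e)}] (ρ.pt e), w ∈ F')
    {x y : Plane} (hx : x ∈ F) (hy : y ∈ F') :
    ρ.sign c y = (-1) ^ {i | s(c i, c (i + 1)) = e}.ncard * ρ.sign c x := by
  have := IsCrossing.nhdsWithin_above_neBot (z := ρ.pt e) (ρ.crossing e he).ne_zero
  have := IsCrossing.nhdsWithin_below_neBot (z := ρ.pt e) (ρ.crossing e he).ne_zero
  obtain ⟨l, hl1, hl2⟩ := ρ.exists_sign_jump hc he
  have e1 : l = ρ.sign c x := tendsto_nhds_unique hl1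
    (tendsto_const_nhds.congr' (h1.mono fun w hw => sign_eq_of_mem_face hc hF hx hw))
  have e2 := tendsto_nhds_unique hl2
    (tendsto_const_nhds.congr' (h2.mono fun w hw => sign_eq_of_mem_face hc hF' hy hw))
  rw [← e2, e1]

end RootSystem

end PlaneGraph

/-- The vertices of a cycle as a cyclic sequence. -/
theorem SimpleGraph.Walk.IsCycle.exists_cyclic {V : Type*} {G : SimpleGraph V} {a : V}
    {p : G.Walk a a} (hp : p.IsCycle) {n : ℕ} [NeZero n] (hn : p.length = n) :
    ∃ v : Fin n → V, Function.Injective v ∧ (∀ i, G.Adj (v i) (v (i + 1))) ∧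
      (∀ i : Fin n, v i = p.getVert i) ∧ (∀ e, e ∈ p.edges ↔ e ∈ cyclicEdges v) ∧
      ∀ x, x ∈ p.support ↔ x ∈ Set.range v := by
  subst hn
  have hpos : 0 < p.length := Nat.pos_of_ne_zero (NeZero.ne _)
  -- Addition in `Fin` wraps around, which agrees with the walk because its last vertex is its
  -- first.
  have hsucc : ∀ i : Fin p.length, p.getVert (i + 1 : Fin p.length) = p.getVert (i + 1 : ℕ) := by
    intro i
    rw [Fin.val_add]
    by_cases h : (i : ℕ) + 1 = p.length
    · have h1 : ((i : ℕ) + (1 : Fin p.length).val) % p.length = 0 := by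
        rw [Fin.val_one', Nat.add_mod_mod, h, Nat.mod_self]
      rw [h1, h]; simp
    · have h1 : ((i : ℕ) + (1 : Fin p.length).val) % p.length = i + 1 := by
        rw [Fin.val_one', Nat.add_mod_mod, Nat.mod_eq_of_lt (by omega)]
      rw [h1]
  refine ⟨fun i => p.getVert i, ?_, ?_, fun _ => rfl, ?_, ?_⟩
  · intro i j hij
    have := hp.getVert_injOn' (by simp; omega : (i : ℕ) ∈ {i | i ≤ p.length - 1})
      (by simp; omega : (j : ℕ) ∈ {i | i ≤ p.length - 1}) hij
    exact Fin.ext this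
  · intro i
    simp only [hsucc]
    exact p.adj_getVert_succ i.2
  · intro e
    simp only [cyclicEdges, Set.mem_ofPred_eq, hsucc]
    rw [← SimpleGraph.Walk.mem_edges_toSubgraph]
    induction e using Sym2.ind with | _ x y
    rw [SimpleGraph.Subgraph.mem_edgeSet, SimpleGraph.Walk.toSubgraph_adj_iff]
    constructor
    · rintro ⟨i, h, hi⟩
      exact ⟨⟨i, hi⟩, h.symm⟩
    · rintro ⟨i, h⟩
      exact ⟨i, h.symm, i.2⟩
  · intro x
    rw [SimpleGraph.Walk.mem_support_iff_exists_getVert]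
    constructor
    · rintro ⟨m, rfl, hm⟩
      rcases hm.lt_or_eq with h | h
      · exact ⟨⟨m, h⟩, rfl⟩
      · exact ⟨⟨0, hpos⟩, by simp [h]⟩
    · rintro ⟨i, rfl⟩
      exact ⟨i, rfl, i.2.le⟩

/-! ### The face system of a pentagulation. -/

namespace PlaneGraph

variable {V : Type*} {G : PlaneGraph V}

theorem walkSet_eq_polygon {a b : V} {p : G.graph.Walk a b} {n : ℕ} [NeZero n] {v : Fin n → V}
    (h : ∀ e, e ∈ p.edges ↔ e ∈ cyclicEdges v) : G.walkSet p = G.polygon v := by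
  ext x
  simp only [walkSet, polygon, Set.mem_ofPred_eq, Set.mem_iUnion, h]
  constructor
  · rintro ⟨_, ⟨i, rfl⟩, hx⟩
    exact ⟨i, hx⟩
  · rintro ⟨i, hx⟩
    exact ⟨_, ⟨i, rfl⟩, hx⟩

theorem IsPentagulation.exists_frontier_eq (hG : G.IsPentagulation) {F : Set Plane}
    (hF : G.IsFace F) : ∃ v : Fin 5 → V, Function.Injective v ∧
      (∀ i, G.graph.Adj (v i) (v (i + 1))) ∧ frontier F = G.polygon v := by
  obtain ⟨a, p, hp, hp5, hfr⟩ := hG F hF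
  obtain ⟨v, hv, hadj, -, hedges, -⟩ := hp.exists_cyclic hp5
  exact ⟨v, hv, hadj, hfr.trans (walkSet_eq_polygon hedges)⟩

/-- The edges on the boundary of a face. -/
def faceEdges (G : PlaneGraph V) (F : Set Plane) : Set (Sym2 V) :=
  {e | e ∈ G.graph.edgeSet ∧ G.arc e ⊆ frontier F}

/-- The frontier is a union of arcs, and different arcs meet only in vertices, so a single point
that is not a vertex brings the whole arc with it. -/
theorem mem_faceEdges_of_mem_frontier (hG : G.IsPentagulation) {F : Set Plane} (hF : G.IsFace F)
    {e : Sym2 V} (he : e ∈ G.graph.edgeSet) {x : Plane} (hx : x ∈ G.arc e)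
    (hv : ∀ w, x ≠ G.pos w) (hxF : x ∈ frontier F) : e ∈ G.faceEdges F := by
  obtain ⟨v, -, hadj, hfr⟩ := hG.exists_frontier_eq hF
  rw [hfr] at hxF
  obtain ⟨i, hi⟩ := Set.mem_iUnion.1 hxF
  obtain rfl := edge_eq_of_mem he (hadj i) hx hi hv
  exact ⟨he, hfr ▸ Set.subset_iUnion (fun i => G.arc s(v i, v (i + 1))) i⟩

theorem faceEdges_eq_cyclicEdges (ρ : G.RootSystem) {F : Set Plane} {n : ℕ} [NeZero n]
    {v : Fin n → V} (hadj : ∀ i, G.graph.Adj (v i) (v (i + 1))) (hfr : frontier F = G.polygon v) :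
    G.faceEdges F = cyclicEdges v := by
  ext e
  constructor
  · rintro ⟨he, h⟩
    have h1 := h (ρ.crossing e he).mem
    rw [hfr] at h1
    obtain ⟨i, hi⟩ := Set.mem_iUnion.1 h1
    exact ⟨i, edge_eq_of_mem he (hadj i) (ρ.crossing e he).mem hi (ρ.pt_ne e he)⟩
  · rintro ⟨i, rfl⟩
    exact ⟨hadj i, hfr ▸ Set.subset_iUnion (fun i => G.arc s(v i, v (i + 1))) i⟩

theorem exists_faceEdges_eq (hG : G.IsPentagulation) {F : Set Plane} (hF : G.IsFace F) :
    ∃ v : Fin 5 → V, Function.Injective v ∧ (∀ i, G.graph.Adj (v i) (v (i + 1))) ∧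
      frontier F = G.polygon v ∧ G.faceEdges F = cyclicEdges v := by
  obtain ⟨ρ⟩ := G.nonempty_rootSystem
  obtain ⟨v, hv, hadj, hfr⟩ := hG.exists_frontier_eq hF
  exact ⟨v, hv, hadj, hfr, faceEdges_eq_cyclicEdges ρ hadj hfr⟩

variable [Finite V]

/-- Every edge bounds exactly the two faces on its sides. -/
theorem exists_two_faces (hG : G.IsPentagulation) (ρ : G.RootSystem) {e : Sym2 V}
    (he : e ∈ G.graph.edgeSet) : ∃ F F', G.IsFace F ∧ G.IsFace F' ∧ F ≠ F' ∧
      (∀ X, G.IsFace X → (e ∈ G.faceEdges X ↔ X = F ∨ X = F')) ∧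
      ∀ {ℓ : ℕ} [NeZero ℓ] (c : Fin ℓ → V), (∀ i, G.graph.Adj (c i) (c (i + 1))) →
        ∀ x ∈ F, ∀ y ∈ F', ρ.sign c y =
          (-1) ^ {i | s(c i, c (i + 1)) = e}.ncard * ρ.sign c x := by
  obtain ⟨F, F', hF, hF', h1, h2, h3⟩ := ρ.exists_sides he
  have hcr := ρ.crossing e he
  have := IsCrossing.nhdsWithin_above_neBot (z := ρ.pt e) hcr.ne_zero
  have := IsCrossing.nhdsWithin_below_neBot (z := ρ.pt e) hcr.ne_zero
  have hP := arc_subset_pointSet he hcr.mem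
  have hcl : ρ.pt e ∈ closure F := mem_closure_iff_frequently.2
    (h1.frequently.filter_mono nhdsWithin_le_nhds)
  have hcl' : ρ.pt e ∈ closure F' := mem_closure_iff_frequently.2
    (h2.frequently.filter_mono nhdsWithin_le_nhds)
  have heF := mem_faceEdges_of_mem_frontier hG hF he hcr.mem (ρ.pt_ne e he) (hF.mem_frontier hcl hP)
  have heF' := mem_faceEdges_of_mem_frontier hG hF' he hcr.mem (ρ.pt_ne e he)
    (hF'.mem_frontier hcl' hP)
  have hsign : ∀ {ℓ : ℕ} [NeZero ℓ] (c : Fin ℓ → V), (∀ i, G.graph.Adj (c i) (c (i + 1))) →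
        ∀ x ∈ F, ∀ y ∈ F', ρ.sign c y =
          (-1) ^ {i | s(c i, c (i + 1)) = e}.ncard * ρ.sign c x :=
    fun c hc x hx y hy => RootSystem.sign_sides hc he hF hF' h1 h2 hx hy
  refine ⟨F, F', hF, hF', ?_, ?_, hsign⟩
  -- If both sides were one face, the sign of its boundary cycle, which uses `e` exactly once, would
  -- be its own negative there.
  · rintro rfl
    obtain ⟨v, hv, hadj, -, hbd⟩ := exists_faceEdges_eq hG hF
    obtain ⟨x, hx⟩ := hF.nonempty
    have hs := hsign v hadj x hx x hx
    rw [hbd] at heF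
    obtain ⟨i, rfl⟩ := heF
    have : {j | s(v j, v (j + 1)) = s(v i, v (i + 1))} = {i} := by
      ext j
      exact ⟨fun h => cyclicEdge_injective (by norm_num) hv h, fun h => by rw [h]; rfl⟩
    rw [this, Set.ncard_singleton, pow_one, neg_one_mul] at hs
    have h0 : ρ.sign v x = 0 := self_eq_neg.1 hs
    have h1 := RootSystem.sign_sq (ρ := ρ) hadj fun h =>
      hF.subset hx (polygon_subset_pointSet hadj h)
    rw [h0] at h1
    norm_num at h1
  · intro X hX
    refine ⟨fun heX => ?_, ?_⟩
    · have hzX : ρ.pt e ∈ closure X := frontier_subset_closure (heX.2 hcr.mem)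
      obtain ⟨w, hw, hw'⟩ := ((mem_closure_iff_frequently.1 hzX).and_eventually h3).exists
      rcases hw' (hX.subset hw) with h | h
      · exact .inl (hX.eq_of_mem hF hw h)
      · exact .inr (hX.eq_of_mem hF' hw h)
    · rintro (rfl | rfl) <;> assumption

/-- Every face has an edge on its boundary, and each of the finitely many edges bounds at most two
faces. -/
theorem finite_faces (hG : G.IsPentagulation) : Finite {F // G.IsFace F} := by
  obtain ⟨ρ⟩ := G.nonempty_rootSystem
  have : {F | G.IsFace F} ⊆ ⋃ e ∈ G.graph.edgeSet, {F | G.IsFace F ∧ e ∈ G.faceEdges F} := by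
    intro F hF
    obtain ⟨v, -, hadj, -, hbd⟩ := exists_faceEdges_eq hG hF
    exact Set.mem_biUnion (hadj 0) ⟨hF, hbd ▸ mem_cyclicEdges_self v 0⟩
  refine Set.Finite.subset ((Set.toFinite _).biUnion fun e he => ?_) this
  obtain ⟨F, F', -, -, -, h, -⟩ := exists_two_faces hG ρ he
  refine (Set.toFinite {F, F'}).subset ?_
  rintro X ⟨hX, hX'⟩
  exact (h X hX).1 hX'

/-- Every point lies in the closure of a face. -/
theorem exists_mem_closure_face (hG : G.IsPentagulation) (x : Plane) :
    ∃ F, G.IsFace F ∧ x ∈ closure F := by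
  have hfin : {F | G.IsFace F}.Finite := finite_faces hG
  have hU : G.pointSetᶜ ⊆ ⋃ F ∈ {F | G.IsFace F}, F := by
    intro y hy
    obtain ⟨F, hF, hyF⟩ := exists_isFace_mem hy
    exact Set.mem_biUnion hF hyF
  have := closure_mono hU (dense_compl_pointSet (G := G) x)
  rw [hfin.closure_biUnion] at this
  simpa using this

/-- A set of faces that is closed under crossing edges contains no face or all faces. -/
theorem faces_connected (hG : G.IsPentagulation) (S : Set {F // G.IsFace F})
    (hS : ∀ e (F F' : {F // G.IsFace F}), e ∈ G.faceEdges F → e ∈ G.faceEdges F' → F ∈ S → F' ∈ S) :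
    S = ∅ ∨ S = Set.univ := by
  have := finite_faces hG
  by_contra hcon
  rw [not_or, ← ne_eq, ← Set.nonempty_iff_ne_empty, Set.eq_univ_iff_forall] at hcon
  push Not at hcon
  obtain ⟨⟨F₀, hF₀⟩, F₁, hF₁⟩ := hcon
  have hclosed : ∀ T : Set {F // G.IsFace F}, IsClosed (⋃ F ∈ T, closure (F : Set Plane)) :=
    fun T => (Set.toFinite T).isClosed_biUnion fun _ _ => isClosed_closure
  -- The plane without the vertices is connected and is covered by two closed sets, the union of the
  -- closures of the faces in `S` and that of the others. A common point lies on an edge that bounds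
  -- a face of each kind.
  have hconn : IsPreconnected (Set.range G.pos)ᶜ := by
    refine ((Set.finite_range G.pos).countable.isPathConnected_compl_of_one_lt_rank
      ?_).isConnected.isPreconnected
    rw [← Module.finrank_eq_rank]
    norm_num
  have hvert : ∀ F : {F // G.IsFace F}, ∀ x ∈ (F : Set Plane), x ∉ Set.range G.pos :=
    fun F x hx hP => F.2.subset hx (.inl hP)
  have key := isPreconnected_closed_iff.1 hconn (⋃ F ∈ S, closure (F : Set Plane))
    (⋃ F ∈ Sᶜ, closure (F : Set Plane)) (hclosed S) (hclosed Sᶜ) ?_ ?_ ?_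
  · obtain ⟨x, hxV, hx1, hx2⟩ := key
    simp only [Set.mem_iUnion] at hx1 hx2
    obtain ⟨A, hA, hxA⟩ := hx1
    obtain ⟨B, hB, hxB⟩ := hx2
    have hxP : x ∈ G.pointSet := by
      by_contra hxP
      have hmem : ∀ F : {F // G.IsFace F}, x ∈ closure (F : Set Plane) → x ∈ (F : Set Plane) := by
        intro F hxF
        by_contra hn
        obtain ⟨v, -, hadj, hfr⟩ := hG.exists_frontier_eq F.2
        exact hxP (polygon_subset_pointSet hadj (hfr ▸ F.2.frontier_eq ▸ ⟨hxF, hn⟩))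
      have : A = B := Subtype.ext (A.2.eq_of_mem B.2 (hmem A hxA) (hmem B hxB))
      exact hB (this ▸ hA)
    rcases hxP with hxP | ⟨e, he, hxe⟩
    · exact hxV hxP
    · have hv : ∀ w, x ≠ G.pos w := fun w hw => hxV ⟨w, hw.symm⟩
      have hxP := arc_subset_pointSet he hxe
      exact hB (hS e A B
        (mem_faceEdges_of_mem_frontier hG A.2 he hxe hv (A.2.mem_frontier hxA hxP))
        (mem_faceEdges_of_mem_frontier hG B.2 he hxe hv (B.2.mem_frontier hxB hxP)) hA)
  · intro x _
    obtain ⟨F, hF, hx⟩ := exists_mem_closure_face hG x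
    by_cases h : (⟨F, hF⟩ : {F // G.IsFace F}) ∈ S
    · exact .inl (Set.mem_biUnion h hx)
    · exact .inr (Set.mem_biUnion h hx)
  · obtain ⟨x, hx⟩ := F₀.2.nonempty
    exact ⟨x, hvert F₀ x hx, Set.mem_biUnion hF₀ (subset_closure hx)⟩
  · obtain ⟨x, hx⟩ := F₁.2.nonempty
    exact ⟨x, hvert F₁ x hx, Set.mem_biUnion hF₁ (subset_closure hx)⟩

/-- The faces with sign `-1`. -/
def insideFaces (ρ : G.RootSystem) {ℓ : ℕ} [NeZero ℓ] (c : Fin ℓ → V) :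
    Set {F // G.IsFace F} := {F | ∃ x ∈ (F : Set Plane), ρ.sign c x = -1}

/-- Since the sign is locally constant off the polygon, it may be read off at boundary points of the
face, such as vertices or the points `ρ.pt e`. -/
theorem mem_insideFaces_iff {ρ : G.RootSystem} {ℓ : ℕ} [NeZero ℓ] {c : Fin ℓ → V}
    (hc : ∀ i, G.graph.Adj (c i) (c (i + 1))) {F : {F // G.IsFace F}} {y : Plane}
    (hy : y ∈ closure (F : Set Plane)) (hyc : y ∉ G.polygon c) :
    F ∈ insideFaces ρ c ↔ ρ.sign c y = -1 := by
  constructor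
  · rintro ⟨x, hx, hs⟩
    rw [← RootSystem.sign_eq_of_mem_closure_face hc F.2 hx hy hyc, hs]
  · intro hs
    obtain ⟨x, hx⟩ := F.2.nonempty
    exact ⟨x, hx, by rw [RootSystem.sign_eq_of_mem_closure_face hc F.2 hx hy hyc, hs]⟩

/-- One radius serves all closed walks: the outside of a large disc is connected and misses the
drawing, and every sign tends to 1 at infinity. -/
theorem exists_radius (ρ : G.RootSystem) : ∃ R : ℝ, 0 ≤ R ∧ ∀ x : Plane, R < ‖x‖ → x ∉ G.pointSet ∧
    ∀ {ℓ : ℕ} [NeZero ℓ] (c : Fin ℓ → V), (∀ i, G.graph.Adj (c i) (c (i + 1))) →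
      ρ.sign c x = 1 := by
  obtain ⟨R, hR⟩ := (Metric.isBounded_iff_subset_closedBall (0 : Plane)).1
    (isBounded_pointSet (G := G))
  have hP : ∀ x : Plane, max R 0 < ‖x‖ → x ∉ G.pointSet := by
    intro x hx hxP
    have := hR hxP
    rw [mem_closedBall_zero_iff] at this
    exact absurd ((le_max_left R 0).trans_lt hx) (not_lt.2 this)
  refine ⟨max R 0, le_max_right _ _, fun x hx => ⟨hP x hx, fun c hc => ?_⟩⟩
  have hfar : ∀ᶠ y in Bornology.cobounded Plane, max R 0 < ‖y‖ :=
    tendsto_norm_cobounded_atTop.eventually_gt_atTop _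
  have hne : ∀ᶠ y in Bornology.cobounded Plane, ρ.sign c y ≠ -1 :=
    (RootSystem.tendsto_sign hc).eventually_ne (by norm_num)
  obtain ⟨y, hy, hy'⟩ := (hfar.and hne).exists
  have hpoly : ∀ w ∈ {x : Plane | max R 0 < ‖x‖}, w ∉ G.polygon c := fun w hw h =>
    hP w hw (polygon_subset_pointSet hc h)
  rw [RootSystem.sign_eq_of_isPreconnected hc (isPreconnected_norm_gt (le_max_right R 0)) hpoly
    hx hy]
  exact (RootSystem.sign_eq_one_or hc (hpoly y hy)).resolve_right hy'

theorem exists_unbounded_point (R : ℝ) : ∃ x : Plane, R < ‖x‖ :=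
  (tendsto_norm_cobounded_atTop.eventually_gt_atTop R).exists

theorem pos_mem_closure_of_mem_faceEdges {F : Set Plane} {e : Sym2 V} {w : V}
    (he : e ∈ G.faceEdges F) (hw : w ∈ e) : G.pos w ∈ closure F := by
  obtain ⟨he, hsub⟩ := he
  refine frontier_subset_closure (hsub ?_)
  induction e using Sym2.ind with | _ u v
  rcases Sym2.mem_iff.1 hw with rfl | rfl
  exacts [(G.arc_isArc _ _ he).left_mem, (G.arc_isArc _ _ he).right_mem]

/-- The faces of a pentagulation. -/
theorem exists_faceSystem (hG : G.IsPentagulation) (ρ : G.RootSystem) :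
    ∃ fs : FaceSystem G.graph {F // G.IsFace F}, (∀ F, fs.bd F = G.faceEdges F) ∧
      ∀ {ℓ : ℕ} [NeZero ℓ] (c : Fin ℓ → V), 3 ≤ ℓ → Function.Injective c →
        (∀ i, G.graph.Adj (c i) (c (i + 1))) → fs.IsDisk c (insideFaces ρ c) := by
  obtain ⟨R, -, hR⟩ := exists_radius ρ
  -- The face `out` is that of a point so far away that the sign of every closed walk is 1.
  obtain ⟨x₀, hx₀⟩ := exists_unbounded_point R
  obtain ⟨O, hO, hxO⟩ := exists_isFace_mem (hR x₀ hx₀).1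
  have hout : ∀ {ℓ : ℕ} [NeZero ℓ] (c : Fin ℓ → V), (∀ i, G.graph.Adj (c i) (c (i + 1))) →
      (⟨O, hO⟩ : {F // G.IsFace F}) ∉ insideFaces ρ c := by
    rintro ℓ _ c hc ⟨x, hx, hs⟩
    rw [RootSystem.sign_eq_of_mem_face hc hO hx hxO, (hR x₀ hx₀).2 c hc] at hs
    norm_num at hs
  have hfill : ∀ {ℓ : ℕ} [NeZero ℓ] (c : Fin ℓ → V), (∀ i, G.graph.Adj (c i) (c (i + 1))) →
      (∀ (e : Sym2 V) (F F' : {F // G.IsFace F}), F ≠ F' → e ∈ G.faceEdges F → e ∈ G.faceEdges F' →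
        ((F ∈ insideFaces ρ c ↔ F' ∈ insideFaces ρ c) ↔ Even {i | s(c i, c (i + 1)) = e}.ncard)) ∧
      ∀ w ∉ Set.range c, ∀ F F' : {F // G.IsFace F}, (∃ e ∈ G.faceEdges F, w ∈ e) →
        (∃ e ∈ G.faceEdges F', w ∈ e) → F ∈ insideFaces ρ c → F' ∈ insideFaces ρ c := by
    intro ℓ _ c hc
    refine ⟨?_, ?_⟩
    · have key : ∀ (A B : {F // G.IsFace F}) (k : ℕ), (∀ x ∈ (A : Set Plane), ∀ y ∈ (B : Set Plane),
          ρ.sign c y = (-1) ^ k * ρ.sign c x) →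
          ((A ∈ insideFaces ρ c ↔ B ∈ insideFaces ρ c) ↔ Even k) := by
        intro A B k h
        obtain ⟨x, hx⟩ := A.2.nonempty
        obtain ⟨y, hy⟩ := B.2.nonempty
        have hx' : x ∉ G.polygon c := fun hp => A.2.subset hx (polygon_subset_pointSet hc hp)
        have hy' : y ∉ G.polygon c := fun hp => B.2.subset hy (polygon_subset_pointSet hc hp)
        rw [mem_insideFaces_iff hc (subset_closure hx) hx',
          mem_insideFaces_iff hc (subset_closure hy) hy', h x hx y hy]
        rcases Nat.even_or_odd k with hk | hk
        · simp [hk]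
        · simp only [hk.neg_one_pow, Nat.not_even_iff_odd.2 hk, iff_false]
          rcases RootSystem.sign_eq_one_or (ρ := ρ) hc hx' with h1 | h1 <;> rw [h1] <;> norm_num
      intro e F F' hne hF hF'
      obtain ⟨A, B, hA, hB, -, h, hs⟩ := exists_two_faces hG ρ hF.1
      have hAB := key ⟨A, hA⟩ ⟨B, hB⟩ _ (hs c hc)
      rcases (h F F.2).1 hF with h1 | h1 <;> rcases (h F' F'.2).1 hF' with h2 | h2
      · exact absurd (Subtype.ext (h1.trans h2.symm)) hne
      · obtain rfl : F = ⟨A, hA⟩ := Subtype.ext h1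
        obtain rfl : F' = ⟨B, hB⟩ := Subtype.ext h2
        exact hAB
      · obtain rfl : F = ⟨B, hB⟩ := Subtype.ext h1
        obtain rfl : F' = ⟨A, hA⟩ := Subtype.ext h2
        rw [← hAB]; exact iff_comm
      · exact absurd (Subtype.ext (h1.trans h2.symm)) hne
    · rintro w hw F F' ⟨e, he, hwe⟩ ⟨e', he', hwe'⟩ hF
      have hwp : G.pos w ∉ G.polygon c := fun h => hw (mem_range_of_pos_mem_polygon hc h)
      rw [mem_insideFaces_iff hc (pos_mem_closure_of_mem_faceEdges he hwe) hwp] at hF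
      rwa [mem_insideFaces_iff hc (pos_mem_closure_of_mem_faceEdges he' hwe') hwp]
  refine ⟨⟨fun F => G.faceEdges F, ⟨O, hO⟩, fun F e he => he.1, ?_, ?_,
    fun ℓ _ c hc => ⟨insideFaces ρ c, hout c hc, hfill c hc⟩, faces_connected hG⟩,
    fun _ => rfl, fun c hℓ hinj hc =>
      FaceSystem.isDisk_of_even hℓ hinj hc (hout c hc) (hfill c hc).1 (hfill c hc).2⟩
  · intro F
    obtain ⟨v, hv, -, -, hbd⟩ := exists_faceEdges_eq hG F.2
    exact ⟨v, hv, hbd⟩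
  · intro e he
    obtain ⟨F, F', hF, hF', hne, h, -⟩ := exists_two_faces hG ρ he
    exact ⟨⟨F, hF⟩, ⟨F', hF'⟩, fun h => hne (congrArg Subtype.val h), fun X => by
      rw [h X X.2, Subtype.ext_iff, Subtype.ext_iff]⟩

end PlaneGraph

/-! ### The interior of a cycle in terms of faces. -/

namespace PlaneGraph

variable {V : Type*} {G : PlaneGraph V} {ℓ : ℕ} [NeZero ℓ] {c : Fin ℓ → V}

/-- The component of `y` is open, so it meets `F`; as `F` is connected and misses the polygon, it
lies in that component. -/
theorem mem_component_iff_of_mem_closure [Finite V] (hc : ∀ i, G.graph.Adj (c i) (c (i + 1)))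
    {F : Set Plane} (hF : G.IsFace F) {x y : Plane} (hy : y ∈ closure F) (hyc : y ∉ G.polygon c) :
    F ⊆ connectedComponentIn (G.polygon c)ᶜ x ↔ y ∈ connectedComponentIn (G.polygon c)ᶜ x := by
  have hFc : F ⊆ (G.polygon c)ᶜ := fun w hw hp => hF.subset hw (polygon_subset_pointSet hc hp)
  have hopen : IsOpen (connectedComponentIn (G.polygon c)ᶜ y) :=
    (RootSystem.isClosed_polygon hc).isOpen_compl.connectedComponentIn
  obtain ⟨w, hw, hwF⟩ := mem_closure_iff.1 hy _ hopen (mem_connectedComponentIn hyc)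
  have hwy := connectedComponentIn_eq hw
  have hFw : F ⊆ connectedComponentIn (G.polygon c)ᶜ w :=
    hF.isPreconnected.subset_connectedComponentIn hwF hFc
  constructor
  · intro h
    rw [connectedComponentIn_eq (h hwF), ← hwy]
    exact mem_connectedComponentIn hyc
  · intro h
    rw [connectedComponentIn_eq h, hwy]
    exact hFw

/-- The points with bounded component in the complement of a cycle are those of sign `-1`. -/
theorem isBounded_component_iff [Finite V] (hG : G.IsPentagulation) (ρ : G.RootSystem)
    (hℓ : 3 ≤ ℓ) (hinj : Function.Injective c) (hc : ∀ i, G.graph.Adj (c i) (c (i + 1)))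
    {x : Plane} (hx : x ∉ G.polygon c) :
    Bornology.IsBounded (connectedComponentIn (G.polygon c)ᶜ x) ↔ ρ.sign c x = -1 := by
  obtain ⟨R, hR0, hR⟩ := exists_radius ρ
  set K := connectedComponentIn (G.polygon c)ᶜ x with hK
  have hxK : x ∈ K := mem_connectedComponentIn hx
  have hKc : ∀ w ∈ K, w ∉ G.polygon c := fun w hw => connectedComponentIn_subset _ _ hw
  have hsign : ∀ w ∈ K, ρ.sign c w = ρ.sign c x := fun w hw =>
    RootSystem.sign_eq_of_isPreconnected hc isPreconnected_connectedComponentIn hKc hw hxK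
  constructor
  · intro hb
    by_contra hs
    have hs : ρ.sign c x = 1 := (RootSystem.sign_eq_one_or hc hx).resolve_right hs
    have := finite_faces hG
    obtain ⟨fs, hbd, hdisk⟩ := exists_faceSystem hG ρ
    have hD := hdisk c hℓ hinj hc
    -- Assume that `K` is bounded with sign 1. The faces in `K` are not inside faces, and their
    -- boundary is contained in the cycle. It is not empty, since `X` is neither empty nor
    -- everything, so it is the whole cycle. Then `X` and the inside faces are equal or
    -- complementary; they are disjoint and not empty, and a far face belongs to neither.
    let X : Set {F // G.IsFace F} := {F | (F : Set Plane) ⊆ K}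
    have hdisj : ∀ F ∈ X, F ∉ insideFaces ρ c := by
      rintro F hF ⟨y, hy, hy'⟩
      rw [hsign y (hF hy), hs] at hy'
      norm_num at hy'
    have hXne : X ≠ ∅ := by
      obtain ⟨F, hF, hxF⟩ := exists_mem_closure_face hG x
      have : (⟨F, hF⟩ : {F // G.IsFace F}) ∈ X :=
        (mem_component_iff_of_mem_closure hc hF hxF hx).2 hxK
      exact Set.nonempty_iff_ne_empty.1 ⟨_, this⟩
    have hbdX : fs.boundary X ⊆ cyclicEdges c := by
      rintro e ⟨F, hF, F', hF', h1, h2⟩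
      by_contra hec
      rw [hbd] at h1 h2
      have hcr := (ρ.crossing e h1.1)
      have hpt : ρ.pt e ∉ G.polygon c := by
        intro h
        obtain ⟨i, hi⟩ := Set.mem_iUnion.1 h
        exact hec ⟨i, edge_eq_of_mem h1.1 (hc i) hcr.mem hi (ρ.pt_ne e h1.1)⟩
      have k1 := mem_component_iff_of_mem_closure (x := x) hc F.2
        (frontier_subset_closure (h1.2 hcr.mem)) hpt
      have k2 := mem_component_iff_of_mem_closure (x := x) hc F'.2
        (frontier_subset_closure (h2.2 hcr.mem)) hpt
      exact hF' (k2.2 (k1.1 hF))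
    obtain ⟨A, hA⟩ := hD.nonempty
    rcases FaceSystem.boundary_eq_of_subset_cyclicEdges hinj hbdX with h0 | h0
    · rcases FaceSystem.eq_empty_or_univ_of_boundary h0 with h | h
      · exact hXne h
      · exact hdisj A (h ▸ Set.mem_univ _) hA
    · have h1 : fs.boundary (symmDiff X (insideFaces ρ c)) = ∅ := by
        rw [FaceSystem.boundary_symmDiff, h0, hD.boundary_eq, symmDiff_self]; rfl
      rcases FaceSystem.eq_empty_or_univ_of_boundary h1 with h | h
      · have : X = insideFaces ρ c := symmDiff_eq_bot.1 h
        exact hdisj A (this ▸ hA) hA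
      · obtain ⟨B, hB⟩ := hb.exists_pos_norm_le
        obtain ⟨y, hy⟩ := exists_unbounded_point (max R B)
        have hyR := hR y ((le_max_left _ _).trans_lt hy)
        obtain ⟨F, hF, hyF⟩ := exists_isFace_mem hyR.1
        have hFs : (⟨F, hF⟩ : {F // G.IsFace F}) ∈ symmDiff X (insideFaces ρ c) :=
          h ▸ Set.mem_univ _
        rcases hFs with hFs | hFs
        · exact absurd (hB.2 y (hFs.1 hyF)) (not_le.2 ((le_max_right _ _).trans_lt hy))
        · obtain ⟨z, hz, hz'⟩ := hFs.1
          rw [RootSystem.sign_eq_of_mem_face hc hF hz hyF, hyR.2 c hc] at hz'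
          norm_num at hz'
  · intro hs
    refine (Metric.isBounded_closedBall (x := (0 : Plane)) (r := R)).subset fun w hw => ?_
    rw [mem_closedBall_zero_iff]
    by_contra hcon
    have := (hR w (not_le.1 hcon)).2 c hc
    rw [hsign w hw, hs] at this
    norm_num at this

theorem mem_openInside_iff [Finite V] (hG : G.IsPentagulation) (ρ : G.RootSystem) (hℓ : 3 ≤ ℓ)
    (hinj : Function.Injective c) (hc : ∀ i, G.graph.Adj (c i) (c (i + 1))) {a : V}
    {C : G.graph.Walk a a} (hC : ∀ e, e ∈ C.edges ↔ e ∈ cyclicEdges c) {x : Plane} :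
    x ∈ G.openInside C ↔ x ∉ G.polygon c ∧ ρ.sign c x = -1 := by
  rw [openInside, walkSet_eq_polygon hC]
  exact and_congr_right fun hx => isBounded_component_iff hG ρ hℓ hinj hc hx

theorem face_subset_openInside [Finite V] (hG : G.IsPentagulation) (ρ : G.RootSystem) (hℓ : 3 ≤ ℓ)
    (hinj : Function.Injective c) (hc : ∀ i, G.graph.Adj (c i) (c (i + 1))) {a : V}
    {C : G.graph.Walk a a} (hC : ∀ e, e ∈ C.edges ↔ e ∈ cyclicEdges c) {F : {F // G.IsFace F}}
    (hF : F ∈ insideFaces ρ c) : (F : Set Plane) ⊆ G.openInside C := by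
  intro x hx
  have hxc : x ∉ G.polygon c := fun hp => F.2.subset hx (polygon_subset_pointSet hc hp)
  exact (mem_openInside_iff hG ρ hℓ hinj hc hC).2
    ⟨hxc, (mem_insideFaces_iff hc (subset_closure hx) hxc).1 hF⟩

theorem mem_closedInside_of_mem_closure [Finite V] (hG : G.IsPentagulation) (ρ : G.RootSystem)
    (hℓ : 3 ≤ ℓ) (hinj : Function.Injective c) (hc : ∀ i, G.graph.Adj (c i) (c (i + 1))) {a : V}
    {C : G.graph.Walk a a} (hC : ∀ e, e ∈ C.edges ↔ e ∈ cyclicEdges c) {F : {F // G.IsFace F}}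
    (hF : F ∈ insideFaces ρ c) {x : Plane} (hx : x ∈ closure (F : Set Plane)) :
    x ∈ G.closedInside C := by
  by_cases hxc : x ∈ G.polygon c
  · right; rwa [walkSet_eq_polygon hC]
  · left
    exact (mem_openInside_iff hG ρ hℓ hinj hc hC).2 ⟨hxc, (mem_insideFaces_iff hc hx hxc).1 hF⟩

/-- Every vertex lies on the boundary of a face. -/
theorem exists_face_at [Finite V] (hG : G.IsPentagulation) (w : V) :
    ∃ F : {F // G.IsFace F}, ∃ e ∈ G.faceEdges F, w ∈ e := by
  obtain ⟨F, hF, hw⟩ := exists_mem_closure_face hG (G.pos w)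
  have hfr := hF.mem_frontier hw (.inl ⟨w, rfl⟩)
  obtain ⟨v, -, hadj, hfr', hbd⟩ := exists_faceEdges_eq hG hF
  rw [hfr'] at hfr
  obtain ⟨i, rfl⟩ := mem_range_of_pos_mem_polygon hadj hfr
  exact ⟨⟨F, hF⟩, _, hbd ▸ mem_cyclicEdges_self v i, by simp⟩

theorem pos_notMem_polygon_iff (hc : ∀ i, G.graph.Adj (c i) (c (i + 1))) {w : V} :
    G.pos w ∉ G.polygon c ↔ w ∉ Set.range c := by
  rw [not_iff_not]
  refine ⟨mem_range_of_pos_mem_polygon hc, ?_⟩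
  rintro ⟨i, rfl⟩
  exact Set.mem_iUnion.2 ⟨i, (G.arc_isArc _ _ (hc i)).left_mem⟩

theorem pos_mem_openInside_iff [Finite V] (hG : G.IsPentagulation) (ρ : G.RootSystem) (hℓ : 3 ≤ ℓ)
    (hinj : Function.Injective c) (hc : ∀ i, G.graph.Adj (c i) (c (i + 1))) {a : V}
    {C : G.graph.Walk a a} (hC : ∀ e, e ∈ C.edges ↔ e ∈ cyclicEdges c)
    {fs : FaceSystem G.graph {F // G.IsFace F}} (hbd : ∀ F, fs.bd F = G.faceEdges F) {w : V} :
    G.pos w ∈ G.openInside C ↔ fs.Inside c (insideFaces ρ c) w := by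
  rw [mem_openInside_iff hG ρ hℓ hinj hc hC, pos_notMem_polygon_iff hc]
  refine and_congr_right fun hw => ?_
  have hwp := (pos_notMem_polygon_iff hc).2 hw
  constructor
  · intro hs
    obtain ⟨F, e, he, hwe⟩ := exists_face_at hG w
    exact ⟨F, (mem_insideFaces_iff hc (pos_mem_closure_of_mem_faceEdges he hwe) hwp).2 hs, e,
      hbd F ▸ he, hwe⟩
  · rintro ⟨F, hF, e, he, hwe⟩
    rw [hbd] at he
    exact (mem_insideFaces_iff hc (pos_mem_closure_of_mem_faceEdges he hwe) hwp).1 hF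

theorem pos_mem_closedInside_iff [Finite V] (hG : G.IsPentagulation) (ρ : G.RootSystem)
    (hℓ : 3 ≤ ℓ) (hinj : Function.Injective c) (hc : ∀ i, G.graph.Adj (c i) (c (i + 1))) {a : V}
    {C : G.graph.Walk a a} (hC : ∀ e, e ∈ C.edges ↔ e ∈ cyclicEdges c)
    {fs : FaceSystem G.graph {F // G.IsFace F}} (hbd : ∀ F, fs.bd F = G.faceEdges F)
    (hD : fs.IsDisk c (insideFaces ρ c)) {w : V} :
    G.pos w ∈ G.closedInside C ↔ ∃ F ∈ insideFaces ρ c, fs.At F w := by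
  constructor
  · rintro (h | h)
    · exact ((pos_mem_openInside_iff hG ρ hℓ hinj hc hC hbd).1 h).2
    · rw [walkSet_eq_polygon hC] at h
      obtain ⟨i, rfl⟩ := mem_range_of_pos_mem_polygon hc h
      obtain ⟨F, hF, -, -, h, -⟩ := hD.exists_mem_notMem i
      exact ⟨F, hF, h⟩
  · rintro ⟨F, hF, e, he, hwe⟩
    rw [hbd] at he
    exact mem_closedInside_of_mem_closure hG ρ hℓ hinj hc hC hF
      (pos_mem_closure_of_mem_faceEdges he hwe)

/-- For the forward direction one point of the arc suffices: `ρ.pt e` is not a vertex, so its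
position shows that `e` has an inside face or is an edge of the cycle. -/
theorem arc_subset_closedInside_iff [Finite V] (hG : G.IsPentagulation) (ρ : G.RootSystem)
    (hℓ : 3 ≤ ℓ) (hinj : Function.Injective c) (hc : ∀ i, G.graph.Adj (c i) (c (i + 1))) {a : V}
    {C : G.graph.Walk a a} (hC : ∀ e, e ∈ C.edges ↔ e ∈ cyclicEdges c)
    {fs : FaceSystem G.graph {F // G.IsFace F}} (hbd : ∀ F, fs.bd F = G.faceEdges F)
    (hD : fs.IsDisk c (insideFaces ρ c)) {e : Sym2 V} (he : e ∈ G.graph.edgeSet) :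
    G.arc e ⊆ G.closedInside C ↔ ∃ F ∈ insideFaces ρ c, e ∈ fs.bd F := by
  constructor
  · intro h
    have hcr := ρ.crossing e he
    rcases h hcr.mem with h | h
    · obtain ⟨F, hF⟩ := FaceSystem.exists_mem_bd (fs := fs) he
      obtain ⟨h1, h2⟩ := (mem_openInside_iff hG ρ hℓ hinj hc hC).1 h
      refine ⟨F, ?_, hF⟩
      rw [hbd] at hF
      exact (mem_insideFaces_iff hc (frontier_subset_closure (hF.2 hcr.mem)) h1).2 h2
    · rw [walkSet_eq_polygon hC] at h
      obtain ⟨i, hi⟩ := Set.mem_iUnion.1 h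
      obtain rfl := edge_eq_of_mem he (hc i) hcr.mem hi (ρ.pt_ne e he)
      have := mem_cyclicEdges_self c i
      rw [← hD.boundary_eq] at this
      obtain ⟨F, hF, -, -, h, -⟩ := this
      exact ⟨F, hF, h⟩
  · rintro ⟨F, hF, he⟩ x hx
    rw [hbd] at he
    exact mem_closedInside_of_mem_closure hG ρ hℓ hinj hc hC hF (frontier_subset_closure (he.2 hx))

/-- The frontier of a face is the union of two walks that together have its edges. -/
theorem IsPentagulation.frontier_eq_union (hG : G.IsPentagulation) {F : Set Plane}
    (hF : G.IsFace F) {u v u' v' : V} {p : G.graph.Walk u v} {q : G.graph.Walk u' v'}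
    (h : ∀ e, e ∈ G.faceEdges F ↔ e ∈ p.edges ∨ e ∈ q.edges) :
    frontier F = G.walkSet p ∪ G.walkSet q := by
  obtain ⟨v, -, -, hfr, hbd⟩ := exists_faceEdges_eq hG hF
  have : frontier F = {x | ∃ e ∈ G.faceEdges F, x ∈ G.arc e} := by
    rw [hfr, hbd]
    ext x
    simp only [polygon, cyclicEdges, Set.mem_iUnion, Set.mem_ofPred_eq]
    constructor
    · rintro ⟨i, hi⟩; exact ⟨_, ⟨i, rfl⟩, hi⟩
    · rintro ⟨_, ⟨i, rfl⟩, hi⟩; exact ⟨i, hi⟩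
  rw [this]
  ext x
  simp only [walkSet, h, Set.mem_union, Set.mem_ofPred_eq]
  constructor
  · rintro ⟨e, h1 | h1, h2⟩
    exacts [.inl ⟨e, h1, h2⟩, .inr ⟨e, h1, h2⟩]
  · rintro (⟨e, h1, h2⟩ | ⟨e, h1, h2⟩)
    exacts [⟨e, .inl h1, h2⟩, ⟨e, .inr h1, h2⟩]

end PlaneGraph

/-! ### From strips to paths in the plane graph. -/

namespace FaceSystem

theorem mem_cyclicEdges_theta {V : Type*} {u b v q p : V} {e : Sym2 V} :
    e ∈ cyclicEdges ![u, b, v, q, p] ↔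
      (e = s(u, b) ∨ e = s(b, v)) ∨ e = s(u, p) ∨ e = s(p, q) ∨ e = s(q, v) := by
  rw [cyclicEdges_five, Sym2.eq_swap (a := v), Sym2.eq_swap (a := q) (b := p),
    Sym2.eq_swap (a := p) (b := u)]
  simp only [Set.mem_insert_iff, Set.mem_singleton_iff]
  tauto

end FaceSystem

namespace PlaneGraph

variable {V : Type*} {G : PlaneGraph V}

/-- `B i` is the path through `t (3 i)`, and `A i` the path through `t (3 i + 1)` and `t (3 i + 2)`.
Disjointness of the paths is injectivity of `t`, and the subgraph in the closed region consists of
the vertices and edges on the boundaries of the inside faces. -/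
theorem exists_walks_of_strip [Finite V] (hG : G.IsPentagulation) (ρ : G.RootSystem) {a : V}
    {C : G.graph.Walk a a} {c : Fin 4 → V} (hinj : Function.Injective c)
    (hc : ∀ i, G.graph.Adj (c i) (c (i + 1))) (hC : ∀ e, e ∈ C.edges ↔ e ∈ cyclicEdges c)
    (hCs : ∀ x, x ∈ C.support ↔ x ∈ Set.range c) {fs : FaceSystem G.graph {F // G.IsFace F}}
    (hbd : ∀ F, fs.bd F = G.faceEdges F) (hD : fs.IsDisk c (insideFaces ρ c))
    (hs : fs.Strip (c 0) (c 1) (c 2) (c 3) (insideFaces ρ c)) :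
    ∃ u ∈ C.support, ∃ v ∈ C.support, u ≠ v ∧ ¬ C.toSubgraph.Adj u v ∧
      ∃ k : ℕ, 1 ≤ k ∧
        ∃ (A : Fin k → G.graph.Walk u v) (B : Fin (k + 1) → G.graph.Walk u v),
          (∀ i, (A i).IsPath ∧ (A i).length = 3) ∧
          (∀ i, (B i).IsPath ∧ (B i).length = 2) ∧
          C.toSubgraph = (B 0).toSubgraph ⊔ (B (Fin.last k)).toSubgraph ∧
          G.insideSubgraph C =
            C.toSubgraph ⊔ (⨆ i, (A i).toSubgraph) ⊔ (⨆ i, (B i).toSubgraph) ∧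
          (∀ i j, i ≠ j → G.InternallyDisjoint (A i) (A j)) ∧
          (∀ i j, i ≠ j → G.InternallyDisjoint (B i) (B j)) ∧
          (∀ i j, G.InternallyDisjoint (A i) (B j)) ∧
          (∀ i : Fin k, G.BoundFaceInside C (B i.castSucc) (A i) ∧
            G.BoundFaceInside C (A i) (B i.succ)) := by
  obtain ⟨k, t, hk, ht0, htk, huv, hinjt, hne, hf1, hf2, hf⟩ := hs
  generalize hu : c 0 = u at *
  generalize hv : c 2 = v at *
  have hmemC : ∀ e, e ∈ C.edges ↔ (e = s(u, t 0) ∨ e = s(t 0, v)) ∨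
      (e = s(u, t (3 * k)) ∨ e = s(t (3 * k), v)) := by
    intro e
    have hc4 : cyclicEdges c = cyclicEdges ![u, t 0, v, t (3 * k)] := by
      congr 1; ext i; fin_cases i
      exacts [hu, ht0.symm, hv, htk.symm]
    rw [hC, hc4, FaceSystem.cyclicEdges_four, Sym2.eq_swap (a := v),
      Sym2.eq_swap (a := t (3 * k)) (b := u)]
    simp only [Set.mem_insert_iff, Set.mem_singleton_iff]
    tauto
  have hsuppC : ∀ x, x ∈ C.support ↔ x = u ∨ x = t 0 ∨ x = v ∨ x = t (3 * k) := by
    intro x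
    rw [hCs]
    constructor
    · rintro ⟨i, rfl⟩
      fin_cases i
      exacts [.inl hu, .inr (.inl ht0.symm), .inr (.inr (.inl hv)), .inr (.inr (.inr htk.symm))]
    · rintro (rfl | rfl | rfl | rfl)
      exacts [⟨0, hu⟩, ⟨1, ht0.symm⟩, ⟨2, hv⟩, ⟨3, htk.symm⟩]
  have hA : ∀ i < k, G.graph.Adj u (t (3 * i + 1)) ∧ G.graph.Adj (t (3 * i + 1)) (t (3 * i + 2)) ∧
      G.graph.Adj (t (3 * i + 2)) v ∧ G.graph.Adj u (t (3 * i)) ∧ G.graph.Adj (t (3 * i)) v := by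
    intro i hi
    obtain ⟨F, -, hF⟩ := hf1 i hi
    have h : ∀ e, e ∈ cyclicEdges ![u, t (3 * i), v, t (3 * i + 2), t (3 * i + 1)] →
        e ∈ G.graph.edgeSet := fun e he => fs.bd_subset F (hF ▸ he)
    simp only [FaceSystem.mem_cyclicEdges_theta] at h
    exact ⟨h s(_, _) (by simp), h s(_, _) (by simp), h s(_, _) (by simp), h s(_, _) (by simp),
      h s(_, _) (by simp)⟩
  have hB : ∀ i ≤ k, G.graph.Adj u (t (3 * i)) ∧ G.graph.Adj (t (3 * i)) v := by
    intro i hi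
    rcases hi.lt_or_eq with hi | rfl
    · exact (hA i hi).2.2.2
    · obtain ⟨F, -, hF⟩ := hf2 (i - 1) (by omega)
      rw [show 3 * (i - 1) + 3 = 3 * i by omega] at hF
      have h := fs.bd_subset F
      rw [hF] at h
      exact ⟨h (a := s(_, _)) (FaceSystem.mem_cyclicEdges_theta.2 (by simp)),
        h (a := s(_, _)) (FaceSystem.mem_cyclicEdges_theta.2 (by simp))⟩
  let A : Fin k → G.graph.Walk u v := fun i =>
    .cons (hA i i.2).1 (.cons (hA i i.2).2.1 (.cons (hA i i.2).2.2.1 .nil))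
  let B : Fin (k + 1) → G.graph.Walk u v := fun i =>
    .cons (hB i (Nat.lt_succ_iff.1 i.2)).1 (.cons (hB i (Nat.lt_succ_iff.1 i.2)).2 .nil)
  have hAs : ∀ i x, x ∈ (A i).support ↔ x = u ∨ x = t (3 * i + 1) ∨ x = t (3 * i + 2) ∨ x = v := by
    intro i x; simp [A]
  have hBs : ∀ i x, x ∈ (B i).support ↔ x = u ∨ x = t (3 * i) ∨ x = v := by
    intro i x; simp [B]
  have hAe : ∀ i e, e ∈ (A i).edges ↔ e = s(u, t (3 * i + 1)) ∨
      e = s(t (3 * i + 1), t (3 * i + 2)) ∨ e = s(t (3 * i + 2), v) := by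
    intro i e; simp [A]
  have hBe : ∀ i e, e ∈ (B i).edges ↔ e = s(u, t (3 * i)) ∨ e = s(t (3 * i), v) := by
    intro i e; simp [B]
  have ht : ∀ {i j}, i ≤ 3 * k → j ≤ 3 * k → t i = t j → i = j := fun hi hj h => hinjt hi hj h
  have hface1 : ∀ i : Fin k, ∃ F ∈ insideFaces ρ c,
      ∀ e, e ∈ fs.bd F ↔ e ∈ (B i.castSucc).edges ∨ e ∈ (A i).edges := by
    intro i
    obtain ⟨F, hF, hFe⟩ := hf1 i i.2
    exact ⟨F, hF, fun e => by rw [hFe, FaceSystem.mem_cyclicEdges_theta, hBe, hAe]; rfl⟩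
  have hface2 : ∀ i : Fin k, ∃ F ∈ insideFaces ρ c,
      ∀ e, e ∈ fs.bd F ↔ e ∈ (A i).edges ∨ e ∈ (B i.succ).edges := by
    intro i
    obtain ⟨F, hF, hFe⟩ := hf2 i i.2
    refine ⟨F, hF, fun e => ?_⟩
    rw [hFe, FaceSystem.mem_cyclicEdges_theta, hBe, hAe, or_comm, Fin.val_succ, Nat.mul_add]
  have hface : ∀ F ∈ insideFaces ρ c, ∀ e ∈ fs.bd F,
      (∃ i, e ∈ (A i).edges) ∨ ∃ i, e ∈ (B i).edges := by
    intro F hF e he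
    obtain ⟨i, hi, hFe⟩ := hf F hF
    rcases hFe with hFe | hFe <;> rw [hFe, FaceSystem.mem_cyclicEdges_theta] at he <;>
      rcases he with he | he
    · exact .inr ⟨⟨i, by omega⟩, (hBe _ _).2 he⟩
    · exact .inl ⟨⟨i, hi⟩, (hAe _ _).2 he⟩
    · exact .inr ⟨⟨i + 1, by omega⟩, (hBe _ _).2 he⟩
    · exact .inl ⟨⟨i, hi⟩, (hAe _ _).2 he⟩
  have hfaceA : ∀ i, ∃ F ∈ insideFaces ρ c, ∀ e ∈ (A i).edges, e ∈ fs.bd F := by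
    intro i
    obtain ⟨F, hF, h⟩ := hface1 i
    exact ⟨F, hF, fun e he => (h e).2 (.inr he)⟩
  have hfaceB : ∀ i, ∃ F ∈ insideFaces ρ c, ∀ e ∈ (B i).edges, e ∈ fs.bd F := by
    intro i
    -- For `i < k` the path `B i` bounds the face before `A i`; the last path needs the face after
    -- `A (k - 1)`.
    induction i using Fin.lastCases with
    | last =>
      obtain ⟨F, hF, h⟩ := hface2 ⟨k - 1, by omega⟩
      have hl : Fin.succ ⟨k - 1, by omega⟩ = Fin.last k := Fin.ext (by simp; omega)
      rw [hl] at h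
      exact ⟨F, hF, fun e he => (h e).2 (.inr he)⟩
    | cast i =>
      obtain ⟨F, hF, h⟩ := hface1 i
      exact ⟨F, hF, fun e he => (h e).2 (.inl he)⟩
  have hCB : ∀ e, e ∈ C.edges ↔ e ∈ (B 0).edges ∨ e ∈ (B (Fin.last k)).edges := by
    intro e
    rw [hmemC, hBe, hBe]
    simp
  have hCBs : ∀ x, x ∈ C.support ↔ x ∈ (B 0).support ∨ x ∈ (B (Fin.last k)).support := by
    intro x
    rw [hsuppC, hBs, hBs]
    simp only [Fin.val_zero, Nat.mul_zero, Fin.val_last]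
    tauto
  have hadj : ∀ {u' v' : V} (p : G.graph.Walk u' v') (x y : V),
      p.toSubgraph.Adj x y ↔ s(x, y) ∈ p.edges := fun p x y => by
    rw [← SimpleGraph.Walk.mem_edges_toSubgraph, SimpleGraph.Subgraph.mem_edgeSet]
  refine ⟨u, (hsuppC u).2 (by simp), v, (hsuppC v).2 (by simp), huv, ?_, k, hk, A, B, ?_, ?_, ?_,
    ?_, ?_, ?_, ?_, ?_⟩
  · rw [hadj, hmemC]
    have h0 := hne 0 (by omega)
    have h1 := hne (3 * k) le_rfl
    simp [h0.2.symm, h1.2.symm, huv, h0.1.symm, h1.1.symm]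
  · intro i
    have h1 := hne (3 * i + 1) (by omega)
    have h2 := hne (3 * i + 2) (by omega)
    have h3 : t (3 * i + 1) ≠ t (3 * i + 2) := fun h => by
      have := ht (by omega) (by omega) h; omega
    refine ⟨?_, rfl⟩
    simp [A, SimpleGraph.Walk.cons_isPath_iff, h1.1.symm, h2.1.symm, h1.2, h2.2, h3, huv]
  · intro i
    have h1 := hne (3 * i) (by omega)
    refine ⟨?_, rfl⟩
    simp [B, SimpleGraph.Walk.cons_isPath_iff, h1.1.symm, h1.2, huv]
  · ext x y
    · simp only [SimpleGraph.Subgraph.verts_sup, Set.mem_union,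
        SimpleGraph.Walk.mem_verts_toSubgraph, hCBs]
    · simp only [SimpleGraph.Subgraph.sup_adj, hadj, hCB]
  · ext x y
    · simp only [SimpleGraph.Subgraph.verts_sup, SimpleGraph.Subgraph.verts_iSup, Set.mem_union,
        Set.mem_iUnion, SimpleGraph.Walk.mem_verts_toSubgraph]
      change G.pos x ∈ G.closedInside C ↔ _
      rw [pos_mem_closedInside_iff hG ρ (by norm_num) hinj hc hC hbd hD]
      constructor
      · rintro ⟨F, hF, e, he, hx⟩
        rcases hface F hF e he with ⟨i, hi⟩ | ⟨i, hi⟩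
        · exact .inl (.inr ⟨i, SimpleGraph.Walk.mem_support_of_mem_edges hi hx⟩)
        · exact .inr ⟨i, SimpleGraph.Walk.mem_support_of_mem_edges hi hx⟩
      · have hBx : ∀ i, x ∈ (B i).support → ∃ F ∈ insideFaces ρ c, fs.At F x := by
          intro i hi
          obtain ⟨F, hF, h⟩ := hfaceB i
          refine ⟨F, hF, ?_⟩
          rcases (hBs i x).1 hi with rfl | rfl | rfl
          · exact ⟨_, h _ ((hBe i _).2 (.inl rfl)), by simp⟩
          · exact ⟨_, h _ ((hBe i _).2 (.inl rfl)), by simp⟩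
          · exact ⟨_, h _ ((hBe i _).2 (.inr rfl)), by simp⟩
        rintro ((hx | ⟨i, hi⟩) | ⟨i, hi⟩)
        · rcases (hCBs x).1 hx with h | h
          exacts [hBx _ h, hBx _ h]
        · obtain ⟨F, hF, h⟩ := hfaceA i
          refine ⟨F, hF, ?_⟩
          rcases (hAs i x).1 hi with rfl | rfl | rfl | rfl
          · exact ⟨_, h _ ((hAe i _).2 (.inl rfl)), by simp⟩
          · exact ⟨_, h _ ((hAe i _).2 (.inl rfl)), by simp⟩
          · exact ⟨_, h _ ((hAe i _).2 (.inr (.inr rfl))), by simp⟩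
          · exact ⟨_, h _ ((hAe i _).2 (.inr (.inr rfl))), by simp⟩
        · exact hBx i hi
    · simp only [SimpleGraph.Subgraph.sup_adj, SimpleGraph.Subgraph.iSup_adj, hadj]
      change G.graph.Adj x y ∧ G.arc s(x, y) ⊆ G.closedInside C ↔ _
      constructor
      · rintro ⟨hxy, h⟩
        obtain ⟨F, hF, he⟩ :=
          (arc_subset_closedInside_iff hG ρ (by norm_num) hinj hc hC hbd hD hxy).1 h
        rcases hface F hF _ he with h | h
        exacts [.inl (.inr h), .inr h]
      · have key : (∃ F ∈ insideFaces ρ c, s(x, y) ∈ fs.bd F) →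
            G.graph.Adj x y ∧ G.arc s(x, y) ⊆ G.closedInside C := by
          rintro ⟨F, hF, he⟩
          have hxy := fs.bd_subset F he
          exact ⟨hxy, (arc_subset_closedInside_iff hG ρ (by norm_num) hinj hc hC hbd hD hxy).2
            ⟨F, hF, he⟩⟩
        have hBx : ∀ i, s(x, y) ∈ (B i).edges → ∃ F ∈ insideFaces ρ c, s(x, y) ∈ fs.bd F := by
          intro i hi
          obtain ⟨F, hF, h⟩ := hfaceB i
          exact ⟨F, hF, h _ hi⟩
        rintro ((hx | ⟨i, hi⟩) | ⟨i, hi⟩)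
        · rcases (hCB _).1 hx with h | h
          exacts [key (hBx _ h), key (hBx _ h)]
        · obtain ⟨F, hF, h⟩ := hfaceA i
          exact key ⟨F, hF, h _ hi⟩
        · exact key (hBx i hi)
  · intro i j hij w hw hw'
    rw [hAs] at hw hw'
    have hij' : (i : ℕ) ≠ j := fun h => hij (Fin.ext h)
    rcases hw with rfl | rfl | rfl | rfl
    · exact .inl rfl
    · rcases hw' with h | h | h | h
      · exact .inl h
      · have := ht (by omega) (by omega) h; omega
      · have := ht (by omega) (by omega) h; omega
      · exact .inr h
    · rcases hw' with h | h | h | h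
      · exact .inl h
      · have := ht (by omega) (by omega) h; omega
      · have := ht (by omega) (by omega) h; omega
      · exact .inr h
    · exact .inr rfl
  · intro i j hij w hw hw'
    rw [hBs] at hw hw'
    have hij' : (i : ℕ) ≠ j := fun h => hij (Fin.ext h)
    rcases hw with rfl | rfl | rfl
    · exact .inl rfl
    · rcases hw' with h | h | h
      · exact .inl h
      · have := ht (by omega) (by omega) h; omega
      · exact .inr h
    · exact .inr rfl
  · intro i j w hw hw'
    rw [hAs] at hw
    rw [hBs] at hw'
    rcases hw with rfl | rfl | rfl | rfl
    · exact .inl rfl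
    · rcases hw' with h | h | h
      · exact .inl h
      · have := ht (by omega) (by omega) h; omega
      · exact .inr h
    · rcases hw' with h | h | h
      · exact .inl h
      · have := ht (by omega) (by omega) h; omega
      · exact .inr h
    · exact .inr rfl
  · intro i
    obtain ⟨F, hF, h⟩ := hface1 i
    obtain ⟨F', hF', h'⟩ := hface2 i
    simp only [hbd] at h h'
    exact ⟨⟨F, F.2, face_subset_openInside hG ρ (by norm_num) hinj hc hC hF,
      hG.frontier_eq_union F.2 h⟩, F', F'.2,
      face_subset_openInside hG ρ (by norm_num) hinj hc hC hF', hG.frontier_eq_union F'.2 h'⟩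

end PlaneGraph

/-- `A 0, …, A (k - 1)` are the `k` paths of length 3. `B 0` and `B k` are the two `u`–`v` paths
of `C`, and `B 1, …, B (k - 1)` are the `k - 1` paths of length 2 through `Int(C)`. In the plane
the order from one side of `C` to the other is `B 0, A 0, B 1, A 1, …, A (k - 1), B k`. -/
theorem mainTheorem8 {V : Type*} [Finite V] (G : PlaneGraph V) (hG : G.IsPentagulation)
    {a : V} (C : G.graph.Walk a a) (hC : C.IsCycle) (hC4 : C.length = 4)
    (hdom : G.DominatesInterior C) :
    ∃ u ∈ C.support, ∃ v ∈ C.support, u ≠ v ∧ ¬ C.toSubgraph.Adj u v ∧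
      ∃ k : ℕ, 1 ≤ k ∧
        ∃ (A : Fin k → G.graph.Walk u v) (B : Fin (k + 1) → G.graph.Walk u v),
          (∀ i, (A i).IsPath ∧ (A i).length = 3) ∧
          (∀ i, (B i).IsPath ∧ (B i).length = 2) ∧
          C.toSubgraph = (B 0).toSubgraph ⊔ (B (Fin.last k)).toSubgraph ∧
          G.insideSubgraph C =
            C.toSubgraph ⊔ (⨆ i, (A i).toSubgraph) ⊔ (⨆ i, (B i).toSubgraph) ∧
          (∀ i j, i ≠ j → G.InternallyDisjoint (A i) (A j)) ∧
          (∀ i j, i ≠ j → G.InternallyDisjoint (B i) (B j)) ∧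
          (∀ i j, G.InternallyDisjoint (A i) (B j)) ∧
          (∀ i : Fin k, G.BoundFaceInside C (B i.castSucc) (A i) ∧
            G.BoundFaceInside C (A i) (B i.succ)) := by
  obtain ⟨ρ⟩ := G.nonempty_rootSystem
  obtain ⟨c, hinj, hc, -, hCe, hCs⟩ := hC.exists_cyclic hC4
  obtain ⟨fs, hbd, hdisk⟩ := PlaneGraph.exists_faceSystem hG ρ
  have hD := hdisk c (by norm_num) hinj hc
  have hdom' : fs.Dominates c (PlaneGraph.insideFaces ρ c) := by
    intro w hw
    obtain ⟨x, hx, hxw⟩ := hdom w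
      ((PlaneGraph.pos_mem_openInside_iff hG ρ (by norm_num) hinj hc hCe hbd).2 hw)
    obtain ⟨i, rfl⟩ := (hCs x).1 hx
    exact ⟨i, hxw⟩
  have := PlaneGraph.finite_faces hG
  rcases hD.strip hdom' with hs | hs
  · exact PlaneGraph.exists_walks_of_strip hG ρ hinj hc hCe hCs hbd hD hs
  -- Here the poles are `c 1` and `c 3`. Rotating the cycle by one step puts them in positions 0 and
  -- 2 and keeps the edges, hence also the set of inside faces.
  · have hD' := hdisk (fun i => c (i + 1)) (by norm_num) (hinj.comp (add_left_injective 1))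
      (fun i => hc (i + 1))
    have hS : PlaneGraph.insideFaces ρ (fun i => c (i + 1)) = PlaneGraph.insideFaces ρ c :=
      FaceSystem.eq_of_boundary (fs := fs)
        (by rw [hD'.boundary_eq, hD.boundary_eq, cyclicEdges_comp_add])
        hD'.out_notMem hD.out_notMem
    refine PlaneGraph.exists_walks_of_strip hG ρ hD'.injective hD'.adj
      (fun e => by rw [hCe, cyclicEdges_comp_add]) (fun x => ?_) hbd hD' (hS ▸ hs)
    rw [hCs]
    exact ⟨fun ⟨i, hi⟩ => ⟨i - 1, by simpa using hi⟩, fun ⟨i, hi⟩ => ⟨i + 1, hi⟩⟩
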